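/- **Setting.** Let $G=(V,E,w)$ be a weighted undirected simple graph with $V=\{0,\dots,n-1\}$, $n\ge 2$, and $m=|E|\ge n/2$ edges (as is the case if no vertex is isolated), whose edge weights are integers with $1\le w(e)\le n^{a}$ for a constant $a$. For $u\in V$, $\ell\ge 1$ and $W>0$ let $B^{\ell}(u,W)$ be the set of all vertices joined to $u$ by a path with at most $\ell$ edges and of weighted length at most $W$. An *$\ell$-limited $W$-neighborhood cover* of $G$ is a family of clusters $X_c\subseteq V$ such that 1. every cluster has strong diameter $O(W\log n)$, i.e. any two vertices of $X_c$ are joined by a path of weighted length $O(W\log n)$ all of whose vertices lie in $X_c$; 2. every vertex lies in $O(\log n)$ clusters; 3. for every $u\in V$ there is a cluster $X_c$ with $B^{\ell}(u,W)\subseteq X_c$. **Model.** In the MPC model there are $M$ machines with a memory of $S$ words each, a word having $O(\log n)$ bits. Initially the edges of $G$ (with their weights) are distributed arbitrarily over the machines, at most $\lfloor n^{\gamma}\rfloor$ edges on each, where $M\lfloor n^{\gamma}\rfloor\ge m$. In each synchronous round every machine performs an arbitrary local computation, with fresh private random words, on the content of its memory, and sends words to the machines (itself included); it sends at most $S$ words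 and receives at most $S$ words, and the words received are the content of its memory after the round. At the end, the machines hold pairs $(v,c)$ that say that $v\in X_c$. **Statement.** For all constants $a$ and $k$ there is a constant $C$, which also bounds all the constants hidden in $O(\cdot)$ above, such that for all $0<\gamma\le 1$ and all $n,m,\ell\ge 1$, $W>0$ (with $n\ge 2$ and $n\le 2m$) there is a randomized MPC algorithm, depending only on $a,k,\gamma,n,m,\ell,W$, that uses * at most $C\,n^{\gamma}$ words of memory per machine, * at most $C\,m\log^2 n$ words of memory overall ($M\cdot S\le C\,m\log^2 n$), * at most $C\,\frac{\ell}{\gamma}\log n$ rounds, and that, for every such graph $G$ with $n$ vertices and $m$ edges and every such distribution of its edges over the machines, always respects the memory and communication limits of the model and outputs an $\ell$-limited $W$-neighborhood cover of $G$ with probability at least $1-n^{-k}$. -/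

import Mathlib

/-! ### Weighted graphs, hop-limited balls, limited neighborhood covers -/

/-- The weighted length of a walk. -/
def walkWeight {n : ℕ} {G : SimpleGraph (Fin n)} (w : Sym2 (Fin n) → ℕ) {u v : Fin n}
    (p : G.Walk u v) : ℕ :=
  (p.edges.map w).sum

/-- The `ℓ`-hop limited ball `B^ℓ(v, r)`: all vertices that are joined to `v` by a path with at most
`ℓ` hops and of weighted length at most `r`. -/
def limitedBall {n : ℕ} (G : SimpleGraph (Fin n)) (w : Sym2 (Fin n) → ℕ) (ℓ : ℕ) (r : ℝ)
    (v : Fin n) : Set (Fin n) :=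
  {u | ∃ p : G.Walk v u, p.IsPath ∧ p.length ≤ ℓ ∧ (walkWeight w p : ℝ) ≤ r}

/-- The indexed family `X` of clusters is an `ℓ`-limited `W`-neighborhood cover of `(G, w)`, where
`K` is the constant hidden in the two `O(·)`s of the definition. -/
structure IsLimitedNeighborhoodCover {n : ℕ} (G : SimpleGraph (Fin n)) (w : Sym2 (Fin n) → ℕ)
    (ℓ : ℕ) (W K : ℝ) {ι : Type} (X : ι → Set (Fin n)) : Prop where
  /-- Every cluster has (strong) diameter `O(W log n)`: any two of its vertices are joined by a path
  of that length which stays inside the cluster. -/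
  diameter : ∀ c, ∀ x ∈ X c, ∀ y ∈ X c, ∃ p : G.Walk x y, p.IsPath ∧
    (∀ z ∈ p.support, z ∈ X c) ∧ (walkWeight w p : ℝ) ≤ K * W * Real.log n
  /-- Every vertex lies in `O(log n)` clusters. -/
  overlap : ∀ v, {c | v ∈ X c}.Finite ∧ ({c | v ∈ X c}.ncard : ℝ) ≤ K * Real.log n
  /-- The `ℓ`-hop limited ball of radius `W` around every vertex lies inside some cluster. -/
  covers : ∀ u, ∃ c, limitedBall G w ℓ W u ⊆ X c

/-! ### The model of massively parallel computation -/

/-- A randomized algorithm of the MPC model. There are `machines` machines, each with a memory of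
`memory` words, where a word is one of `0, …, wordSize - 1`; the algorithm takes `rounds` rounds.
In round `t`, machine `i` with memory content `l` and fresh private coins `ρ` (`memory` many
uniformly random words) sends the words `send t i l ρ j` to machine `j`. The content of a machine's
memory after the round is what it has received; it keeps data by sending them to itself. As usual in
this model, local computation is free. -/
structure MPCAlgorithm where
  machines : ℕ
  memory : ℕ
  wordSize : ℕ
  rounds : ℕ
  send : ℕ → Fin machines → List ℕ → (Fin memory → Fin wordSize) → Fin machines → List ℕ

namespace MPCAlgorithm

/-- The outcomes of all the coins: independent uniform words for every round and machine. -/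
abbrev Coins (A : MPCAlgorithm) : Type :=
  Fin A.rounds → Fin A.machines → Fin A.memory → Fin A.wordSize

/-- The contents of all memories after `t` rounds (nothing happens after the last round). A machine
receives its messages in the order of their senders. -/
def config (A : MPCAlgorithm) (init : Fin A.machines → List ℕ) (ω : A.Coins) :
    ℕ → Fin A.machines → List ℕ
  | 0 => init
  | t + 1 =>
    if h : t < A.rounds then
      fun j => (List.finRange A.machines).flatMap fun i =>
        A.send t i (config A init ω t i) (ω ⟨t, h⟩ i) j
    else config A init ω t

/-- The contents of all memories when the algorithm stops. -/
def output (A : MPCAlgorithm) (init : Fin A.machines → List ℕ) (ω : A.Coins) :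
    Fin A.machines → List ℕ :=
  A.config init ω A.rounds

/-- The constraints of the model hold, whatever the coins show: at any time every memory holds at
most `memory` words (so no machine ever receives more in a round), and in every round every machine
sends at most `memory` words altogether. -/
def ObeysLimits (A : MPCAlgorithm) (init : Fin A.machines → List ℕ) : Prop :=
  ∀ ω : A.Coins,
    (∀ t ≤ A.rounds, ∀ i, (A.config init ω t i).length ≤ A.memory ∧
      ∀ x ∈ A.config init ω t i, x < A.wordSize) ∧
    (∀ t : Fin A.rounds, ∀ i,
      ∑ j, (A.send t i (A.config init ω t i) (ω t i) j).length ≤ A.memory)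

/-- The probability, over the coins of the algorithm, that the output satisfies `good`. -/
noncomputable def successProb (A : MPCAlgorithm) (init : Fin A.machines → List ℕ)
    (good : (Fin A.machines → List ℕ) → Prop) : ℝ :=
  (Nat.card {ω : A.Coins // good (A.output init ω)} : ℝ) / (Nat.card A.Coins : ℝ)

end MPCAlgorithm

/-! ### Input and output formats -/

/-- `D` distributes the edges of `G` over `M` machines: every edge is recorded, in one of its two
orientations, exactly once. -/
def IsEdgeDistribution {n M : ℕ} (G : SimpleGraph (Fin n))
    (D : Fin M → List (Fin n × Fin n)) : Prop :=
  (((List.finRange M).flatMap D).map fun e => s(e.1, e.2)).Nodup ∧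
  ∀ e, e ∈ (((List.finRange M).flatMap D).map fun e => s(e.1, e.2)) ↔ e ∈ G.edgeSet

/-- The initial memory contents: an edge `uv` is stored as the three words `u`, `v`, `w(uv)`. -/
def edgeInput {n M : ℕ} (w : Sym2 (Fin n) → ℕ) (D : Fin M → List (Fin n × Fin n)) (i : Fin M) :
    List ℕ :=
  (D i).flatMap fun e => [(e.1 : ℕ), (e.2 : ℕ), w s(e.1, e.2)]

/-- A list of words, read as consecutive pairs. -/
def wordPairs : List ℕ → List (ℕ × ℕ)
  | x :: y :: l => (x, y) :: wordPairs l
  | _ => []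

/-- The clusters described by the memory contents `out`: a pair of words `v`, `c` in some memory
says that vertex `v` belongs to the cluster with name `c`. -/
def outputClusters (n : ℕ) {M : ℕ} (out : Fin M → List ℕ) (c : ℕ) : Set (Fin n) :=
  {v | ∃ i, ((v : ℕ), c) ∈ wordPairs (out i)}

/-! The cover comes from clustering by randomly shifted distances. Put h = min(ℓ, n), let r be W
rounded down and capped at n^(a+1), and charge an edge e the cost h·w(e) + r. A path with at most h
edges and weight at most r costs at most U = 2hr, so hop-limited balls lie in ordinary balls of the
cost metric. Conversely, a walk of cost O(b·h·r) has weight O(b·r). For r = 0 the cost is a constant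
that makes all clusters singletons.

Each vertex v draws a uniform b-bit number f(v), with b = O(log n), and gets the shift Λ·size(f(v)),
where Λ = 2U + 1 and `size` is the bit length. Every vertex x joins the v that minimises shift(v) +
dist(x, v). A shortest walk to the centre stays inside the cluster and costs at most bΛ, which
bounds the strong diameter (`exists_walk_in_cluster`). If, seen from u, one vertex wins by a margin
Λ, then every vertex within cost U of u joins it (`ball_subset_cluster`).

A margin occurs with constant probability. Halving a nonzero f(v) lowers its bit length by one,
which turns a win of v into a win by Λ, and halving is at most two-to-one. Up to the rare event f(v)
= 0, winning is thus at most twice as likely as winning by Λ, and summing over v gives probability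
at least 1/4 (`card_weak_le`, `card_gapWinner`). With T = Θ(log n) independent copies and a union
bound over u, every ball is covered in some copy (`prob_bad_le`). A vertex lies in one cluster per
copy, hence in at most T clusters.

All T copies are treated at once, as a graph with ν = Tn nodes. The label of a node is ν·(shift +
distance) + name of the centre. Minimising it breaks ties by name, and its remainder modulo ν names
the cluster. Labels are computed by Bellman–Ford. Initial labels are at most about νbΛ and every
edge adds at least νr, so no walk with more than about 5bh edges can improve a label, and 5bh = O(ℓ
log n) iterations reach a fixed point (`IsBellmanFord.fixed`).

An iteration takes O(1/γ) rounds. The two orientations of each edge are records sorted by source,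
each knowing the position of the other. Relaxation is one permutation routing, and the minimum over
all records with a common source comes from prefix maxima in both directions. Prefix computations
use windows that grow by a factor d = max(2, ⌊n^γ⌋) per round (`scanRounds_spec`). The initial
sorting costs one scan per bit of the key (`sortRounds_computes`). `toAlgorithm_spec` translates
such programs on arrays of cells into the MPC model. -/

/-! ### Memories with addressed slots, and their translation into the MPC model. -/

namespace CellMachine

/-- The payload of slot `s` in a memory whose words have the form `slot + D * payload`. -/
def decode (D : ℕ) (l : List ℕ) (s : Fin D) : ℕ :=
  ((l.filter fun x => x % D = s).map (· / D)).sum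

/-- The words `slot + D * payload` of all slots with a nonzero payload. -/
def encode {D : ℕ} (X : Fin D → ℕ) : List ℕ :=
  ((List.finRange D).filter fun s => X s ≠ 0).map fun s : Fin D => (s : ℕ) + D * X s

theorem decode_nil (D : ℕ) (s : Fin D) : decode D [] s = 0 := by simp [decode]

theorem decode_append (D : ℕ) (l l' : List ℕ) (s : Fin D) :
    decode D (l ++ l') s = decode D l s + decode D l' s := by
  simp [decode]

theorem decode_flatMap {ι : Type*} (D : ℕ) (L : List ι) (f : ι → List ℕ) (s : Fin D) :
    decode D (L.flatMap f) s = (L.map fun i => decode D (f i) s).sum := by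
  induction L with
  | nil => simp [decode_nil]
  | cons a L ih => simp [decode_append, ih]

theorem decode_flatMap_finRange {M : ℕ} (D : ℕ) (f : Fin M → List ℕ) (s : Fin D) :
    decode D ((List.finRange M).flatMap f) s = ∑ i, decode D (f i) s := by
  rw [decode_flatMap, Fin.sum_univ_def]

/-- Slot and payload are the remainder and the quotient of a word modulo `D`. A slot without a word
decodes to 0, so zero payloads need not be stored. -/
theorem decode_encode {D : ℕ} (X : Fin D → ℕ) : decode D (encode X) = X := by
  funext s
  have hD : 0 < D := s.pos
  have key : ∀ L : List (Fin D), L.Nodup →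
      decode D ((L.filter fun s => X s ≠ 0).map fun s : Fin D => (s : ℕ) + D * X s) s =
        if s ∈ L then X s else 0 := by
    intro L hL
    induction L with
    | nil => simp [decode_nil]
    | cons a L ih =>
      rw [List.nodup_cons] at hL
      have ih := ih hL.2
      have h1 : ((a : ℕ) + D * X a) % D = a := by
        rw [Nat.add_mul_mod_self_left, Nat.mod_eq_of_lt a.2]
      have h2 : ((a : ℕ) + D * X a) / D = X a := by
        rw [Nat.add_mul_div_left _ _ hD, Nat.div_eq_of_lt a.2, zero_add]
      by_cases hXa : X a = 0
      · rw [List.filter_cons_of_neg (by simpa using hXa), ih]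
        by_cases hs : s = a
        · subst hs; simp [hXa]
        · simp [hs]
      · rw [List.filter_cons_of_pos (by simpa using hXa), List.map_cons,
          ← List.singleton_append, decode_append, ih]
        by_cases hs : s = a
        · subst hs
          simp [decode, h1, h2, hL.1]
        · have : (a : ℕ) ≠ s := fun h => hs (Fin.ext h.symm)
          simp [decode, h1, this, hs]
  have := key _ (List.nodup_finRange D)
  simpa [encode] using this

theorem length_encode {D : ℕ} (X : Fin D → ℕ) :
    (encode X).length = (Finset.univ.filter fun s => X s ≠ 0).card := by
  rw [encode, List.length_map, Finset.card_def]
  rfl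

theorem lt_of_mem_encode {D K Q : ℕ} {X : Fin D → ℕ} (hX : ∀ s, X s < K) (hQ : D * K ≤ Q) {x : ℕ}
    (hx : x ∈ encode X) : x < Q := by
  simp only [encode, List.mem_map, List.mem_filter] at hx
  obtain ⟨s, -, rfl⟩ := hx
  calc (s : ℕ) + D * X s < D + D * X s := by have := s.2; omega
    _ = D * (X s + 1) := by ring
    _ ≤ D * K := Nat.mul_le_mul_left _ (hX s)
    _ ≤ Q := hQ

/-- One synchronous round: the payloads that machine `i`, with memory content `X` and coins `c`,
sends to the slots of the other machines; a payload `0` stands for no message. -/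
abbrev Round (M D : ℕ) : Type :=
  Fin M → (Fin D → ℕ) → (ℕ → ℕ) → Fin M → Fin D → ℕ

/-- The memory contents after a round. -/
def step {M D : ℕ} (r : Round M D) (c : Fin M → ℕ → ℕ) (X : Fin M → Fin D → ℕ) :
    Fin M → Fin D → ℕ :=
  fun j s => ∑ i, r i (X i) (c i) j s

/-- The round respects the limits: every slot receives at most one message, no machine sends more
than `mem` messages, and all payloads are less than `K`. -/
structure StepOK {M D : ℕ} (mem K : ℕ) (r : Round M D) (c : Fin M → ℕ → ℕ)
    (X : Fin M → Fin D → ℕ) : Prop where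
  unique : ∀ j s i i', r i (X i) (c i) j s ≠ 0 → r i' (X i') (c i') j s ≠ 0 → i = i'
  sends : ∀ i, ∑ j, (Finset.univ.filter fun s => r i (X i) (c i) j s ≠ 0).card ≤ mem
  bound : ∀ i j s, r i (X i) (c i) j s < K

/-- Executing the rounds `rs` with coins `c` leads from `X` to `Y`, within the limits. -/
def Exec {M D : ℕ} (mem K : ℕ) : List (Round M D) → (ℕ → Fin M → ℕ → ℕ) →
    (Fin M → Fin D → ℕ) → (Fin M → Fin D → ℕ) → Prop
  | [], _, X, Y => X = Y
  | r :: rs, c, X, Y => StepOK mem K r (c 0) X ∧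
      Exec mem K rs (fun t => c (t + 1)) (step r (c 0) X) Y

theorem Exec.append {M D mem K : ℕ} {rs rs' : List (Round M D)} {c : ℕ → Fin M → ℕ → ℕ}
    {X Y Z : Fin M → Fin D → ℕ} (h : Exec mem K rs c X Y)
    (h' : Exec mem K rs' (fun t => c (t + rs.length)) Y Z) : Exec mem K (rs ++ rs') c X Z := by
  induction rs generalizing c X with
  | nil => cases h; exact h'
  | cons r rs ih =>
    refine ⟨h.1, ih h.2 ?_⟩
    simpa [add_assoc, add_comm, add_left_comm] using h'

/-- The recursion over the list of rounds becomes a sequence indexed by time, which can be compared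
with `config` by induction. -/
theorem Exec.exists_trace {M D mem K : ℕ} {rs : List (Round M D)} {c : ℕ → Fin M → ℕ → ℕ}
    {X Y : Fin M → Fin D → ℕ} (h : Exec mem K rs c X Y) :
    ∃ Z : ℕ → Fin M → Fin D → ℕ, Z 0 = X ∧ Z rs.length = Y ∧
      ∀ t (ht : t < rs.length), StepOK mem K rs[t] (c t) (Z t) ∧
        Z (t + 1) = step rs[t] (c t) (Z t) := by
  induction rs generalizing c X with
  | nil => exact ⟨fun _ => X, rfl, h, fun t ht => by simp at ht⟩
  | cons r rs ih =>
    obtain ⟨Z, hZ0, hZl, hZ⟩ := ih h.2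
    refine ⟨fun t => Nat.casesOn t X Z, rfl, by simpa using hZl, ?_⟩
    intro t ht
    cases t with
    | zero => exact ⟨h.1, hZ0⟩
    | succ t => exact hZ t (by simpa using ht)

/-- The coins of a machine, as a function on all natural numbers. -/
def coinFun {mem Q : ℕ} (ρ : Fin mem → Fin Q) (o : ℕ) : ℕ :=
  if h : o < mem then ρ ⟨o, h⟩ else 0

/-- The algorithm that reads its input by `inp`, executes the rounds `rs` and outputs by `out`. -/
def toAlgorithm {M D : ℕ} (mem Q : ℕ) (inp : Fin M → List ℕ → Fin D → ℕ)
    (rs : List (Round M D)) (out : (Fin D → ℕ) → List ℕ) : MPCAlgorithm where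
  machines := M
  memory := mem
  wordSize := Q
  rounds := rs.length + 2
  send t i l ρ j := match t with
    | 0 => if j = i then encode (inp i l) else []
    | t + 1 => if h : t < rs.length then encode (rs[t] i (decode D l) (coinFun ρ) j)
        else if j = i then out (decode D l) else []

section

variable {M D mem K Q : ℕ} {inp : Fin M → List ℕ → Fin D → ℕ} {rs : List (Round M D)}
  {out : (Fin D → ℕ) → List ℕ}

/-- The coins that are available in the rounds `rs`. -/
def roundCoins (ω : (toAlgorithm mem Q inp rs out).Coins) (t : ℕ) (i : Fin M) (o : ℕ) : ℕ :=
  if h : t + 1 < rs.length + 2 then coinFun (ω ⟨t + 1, h⟩ i) o else 0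

theorem roundCoins_eq (ω : (toAlgorithm mem Q inp rs out).Coins) {t : ℕ}
    (h : t + 1 < rs.length + 2) (i : Fin M) : roundCoins ω t i = coinFun (ω ⟨t + 1, h⟩ i) := by
  funext o
  unfold roundCoins
  exact dif_pos h

theorem config_succ (A : MPCAlgorithm) (init : Fin A.machines → List ℕ) (ω : A.Coins) {t : ℕ}
    (h : t < A.rounds) (j : Fin A.machines) :
    A.config init ω (t + 1) j = (List.finRange A.machines).flatMap fun i =>
      A.send t i (A.config init ω t i) (ω ⟨t, h⟩ i) j := by
  rw [MPCAlgorithm.config, dif_pos h]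

theorem flatMap_finRange_ite {M : ℕ} (j : Fin M) (f : Fin M → List ℕ) :
    ((List.finRange M).flatMap fun i => if j = i then f i else []) = f j := by
  have key : ∀ L : List (Fin M), L.Nodup →
      (L.flatMap fun i => if j = i then f i else []) = if j ∈ L then f j else [] := by
    intro L hL
    induction L with
    | nil => simp
    | cons a L ih =>
      rw [List.nodup_cons] at hL
      rw [List.flatMap_cons, ih hL.2]
      by_cases h : j = a
      · subst h; simp [hL.1]
      · simp [h]
  simpa using key _ (List.nodup_finRange M)

theorem sum_length_ite {M : ℕ} (i : Fin M) (l : List ℕ) :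
    (∑ j, (if j = i then l else []).length) = l.length := by
  rw [Finset.sum_eq_single i] <;> simp +contextual

/-- Different senders address disjoint sets of slots, and there are only `D` slots. This bounds what
a machine receives. -/
theorem length_flatMap_encode_le {M D : ℕ} {f : Fin M → Fin D → ℕ}
    (h : ∀ s i i', f i s ≠ 0 → f i' s ≠ 0 → i = i') :
    ((List.finRange M).flatMap fun i => encode (f i)).length ≤ D := by
  have h1 : ((List.finRange M).flatMap fun i => encode (f i)).length =
      ∑ i, (Finset.univ.filter fun s => f i s ≠ 0).card := by
    rw [List.length_flatMap, Fin.sum_univ_def]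
    simp only [length_encode]
  rw [h1, ← Finset.card_biUnion]
  · exact (Finset.card_le_univ _).trans (by simp)
  · intro i _ i' _ hii
    rw [Function.onFun, Finset.disjoint_left]
    intro s hs hs'
    simp only [Finset.mem_filter, Finset.mem_univ, true_and] at hs hs'
    exact hii (h s i i' hs hs')

/-- If, whatever the coins show, the rounds can be executed within the limits, then the algorithm
obeys the limits, and its output is read off from the result of the execution. -/
theorem toAlgorithm_spec (hDm : D ≤ mem) (hQ : D * K ≤ Q) {init : Fin M → List ℕ}
    (hlen : ∀ i, (init i).length ≤ mem) (hword : ∀ i, ∀ x ∈ init i, x < Q)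
    (hinp : ∀ i s, inp i (init i) s < K)
    (Y : (toAlgorithm mem Q inp rs out).Coins → Fin M → Fin D → ℕ)
    (hY : ∀ ω, Exec mem K rs (roundCoins ω) (fun i => inp i (init i)) (Y ω))
    (hout : ∀ ω i, (out (Y ω i)).length ≤ mem ∧ ∀ x ∈ out (Y ω i), x < Q) :
    (toAlgorithm mem Q inp rs out).ObeysLimits init ∧
      ∀ ω, (toAlgorithm mem Q inp rs out).output init ω = fun i => out (Y ω i) := by
  let A := toAlgorithm mem Q inp rs out
  -- The memories after round `t + 1` represent `Z t`; the shift by one is the initial round that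
  -- reads the input.
  have main : ∀ ω : A.Coins, ∃ Z : ℕ → Fin M → Fin D → ℕ, Z rs.length = Y ω ∧
      (∀ t (ht : t < rs.length), StepOK mem K rs[t] (roundCoins ω t) (Z t)) ∧
      ∀ t ≤ rs.length, ∀ i, decode D (A.config init ω (t + 1) i) = Z t i ∧
        (A.config init ω (t + 1) i).length ≤ D ∧
        ∀ x ∈ A.config init ω (t + 1) i, x < Q := by
    intro ω
    obtain ⟨Z, hZ0, hZl, hZ⟩ := (hY ω).exists_trace
    refine ⟨Z, hZl, fun t ht => (hZ t ht).1, ?_⟩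
    intro t
    induction t with
    | zero =>
      intro _ i
      have hc : A.config init ω 1 i = encode (inp i (init i)) := by
        have h0 : 0 < A.rounds := Nat.succ_pos _
        refine (config_succ A init ω h0 i).trans ?_
        exact flatMap_finRange_ite i fun i' => encode (inp i' (init i'))
      rw [hc, hZ0]
      refine ⟨decode_encode _, ?_, fun x hx => lt_of_mem_encode (hinp i) hQ hx⟩
      rw [length_encode]
      exact (Finset.card_le_univ _).trans (by simp)
    | succ t ih =>
      intro ht j
      have ht' : t < rs.length := ht
      have hr : t + 1 < A.rounds := by change t + 1 < rs.length + 2; omega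
      have hr' : t + 1 < rs.length + 2 := hr
      have hcoin : ∀ i, coinFun (ω ⟨t + 1, hr⟩ i) = roundCoins ω t i := by
        intro i; exact (roundCoins_eq ω hr' i).symm
      have hc : A.config init ω (t + 1 + 1) j = (List.finRange M).flatMap fun i =>
          encode (rs[t] i (Z t i) (roundCoins ω t i) j) := by
        refine (config_succ A init ω hr j).trans ?_
        change ((List.finRange M).flatMap fun i =>
          A.send (t + 1) i (A.config init ω (t + 1) i) (ω ⟨t + 1, hr⟩ i) j) = _
        congr 1
        funext i
        change (if h : t < rs.length then encode (rs[t] i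
          (decode D (A.config init ω (t + 1) i)) (coinFun (ω ⟨t + 1, hr⟩ i)) j) else _) = _
        rw [dif_pos ht', (ih ht'.le i).1, hcoin]
      rw [hc]
      refine ⟨?_, length_flatMap_encode_le fun s i i' => (hZ t ht').1.unique j s i i', ?_⟩
      · funext s
        rw [decode_flatMap_finRange, (hZ t ht').2]
        simp only [decode_encode, step]
      · intro x hx
        obtain ⟨i, -, hx⟩ := List.mem_flatMap.1 hx
        exact lt_of_mem_encode (fun s => (hZ t ht').1.bound i j s) hQ hx
  have last : ∀ ω : A.Coins, A.config init ω (rs.length + 1 + 1) = fun i => out (Y ω i) := by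
    intro ω
    obtain ⟨Z, hZl, -, hZ⟩ := main ω
    funext j
    have hr : rs.length + 1 < A.rounds := by change rs.length + 1 < rs.length + 2; omega
    refine (config_succ A init ω hr j).trans ?_
    change ((List.finRange M).flatMap fun i => A.send (rs.length + 1) i
      (A.config init ω (rs.length + 1) i) (ω ⟨rs.length + 1, hr⟩ i) j) = _
    have : ∀ i, A.send (rs.length + 1) i (A.config init ω (rs.length + 1) i)
        (ω ⟨rs.length + 1, hr⟩ i) j = if j = i then out (Y ω i) else [] := by
      intro i
      change (if h : rs.length < rs.length then _ else if j = i then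
        out (decode D (A.config init ω (rs.length + 1) i)) else []) = _
      rw [dif_neg (lt_irrefl _), (hZ _ le_rfl i).1, hZl]
    simp only [this]
    exact flatMap_finRange_ite j fun i => out (Y ω i)
  refine ⟨fun ω => ⟨?_, ?_⟩, last⟩
  · intro t ht i
    obtain ⟨Z, hZl, -, hZ⟩ := main ω
    rcases t with _ | t
    · exact ⟨hlen i, hword i⟩
    · have ht' : t + 1 ≤ rs.length + 2 := ht
      rcases Nat.lt_or_ge rs.length t with h | h
      · have : t = rs.length + 1 := by omega
        subst this
        have := hout ω i
        rw [← congrFun (last ω) i] at this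
        exact this
      · exact ⟨(hZ t h i).2.1.trans hDm, (hZ t h i).2.2⟩
  · intro ⟨t, ht⟩ i
    obtain ⟨Z, hZl, hZs, hZ⟩ := main ω
    have ht' : t < rs.length + 2 := ht
    rcases t with _ | t
    · change (∑ j, (if j = i then encode (inp i (init i)) else []).length) ≤ mem
      rw [sum_length_ite, length_encode]
      exact ((Finset.card_le_univ _).trans (by simp)).trans hDm
    · by_cases h : t < rs.length
      · have hcoin : coinFun (ω ⟨t + 1, ht⟩ i) = roundCoins ω t i := by
          exact (roundCoins_eq ω ht' i).symm
        change (∑ j, (if h : t < rs.length then encode (rs[t] i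
          (decode D (A.config init ω (t + 1) i)) (coinFun (ω ⟨t + 1, ht⟩ i)) j) else _).length)
          ≤ mem
        simp only [dif_pos h, (hZ t h.le i).1, hcoin, length_encode]
        exact (hZs t h).sends i
      · have : t = rs.length := by omega
        subst this
        change (∑ j, (if h : rs.length < rs.length then _ else if j = i then
          out (decode D (A.config init ω (rs.length + 1) i)) else []).length) ≤ mem
        simp only [dif_neg (lt_irrefl _), (hZ _ le_rfl i).1, hZl]
        rw [sum_length_ite]
        exact (hout ω i).1

end

end CellMachine

/-! ### Arrays distributed over the machines, and routing between cells. -/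

namespace CellMachine

/-- Slot `o` of the main half of a memory. -/
def mainSlot {d : ℕ} (o : Fin d) : Fin (2 * d) := ⟨o, by omega⟩

/-- Slot `o` of the auxiliary half of a memory. -/
def auxSlot {d : ℕ} (o : Fin d) : Fin (2 * d) := ⟨d + o, by omega⟩

/-- The array `x`, distributed over the main halves of the memories in blocks of length `d`. -/
def ofArray (M d : ℕ) (x : ℕ → ℕ) : Fin M → Fin (2 * d) → ℕ :=
  fun i s => if (s : ℕ) < d then x (i * d + s) else 0

theorem ofArray_mainSlot {M d : ℕ} (x : ℕ → ℕ) (i : Fin M) (o : Fin d) :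
    ofArray M d x i (mainSlot o) = x (i * d + o) := by
  simp [ofArray, mainSlot]

theorem address_lt {M d : ℕ} (i : Fin M) {o : ℕ} (ho : o < d) : i * d + o < M * d := by
  have := Nat.mul_le_mul_right d i.2
  rw [Nat.succ_mul] at this
  omega

theorem address_inj {d i i' o o' : ℕ} (ho : o < d) (ho' : o' < d)
    (h : i * d + o = i' * d + o') : i = i' ∧ o = o' := by
  have hd : 0 < d := by omega
  have h1 : (i * d + o) / d = i := by
    rw [mul_comm, Nat.mul_add_div hd, Nat.div_eq_of_lt ho, add_zero]
  have h2 : (i' * d + o') / d = i' := by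
    rw [mul_comm, Nat.mul_add_div hd, Nat.div_eq_of_lt ho', add_zero]
  have : i = i' := by rw [← h1, ← h2, h]
  subst this
  exact ⟨rfl, by omega⟩

theorem ofArray_congr {M d : ℕ} {x y : ℕ → ℕ} (h : ∀ p < M * d, x p = y p) :
    ofArray M d x = ofArray M d y := by
  funext i s
  unfold ofArray
  split_ifs with hs
  · exact h _ (address_lt i hs)
  · rfl

theorem sum_blocks {α : Type*} [AddCommMonoid α] (M d : ℕ) (F : ℕ → α) :
    ∑ i : Fin M, ∑ o : Fin d, F (i * d + o) = ∑ p ∈ Finset.range (M * d), F p := by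
  rw [Finset.sum_range, ← Fintype.sum_prod_type', ← finProdFinEquiv.sum_comp]
  refine Finset.sum_congr rfl fun x _ => ?_
  simp [finProdFinEquiv, mul_comm, add_comm]

/-- Bounds the number of messages sent by one machine: every message has a tag in `κ`, and a tag
determines the destination. -/
theorem sum_card_le {M D : ℕ} {κ : Type*} [Fintype κ] {out : Fin M → Fin D → ℕ}
    (r : Fin M × Fin D → κ → Prop) (h : ∀ j s, out j s ≠ 0 → ∃ b, r (j, s) b)
    (hr : ∀ b x y, r x b → r y b → x = y) :
    ∑ j, (Finset.univ.filter fun s => out j s ≠ 0).card ≤ Fintype.card κ := by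
  classical
  rw [← Finset.card_sigma]
  refine Finset.card_le_card_of_forall_subsingleton (t := Finset.univ)
    (fun a b => r (a.1, a.2) b) ?_ ?_
  · intro a ha
    simp only [Finset.mem_sigma, Finset.mem_univ, Finset.mem_filter, true_and] at ha
    obtain ⟨b, hb⟩ := h _ _ ha
    exact ⟨b, Finset.mem_univ _, hb⟩
  · intro b _ x hx y hy
    have := hr b _ _ hx.2 hy.2
    simp only [Prod.mk.injEq] at this
    exact Sigma.ext this.1 (heq_of_eq this.2)

/-- Every cell `p` with content `v` and coin `c` sends `f p v c` to the cell `dst p v`. -/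
def routeRound (M d : ℕ) (dst : ℕ → ℕ → ℕ) (f : ℕ → ℕ → ℕ → ℕ) : Round M (2 * d) :=
  fun i X c j s => if (s : ℕ) < d then
    ∑ o : Fin d, if dst (i * d + o) (X (mainSlot o)) = j * d + s then
      f (i * d + o) (X (mainSlot o)) (c o) else 0
  else 0

/-- The array after `routeRound`. -/
def routeArray (P : ℕ) (dst : ℕ → ℕ → ℕ) (f : ℕ → ℕ → ℕ → ℕ) (c x : ℕ → ℕ) : ℕ → ℕ :=
  fun q => ∑ p ∈ Finset.range P, if dst p (x p) = q then f p (x p) (c p) else 0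

theorem routeArray_apply {P : ℕ} {dst : ℕ → ℕ → ℕ} {f : ℕ → ℕ → ℕ → ℕ} {c x : ℕ → ℕ}
    (hinj : ∀ p < P, ∀ p' < P, f p (x p) (c p) ≠ 0 → f p' (x p') (c p') ≠ 0 →
      dst p (x p) = dst p' (x p') → p = p')
    {p : ℕ} (hp : p < P) (hf : f p (x p) (c p) ≠ 0) :
    routeArray P dst f c x (dst p (x p)) = f p (x p) (c p) := by
  rw [routeArray, Finset.sum_eq_single p]
  · simp
  · intro q hq hqp
    by_contra h
    simp only [ite_eq_right_iff, Classical.not_imp] at h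
    exact hqp (hinj q (Finset.mem_range.1 hq) p hp h.2 hf h.1)
  · intro h; exact absurd (Finset.mem_range.2 hp) h

theorem routeArray_eq_zero {P : ℕ} {dst : ℕ → ℕ → ℕ} {f : ℕ → ℕ → ℕ → ℕ} {c x : ℕ → ℕ} {q : ℕ}
    (h : ∀ p < P, f p (x p) (c p) ≠ 0 → dst p (x p) ≠ q) : routeArray P dst f c x q = 0 := by
  refine Finset.sum_eq_zero fun p hp => ?_
  by_contra h'
  simp only [ite_eq_right_iff, Classical.not_imp] at h'
  exact h p (Finset.mem_range.1 hp) h'.2 h'.1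

/-- Only cells with a nonzero message need distinct destinations. Then every sum over senders has at
most one nonzero term, so there are no collisions and payloads stay below `K`. -/
theorem routeRound_spec {M d mem K : ℕ} (hmem : d ≤ mem) {dst : ℕ → ℕ → ℕ}
    {f : ℕ → ℕ → ℕ → ℕ} {c : Fin M → ℕ → ℕ} {c' x : ℕ → ℕ} (hK : 0 < K)
    (hf : ∀ p < M * d, f p (x p) (c' p) < K)
    (hc : ∀ (i : Fin M) (o : Fin d), c i o = c' (i * d + o))
    (hinj : ∀ p < M * d, ∀ p' < M * d, f p (x p) (c' p) ≠ 0 → f p' (x p') (c' p') ≠ 0 →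
      dst p (x p) = dst p' (x p') → p = p') :
    StepOK mem K (routeRound M d dst f) c (ofArray M d x) ∧
      step (routeRound M d dst f) c (ofArray M d x) =
        ofArray M d (routeArray (M * d) dst f c' x) := by
  have hr : ∀ (i j : Fin M) (s : Fin (2 * d)), (s : ℕ) < d →
      routeRound M d dst f i (ofArray M d x i) (c i) j s = ∑ o : Fin d,
        if dst (i * d + o) (x (i * d + o)) = j * d + s then
          f (i * d + o) (x (i * d + o)) (c' (i * d + o)) else 0 := by
    intro i j s hs
    simp [routeRound, hs, ofArray_mainSlot, hc]
  have hr0 : ∀ (i j : Fin M) (s : Fin (2 * d)), ¬ (s : ℕ) < d →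
      routeRound M d dst f i (ofArray M d x i) (c i) j s = 0 := by
    intro i j s hs
    simp [routeRound, hs]
  have hne : ∀ (i j : Fin M) (s : Fin (2 * d)),
      routeRound M d dst f i (ofArray M d x i) (c i) j s ≠ 0 → (s : ℕ) < d ∧ ∃ o : Fin d,
        dst (i * d + o) (x (i * d + o)) = j * d + s ∧
        f (i * d + o) (x (i * d + o)) (c' (i * d + o)) ≠ 0 := by
    intro i j s h
    by_cases hs : (s : ℕ) < d
    · rw [hr i j s hs] at h
      obtain ⟨o, -, ho⟩ := Finset.exists_ne_zero_of_sum_ne_zero h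
      simp only [ne_eq, ite_eq_right_iff, Classical.not_imp] at ho
      exact ⟨hs, o, ho⟩
    · exact absurd (hr0 i j s hs) h
  refine ⟨⟨?_, ?_, ?_⟩, ?_⟩
  · intro j s i i' h h'
    obtain ⟨hs, o, ho, hfo⟩ := hne i j s h
    obtain ⟨-, o', ho', hfo'⟩ := hne i' j s h'
    have := hinj _ (address_lt i o.2) _ (address_lt i' o'.2) hfo hfo' (ho.trans ho'.symm)
    exact Fin.ext (address_inj o.2 o'.2 this).1
  · intro i
    refine (sum_card_le (κ := Fin d)
      (fun js o => dst (i * d + o) (x (i * d + o)) = js.1 * d + js.2 ∧ (js.2 : ℕ) < d) ?_ ?_).trans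
      (by simpa using hmem)
    · intro j s h
      obtain ⟨hs, o, ho, -⟩ := hne i j s h
      exact ⟨o, ho, hs⟩
    · rintro o ⟨j, s⟩ ⟨j', s'⟩ ⟨h1, h2⟩ ⟨h3, h4⟩
      have := address_inj h2 h4 (h1.symm.trans h3)
      exact Prod.ext (Fin.ext this.1) (Fin.ext this.2)
  · intro i j s
    by_cases h : routeRound M d dst f i (ofArray M d x i) (c i) j s = 0
    · rw [h]; exact hK
    · obtain ⟨hs, o, ho, hfo⟩ := hne i j s h
      rw [hr i j s hs, Finset.sum_eq_single o]
      · rw [if_pos ho]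
        exact hf _ (address_lt i o.2)
      · intro o' _ hoo
        by_contra h'
        simp only [ite_eq_right_iff, Classical.not_imp] at h'
        have := hinj _ (address_lt i o.2) _ (address_lt i o'.2) hfo h'.2 (ho.trans h'.1.symm)
        exact hoo (Fin.ext (address_inj o.2 o'.2 this).2).symm
      · simp
  · funext j s
    by_cases hs : (s : ℕ) < d
    · simp only [step, hr _ _ s hs, ofArray, hs, if_true]
      exact sum_blocks M d fun p => if dst p (x p) = j * d + s then f p (x p) (c' p) else 0
    · simp only [step, hr0 _ _ s hs, ofArray, hs, if_false, Finset.sum_const_zero]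

/-! ### Prefix sums in a commutative monoid by windows of growing length. -/

section Scan

variable {M d : ℕ} {α : Type} [AddCommMonoid α] (e : α ≃ ℕ) (g : ℕ → ℕ → α)

/-- Every machine sends the sum over its block to the next machine. -/
def scanFirst (M d : ℕ) (e : α ≃ ℕ) (g : ℕ → ℕ → α) : Round M (2 * d) := fun i X _ j s =>
  if (s : ℕ) < d then (if j = i then X s else 0)
  else if (s : ℕ) = d ∧ (j : ℕ) = i + 1 then
    e (∑ o : Fin d, g (i * d + o) (X (mainSlot o))) else 0

/-- Every machine sends the sum over its window to the machines at the distances `0, z, 2 * z, …`. -/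
def scanMiddle (M d : ℕ) (e : α ≃ ℕ) (z : ℕ) : Round M (2 * d) := fun i X _ j s =>
  if (s : ℕ) < d then (if j = i then X s else 0)
  else if (j : ℕ) = i + (s - d) * z then e (∑ o : Fin d, e.symm (X (auxSlot o))) else 0

/-- Every machine updates its block, given the sum over all preceding blocks. -/
def scanLast (M d : ℕ) (e : α ≃ ℕ) (g : ℕ → ℕ → α) (f : ℕ → ℕ → α → ℕ) : Round M (2 * d) :=
  fun i X _ j s =>
  if (s : ℕ) < d then (if j = i then f (i * d + s) (X s)
    ((∑ o : Fin d, e.symm (X (auxSlot o))) +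
      ∑ o : Fin d, if (o : ℕ) < s then g (i * d + o) (X (mainSlot o)) else 0) else 0)
  else 0

/-- The rounds that replace the content `v` of each cell `p` by `f p v b`, where `b` is the sum of
the values `g q u` over all preceding cells `q` with contents `u`; here `d ^ H` is at least `M`. -/
def scanRounds (M d H : ℕ) (e : α ≃ ℕ) (g : ℕ → ℕ → α) (f : ℕ → ℕ → α → ℕ) :
    List (Round M (2 * d)) :=
  scanFirst M d e g :: ((List.range H).map fun h => scanMiddle M d e (d ^ h)) ++
    [scanLast M d e g f]

theorem length_scanRounds (H : ℕ) (f : ℕ → ℕ → α → ℕ) :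
    (scanRounds M d H e g f).length = H + 2 := by
  simp [scanRounds]

/-- The sum over the `z` blocks before block `i`. -/
def windowSum (M d : ℕ) (g : ℕ → ℕ → α) (x : ℕ → ℕ) (z i : ℕ) : α :=
  ∑ p ∈ (Finset.range (M * d)).filter fun p => p / d < i ∧ i ≤ p / d + z, g p (x p)

/-- The main halves hold `x`, the auxiliary halves the sums over windows of length `z`. -/
structure ScanInv (M d : ℕ) (e : α ≃ ℕ) (g : ℕ → ℕ → α) (x : ℕ → ℕ) (z : ℕ)
    (X : Fin M → Fin (2 * d) → ℕ) : Prop where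
  main : ∀ i (s : Fin (2 * d)), (s : ℕ) < d → X i s = x (i * d + s)
  aux : ∀ i, ∑ o : Fin d, e.symm (X i (auxSlot o)) = windowSum M d g x z i

theorem sum_shift {M : ℕ} (j : Fin M) (k : ℕ) (F : ℕ → ℕ) :
    (∑ i : Fin M, if (j : ℕ) = i + k then F i else 0) = if k ≤ j then F (j - k) else 0 := by
  split_ifs with h
  · rw [Finset.sum_eq_single ⟨j - k, by omega⟩]
    · rw [if_pos (by simp; omega)]
    · intro i _ hi
      rw [if_neg]
      intro h'
      exact hi (Fin.ext (by simp; omega))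
    · simp
  · exact Finset.sum_eq_zero fun i _ => if_neg (by omega)

/-- The `z * d` blocks before block `j` split into `d` runs of `z` blocks, the `o`-th run being the
window of block `j - o * z`. Runs that would start from a negative index are empty. -/
theorem windowSum_mul {z : ℕ} (hz : 0 < z) (x : ℕ → ℕ) (j : ℕ) :
    windowSum M d g x (z * d) j =
      ∑ o : Fin d, if o * z ≤ j then windowSum M d g x z (j - o * z) else 0 := by
  rw [← Finset.sum_range fun o => if o * z ≤ j then windowSum M d g x z (j - o * z) else 0]
  unfold windowSum
  -- The fibre index is the number of the run that contains block `p / d`, counted backwards from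
  -- block `j - 1`.
  rw [← Finset.sum_fiberwise_of_maps_to (t := Finset.range d) (g := fun p => (j - 1 - p / d) / z)]
  · refine Finset.sum_congr rfl fun o ho => ?_
    rw [Finset.mem_range] at ho
    have hoz : (o + 1) * z ≤ z * d := by rw [mul_comm]; exact Nat.mul_le_mul_left z ho
    have hoz' : (o + 1) * z = o * z + z := Nat.succ_mul _ _
    split_ifs with h
    · rw [Finset.filter_filter]
      refine Finset.sum_congr (Finset.filter_congr fun p _ => ?_) fun _ _ => rfl
      rw [Nat.div_eq_iff hz]
      generalize p / d = q
      omega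
    · rw [Finset.filter_filter]
      refine Finset.sum_eq_zero fun p hp => ?_
      rw [Finset.mem_filter, Nat.div_eq_iff hz] at hp
      generalize p / d = q at hp
      omega
  · intro p hp
    rw [Finset.mem_filter] at hp
    rw [Finset.mem_range, Nat.div_lt_iff_lt_mul hz, mul_comm]
    omega

theorem windowSum_one (hd : 0 < d) (x : ℕ → ℕ) (j : Fin M) :
    windowSum M d g x 1 j =
      if 1 ≤ (j : ℕ) then ∑ o : Fin d, g ((j - 1 : ℕ) * d + o) (x ((j - 1 : ℕ) * d + o))
      else 0 := by
  unfold windowSum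
  split_ifs with h
  · rw [← Finset.sum_range fun o => g ((j - 1 : ℕ) * d + o) (x ((j - 1 : ℕ) * d + o))]
    have hjM : ((j : ℕ) - 1) * d + d ≤ M * d := by
      rw [← Nat.succ_mul]; exact Nat.mul_le_mul_right d (by omega)
    symm
    refine Finset.sum_bij (fun o _ => (j - 1 : ℕ) * d + o) ?_ ?_ ?_ ?_
    · intro o ho
      rw [Finset.mem_range] at ho
      have : ((j - 1 : ℕ) * d + o) / d = j - 1 := by
        rw [mul_comm, Nat.mul_add_div hd, Nat.div_eq_of_lt ho, add_zero]
      rw [Finset.mem_filter, Finset.mem_range, this]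
      omega
    · intro a _ b _ hab; simpa using hab
    · intro p hp
      rw [Finset.mem_filter] at hp
      have hpd : p / d = j - 1 := by omega
      have h1 := Nat.div_add_mod p d
      rw [hpd, mul_comm] at h1
      exact ⟨p % d, Finset.mem_range.2 (Nat.mod_lt _ hd), h1⟩
    · intro _ _; rfl
  · refine Finset.sum_eq_zero fun p hp => ?_
    rw [Finset.mem_filter] at hp
    generalize p / d = q at hp
    omega

variable {mem K : ℕ}

/-- An unsent message is payload 0 and decodes to the neutral element, so windows that do not exist
contribute nothing. -/
theorem symm_ite (he : e 0 = 0) (p : Prop) [Decidable p] (a : α) :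
    e.symm (if p then e a else 0) = if p then a else 0 := by
  split_ifs
  · simp
  · rw [Equiv.symm_apply_eq, he]

theorem scanFirst_spec (he : e 0 = 0) (hd : 0 < d) (hmem : 2 * d ≤ mem) {x : ℕ → ℕ}
    (hx : ∀ p, x p < K)
    (hg : ∀ s : Finset ℕ, s ⊆ Finset.range (M * d) → e (∑ p ∈ s, g p (x p)) < K)
    (c : Fin M → ℕ → ℕ) :
    StepOK mem K (scanFirst M d e g) c (ofArray M d x) ∧
      ScanInv M d e g x 1 (step (scanFirst M d e g) c (ofArray M d x)) := by
  have hK : 0 < K := (Nat.zero_le _).trans_lt (hx 0)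
  refine ⟨⟨?_, ?_, ?_⟩, ?_, ?_⟩
  · intro j s i i' h h'
    simp only [scanFirst] at h h'
    split_ifs at h h' <;> first | (exact absurd rfl h) | (exact absurd rfl h') | skip
    · simp_all
    · exact Fin.ext (by omega)
  · intro i
    refine (sum_card_le (κ := Fin (2 * d)) (fun js b => js.2 = b ∧
      (js.1 = i ∧ (js.2 : ℕ) < d ∨ (js.1 : ℕ) = i + 1 ∧ ¬ (js.2 : ℕ) < d)) ?_ ?_).trans
      (by simpa using hmem)
    · intro j s h
      simp only [scanFirst] at h
      split_ifs at h <;> simp_all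
    · rintro b ⟨j, s⟩ ⟨j', s'⟩ ⟨h1, h2⟩ ⟨h3, h4⟩
      simp only at h1 h2 h3 h4
      subst h1 h3
      refine Prod.ext (Fin.ext ?_) rfl
      simp only [Fin.ext_iff] at h2 h4
      simp only
      omega
  · intro i j s
    simp only [scanFirst]
    split_ifs with h1 h2 h3
    · simpa [ofArray, h1] using hx _
    · exact hK
    · have := windowSum_one g (M := M) hd x ⟨j, by omega⟩
      rw [if_pos (by simp; omega)] at this
      simp only [ofArray_mainSlot]
      rw [show ((i : ℕ)) = (j : ℕ) - 1 by omega]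
      rw [← this]
      exact hg _ (Finset.filter_subset _ _)
    · exact hK
  · intro j s hs
    simp [step, scanFirst, hs, ofArray]
  · intro j
    rw [windowSum_one g hd x j]
    have h0 : ∀ o : Fin d, step (scanFirst M d e g) c (ofArray M d x) j (auxSlot o) =
        if (o : ℕ) = 0 then (if 1 ≤ (j : ℕ) then
          e (∑ o : Fin d, g ((j - 1 : ℕ) * d + o) (x ((j - 1 : ℕ) * d + o))) else 0) else 0 := by
      intro o
      rw [← sum_shift j 1 fun i => e (∑ o : Fin d, g (i * d + o) (x (i * d + o)))]
      have : ∀ i, scanFirst M d e g i (ofArray M d x i) (c i) j (auxSlot o) =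
          if (o : ℕ) = 0 then (if (j : ℕ) = i + 1 then
            e (∑ o : Fin d, g (i * d + o) (x (i * d + o))) else 0) else 0 := by
        intro i
        simp only [scanFirst, ofArray_mainSlot]
        rw [if_neg (by simp [auxSlot])]
        by_cases h : (o : ℕ) = 0
        · simp [auxSlot, h]
        · simp [auxSlot, h]
      simp only [step, this]
      split_ifs <;> simp
    simp only [h0]
    rw [Finset.sum_eq_single ⟨0, hd⟩]
    · simp only [if_true]
      rw [symm_ite e he]
    · intro o _ ho
      rw [if_neg, Equiv.symm_apply_eq, he]
      exact fun h => ho (Fin.ext h)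
    · simp

/-- Auxiliary slot `o` hears only from the machine `o * z` places to the left. Each slot index
accounts for at most one outgoing message per machine, so at most `2 * d` messages leave it. -/
theorem scanMiddle_spec (he : e 0 = 0) (hmem : 2 * d ≤ mem) {x : ℕ → ℕ} (hx : ∀ p, x p < K)
    (hg : ∀ s : Finset ℕ, s ⊆ Finset.range (M * d) → e (∑ p ∈ s, g p (x p)) < K)
    (c : Fin M → ℕ → ℕ) {z : ℕ} (hz : 0 < z) {X : Fin M → Fin (2 * d) → ℕ}
    (hX : ScanInv M d e g x z X) :
    StepOK mem K (scanMiddle M d e z) c X ∧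
      ScanInv M d e g x (z * d) (step (scanMiddle M d e z) c X) := by
  have hK : 0 < K := (Nat.zero_le _).trans_lt (hx 0)
  refine ⟨⟨?_, ?_, ?_⟩, ?_, ?_⟩
  · intro j s i i' h h'
    simp only [scanMiddle] at h h'
    split_ifs at h h' <;> first | (exact absurd rfl h) | (exact absurd rfl h') | skip
    · simp_all
    · exact Fin.ext (by omega)
  · intro i
    refine (sum_card_le (κ := Fin (2 * d)) (fun js b => js.2 = b ∧
      (js.1 = i ∧ (js.2 : ℕ) < d ∨ (js.1 : ℕ) = i + (js.2 - d) * z ∧ ¬ (js.2 : ℕ) < d)) ?_ ?_).trans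
      (by simpa using hmem)
    · intro j s h
      simp only [scanMiddle] at h
      split_ifs at h <;> simp_all
    · rintro b ⟨j, s⟩ ⟨j', s'⟩ ⟨h1, h2⟩ ⟨h3, h4⟩
      simp only at h1 h2 h3 h4
      subst h1 h3
      refine Prod.ext (Fin.ext ?_) rfl
      simp only [Fin.ext_iff] at h2 h4
      simp only
      omega
  · intro i j s
    simp only [scanMiddle]
    split_ifs with h1 h2 h3
    · rw [hX.main i s h1]; exact hx _
    · exact hK
    · rw [hX.aux]
      exact hg _ (Finset.filter_subset _ _)
    · exact hK
  · intro j s hs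
    simp [step, scanMiddle, hs, hX.main]
  · intro j
    rw [windowSum_mul g hz x j]
    refine Finset.sum_congr rfl fun o _ => ?_
    have : ∀ i, scanMiddle M d e z i (X i) (c i) j (auxSlot o) =
        if (j : ℕ) = i + o * z then e (windowSum M d g x z i) else 0 := by
      intro i
      simp only [scanMiddle, hX.aux]
      rw [if_neg (by simp [auxSlot])]
      simp [auxSlot]
    simp only [step, this]
    rw [sum_shift j (o * z) fun i => e (windowSum M d g x z i), symm_ite e he]

theorem scanLast_spec (hmem : 2 * d ≤ mem) {x : ℕ → ℕ}
    {f : ℕ → ℕ → α → ℕ} (hK : 0 < K)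
    (hf : ∀ p < M * d, f p (x p) (∑ q ∈ Finset.range p, g q (x q)) < K)
    (c : Fin M → ℕ → ℕ) {z : ℕ} (hz : M ≤ z)
    {X : Fin M → Fin (2 * d) → ℕ} (hX : ScanInv M d e g x z X) :
    StepOK mem K (scanLast M d e g f) c X ∧ step (scanLast M d e g f) c X =
      ofArray M d fun p => f p (x p) (∑ q ∈ Finset.range p, g q (x q)) := by
  have hval : ∀ (i : Fin M) (s : Fin (2 * d)), (s : ℕ) < d →
      f (i * d + s) (X i s) ((∑ o : Fin d, e.symm (X i (auxSlot o))) +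
      ∑ o : Fin d, if (o : ℕ) < s then g (i * d + o) (X i (mainSlot o)) else 0) =
      f (i * d + s) (x (i * d + s)) (∑ q ∈ Finset.range (i * d + s), g q (x q)) := by
    intro i s hs
    have hd : 0 < d := by omega
    rw [hX.main i s hs, hX.aux, Finset.sum_range_add]
    -- The cells before `i * d + s` are all earlier blocks, whose sum is the window because `z` is
    -- at least `M`, and the first `s` cells of the block itself.
    congr 2
    · unfold windowSum
      congr 1
      ext p
      rw [Finset.mem_filter, Finset.mem_range, Finset.mem_range, Nat.div_lt_iff_lt_mul hd]
      have h1 : (i : ℕ) * d ≤ M * d := Nat.mul_le_mul_right d i.2.le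
      have h2 := i.2
      generalize p / d = q
      omega
    · have : ∀ o : Fin d, X i (mainSlot o) = x (i * d + o) := fun o => hX.main i _ o.2
      simp only [this]
      rw [← Finset.sum_range fun o => if o < s then g (i * d + o) (x (i * d + o)) else 0,
        ← Finset.sum_filter]
      congr 1
      ext o
      simp only [Finset.mem_filter, Finset.mem_range]
      omega
  refine ⟨⟨?_, ?_, ?_⟩, ?_⟩
  · intro j s i i' h h'
    simp only [scanLast] at h h'
    split_ifs at h h' <;> simp_all
  · intro i
    refine (sum_card_le (κ := Fin (2 * d)) (fun js b => js.2 = b ∧ js.1 = i) ?_ ?_).trans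
      (by simpa using hmem)
    · intro j s h
      simp only [scanLast] at h
      split_ifs at h <;> simp_all
    · rintro b ⟨j, s⟩ ⟨j', s'⟩ ⟨h1, h2⟩ ⟨h3, h4⟩
      simp_all
  · intro i j s
    simp only [scanLast]
    split_ifs with h1
    · rw [hval i s h1]; exact hf _ (address_lt i h1)
    · exact hK
    · exact hK
  · funext j s
    by_cases hs : (s : ℕ) < d
    · simp only [step, scanLast, hs, if_true, ofArray]
      rw [Finset.sum_ite_eq, if_pos (Finset.mem_univ _), hval j s hs]
    · simp [step, scanLast, hs, ofArray]

/-- Each middle round multiplies the window length by `d`; after `H` of them the window reaches back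
over all preceding blocks. The hypothesis `hg` bounds sums over arbitrary sets of cells because sums
over windows are sent as payloads. -/
theorem scanRounds_spec (he : e 0 = 0) (hd : 0 < d) (hmem : 2 * d ≤ mem) {H : ℕ}
    (hH : M ≤ d ^ H) {x : ℕ → ℕ}
    (hx : ∀ p, x p < K)
    (hg : ∀ s : Finset ℕ, s ⊆ Finset.range (M * d) → e (∑ p ∈ s, g p (x p)) < K)
    {f : ℕ → ℕ → α → ℕ} (hf : ∀ p < M * d, f p (x p) (∑ q ∈ Finset.range p, g q (x q)) < K)
    (c : ℕ → Fin M → ℕ → ℕ) :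
    Exec mem K (scanRounds M d H e g f) c (ofArray M d x)
      (ofArray M d fun p => f p (x p) (∑ q ∈ Finset.range p, g q (x q))) := by
  have hmid : ∀ H (c : ℕ → Fin M → ℕ → ℕ) (X : Fin M → Fin (2 * d) → ℕ),
      ScanInv M d e g x 1 X → ∃ Y,
      Exec mem K ((List.range H).map fun h => scanMiddle M d e (d ^ h)) c X Y ∧
      ScanInv M d e g x (d ^ H) Y := by
    intro H c X hX
    induction H with
    | zero => exact ⟨X, rfl, by simpa using hX⟩
    | succ H ih =>
      obtain ⟨Y, hY, hYi⟩ := ih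
      have := scanMiddle_spec e g he hmem hx hg
        (c (0 + ((List.range H).map fun h => scanMiddle M d e (d ^ h)).length))
        (pow_pos hd H) hYi
      rw [List.range_succ, List.map_append]
      exact ⟨_, hY.append ⟨this.1, rfl⟩, by rw [pow_succ]; exact this.2⟩
  obtain ⟨h1, h2⟩ := scanFirst_spec e g he hd hmem hx hg (c 0)
  obtain ⟨Y, hY, hYi⟩ := hmid H (fun t => c (t + 1)) _ h2
  have h3 := scanLast_spec e g hmem ((Nat.zero_le _).trans_lt (hx 0)) hf
    (c (0 + (List.range H).length + 1)) hH hYi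
  refine ⟨h1, hY.append ⟨?_, ?_⟩⟩
  · simpa using h3.1
  · simpa [Exec] using h3.2

end Scan

end CellMachine

/-! ### Deterministic programs on arrays: counting, prefix maxima, permutations. -/

namespace CellMachine

/-- The parameters of the array machine fit together. -/
structure Params (M d H mem K : ℕ) : Prop where
  block_pos : 0 < d
  mem_le : 2 * d ≤ mem
  height : M ≤ d ^ H
  size_lt : M * d < K

/-- Without using coins, the rounds `rs` turn the array `x` into the array `y`. -/
def Computes {M d : ℕ} (mem K : ℕ) (rs : List (Round M (2 * d))) (x y : ℕ → ℕ) : Prop :=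
  ∀ c, Exec mem K rs c (ofArray M d x) (ofArray M d y)

theorem Computes.append {M d mem K : ℕ} {rs rs' : List (Round M (2 * d))} {x y z : ℕ → ℕ}
    (h : Computes mem K rs x y) (h' : Computes mem K rs' y z) : Computes mem K (rs ++ rs') x z :=
  fun c => (h c).append (h' _)

theorem Computes.congr_right {M d mem K : ℕ} {rs : List (Round M (2 * d))} {x y y' : ℕ → ℕ}
    (h : Computes mem K rs x y) (hy : ∀ p < M * d, y p = y' p) : Computes mem K rs x y' := by
  intro c
  rw [← ofArray_congr hy]
  exact h c

/-- The natural numbers with `max` as addition. -/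
@[ext]
structure MaxNat where
  val : ℕ

instance : Add MaxNat := ⟨fun a b => ⟨max a.val b.val⟩⟩

instance : Zero MaxNat := ⟨⟨0⟩⟩

instance : AddCommMonoid MaxNat where
  add_assoc a b c := MaxNat.ext (max_assoc a.val b.val c.val)
  add_comm a b := MaxNat.ext (max_comm a.val b.val)
  zero_add a := MaxNat.ext (max_eq_right (Nat.zero_le a.val))
  add_zero a := MaxNat.ext (max_eq_left (Nat.zero_le a.val))
  nsmul := nsmulRec

/-- The value of an element of `MaxNat`. -/
def MaxNat.equiv : MaxNat ≃ ℕ where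
  toFun := MaxNat.val
  invFun := MaxNat.mk
  left_inv _ := rfl
  right_inv _ := rfl

theorem MaxNat.val_sum {ι : Type*} (s : Finset ι) (f : ι → ℕ) :
    (∑ i ∈ s, MaxNat.mk (f i)).val = s.sup f := by
  classical
  induction s using Finset.induction_on with
  | empty => rfl
  | insert a s ha ih =>
    rw [Finset.sum_insert ha, Finset.sup_insert, ← ih]
    rfl

/-- Scanning with respect to addition. -/
def scanSum (M d H : ℕ) (g : ℕ → ℕ → ℕ) (f : ℕ → ℕ → ℕ → ℕ) : List (Round M (2 * d)) :=
  scanRounds M d H (Equiv.refl ℕ) g f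

/-- Scanning with respect to the maximum. -/
def scanMax (M d H : ℕ) (g : ℕ → ℕ → ℕ) (f : ℕ → ℕ → ℕ → ℕ) : List (Round M (2 * d)) :=
  scanRounds M d H MaxNat.equiv (fun p v => ⟨g p v⟩) fun p v b => f p v b.val

theorem length_scanSum (M d H : ℕ) (g : ℕ → ℕ → ℕ) (f : ℕ → ℕ → ℕ → ℕ) :
    (scanSum M d H g f).length = H + 2 :=
  length_scanRounds _ _ _ _

theorem length_scanMax (M d H : ℕ) (g : ℕ → ℕ → ℕ) (f : ℕ → ℕ → ℕ → ℕ) :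
    (scanMax M d H g f).length = H + 2 :=
  length_scanRounds _ _ _ _

section

variable {M d H mem K : ℕ} (hP : Params M d H mem K)
include hP

theorem Params.pos : 0 < K := (Nat.zero_le _).trans_lt hP.size_lt

/-- Sums are only used for counting cells; with summands at most 1 no partial sum exceeds the number
of cells, which is below `K`. -/
theorem scanSum_computes {x : ℕ → ℕ} {g : ℕ → ℕ → ℕ} {f : ℕ → ℕ → ℕ → ℕ} (hx : ∀ p, x p < K)
    (hg : ∀ p v, g p v ≤ 1)
    (hf : ∀ p < M * d, f p (x p) (∑ q ∈ Finset.range p, g q (x q)) < K) :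
    Computes mem K (scanSum M d H g f) x
      fun p => f p (x p) (∑ q ∈ Finset.range p, g q (x q)) := by
  refine scanRounds_spec (Equiv.refl ℕ) g rfl hP.block_pos hP.mem_le hP.height hx ?_ hf
  intro s hs
  refine lt_of_le_of_lt ?_ hP.size_lt
  calc (∑ p ∈ s, g p (x p)) ≤ ∑ p ∈ s, 1 := Finset.sum_le_sum fun _ _ => hg _ _
    _ = s.card := by simp
    _ ≤ (Finset.range (M * d)).card := Finset.card_le_card hs
    _ = M * d := Finset.card_range _

theorem scanMax_computes {x : ℕ → ℕ} {g : ℕ → ℕ → ℕ} {f : ℕ → ℕ → ℕ → ℕ} (hx : ∀ p, x p < K)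
    (hg : ∀ p, g p (x p) < K)
    (hf : ∀ p < M * d, f p (x p) ((Finset.range p).sup fun q => g q (x q)) < K) :
    Computes mem K (scanMax M d H g f) x
      fun p => f p (x p) ((Finset.range p).sup fun q => g q (x q)) := by
  have h := fun c => scanRounds_spec (mem := mem) (K := K) (f := fun p v b => f p v b.val) (x := x)
    MaxNat.equiv (fun p v => ⟨g p v⟩) rfl hP.block_pos hP.mem_le hP.height hx ?_ ?_ c
  · refine Computes.congr_right h fun p _ => ?_
    simp only [MaxNat.val_sum]
  · intro s _
    change (∑ p ∈ s, MaxNat.mk (g p (x p))).val < K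
    rw [MaxNat.val_sum]
    exact (Finset.sup_lt_iff hP.pos).2 fun p _ => hg p
  · intro p hp
    simp only [MaxNat.val_sum]
    exact hf p hp

theorem route_computes {x : ℕ → ℕ} {dst : ℕ → ℕ → ℕ} {f : ℕ → ℕ → ℕ}
    (hf : ∀ p < M * d, f p (x p) < K)
    (hinj : ∀ p < M * d, ∀ p' < M * d, f p (x p) ≠ 0 → f p' (x p') ≠ 0 →
      dst p (x p) = dst p' (x p') → p = p') :
    Computes mem K [routeRound M d dst fun p v _ => f p v] x
      (routeArray (M * d) dst (fun p v _ => f p v) (fun _ => 0) x) := by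
  intro c
  have h := routeRound_spec (mem := mem) (K := K) (dst := dst) (f := fun p v _ => f p v)
    (c := fun _ _ => 0) (c' := fun _ => 0) (x := x)
    (by have := hP.mem_le; omega) hP.pos hf (fun _ _ => rfl) hinj
  exact ⟨⟨h.1.1, h.1.2, h.1.3⟩, h.2⟩

end

/-- The array with the entries `a`, followed by empty cells. -/
def pad {N : ℕ} (a : Fin N → ℕ) (p : ℕ) : ℕ := if h : p < N then a ⟨p, h⟩ else 0

theorem pad_val {N : ℕ} (a : Fin N → ℕ) (p : Fin N) : pad a p = a p := by simp [pad]

theorem pad_of_le {N : ℕ} (a : Fin N → ℕ) {p : ℕ} (h : N ≤ p) : pad a p = 0 := by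
  simp [pad, h]

theorem pad_lt {N K : ℕ} {a : Fin N → ℕ} (hK : 0 < K) (ha : ∀ p, a p < K) (p : ℕ) :
    pad a p < K := by
  unfold pad
  split_ifs
  exacts [ha _, hK]

theorem sum_range_pad {N : ℕ} (a : Fin N → ℕ) (g : ℕ → ℕ → ℕ) (p : Fin N) :
    ∑ q ∈ Finset.range p, g q (pad a q) = ∑ q ∈ Finset.Iio p, g q (a q) := by
  symm
  refine Finset.sum_bij (fun q _ => (q : ℕ)) ?_ ?_ ?_ ?_
  · intro q hq
    simpa using hq
  · intro q _ q' _ h; exact Fin.ext h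
  · intro q hq
    rw [Finset.mem_range] at hq
    exact ⟨⟨q, by omega⟩, Finset.mem_Iio.2 hq, rfl⟩
  · intro q _; rw [pad_val]

theorem sup_range_pad {N : ℕ} (a : Fin N → ℕ) (g : ℕ → ℕ → ℕ) (p : Fin N) :
    ((Finset.range p).sup fun q => g q (pad a q)) = (Finset.Iio p).sup fun q => g q (a q) := by
  apply le_antisymm
  · refine Finset.sup_le fun q hq => ?_
    rw [Finset.mem_range] at hq
    have h := Finset.le_sup (f := fun q : Fin N => g q (a q)) (s := Finset.Iio p)
      (b := ⟨q, by omega⟩) (Finset.mem_Iio.2 hq)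
    simpa [← pad_val a] using h
  · refine Finset.sup_le fun q hq => ?_
    have h := Finset.le_sup (f := fun q : ℕ => g q (pad a q)) (s := Finset.range p)
      (b := q) (by simpa using hq)
    simpa [pad_val] using h

section

variable {M d H mem K N : ℕ} (hP : Params M d H mem K) {a b : Fin N → ℕ}
include hP

/-- Reduction to arrays of exact length `N`: cells from `N` on are empty, follow all relevant cells,
and stay empty by `hf0`. -/
theorem scanSum_pad {g : ℕ → ℕ → ℕ} {f : ℕ → ℕ → ℕ → ℕ} (ha : ∀ p, a p < K)
    (hb : ∀ p, b p < K) (hg : ∀ p v, g p v ≤ 1)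
    (hf0 : ∀ p z, f p 0 z = 0) (hf : ∀ p : Fin N, f p (a p) (∑ q ∈ Finset.Iio p, g q (a q)) = b p) :
    Computes mem K (scanSum M d H g f) (pad a) (pad b) := by
  have key : ∀ p, f p (pad a p) (∑ q ∈ Finset.range p, g q (pad a q)) = pad b p := by
    intro p
    by_cases h : p < N
    · have := hf ⟨p, h⟩
      rw [← sum_range_pad, ← pad_val a, ← pad_val b] at this
      exact this
    · rw [pad_of_le a (by omega), pad_of_le b (by omega), hf0]
  refine (scanSum_computes hP (pad_lt hP.pos ha) hg ?_).congr_right fun p _ => key p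
  intro p _
  rw [key]
  exact pad_lt hP.pos hb p

theorem scanMax_pad {g : ℕ → ℕ → ℕ} {f : ℕ → ℕ → ℕ → ℕ} (ha : ∀ p, a p < K)
    (hb : ∀ p, b p < K) (hg0 : ∀ p, g p 0 = 0) (hg : ∀ p : Fin N, g p (a p) < K)
    (hf0 : ∀ p z, f p 0 z = 0)
    (hf : ∀ p : Fin N, f p (a p) ((Finset.Iio p).sup fun q => g q (a q)) = b p) :
    Computes mem K (scanMax M d H g f) (pad a) (pad b) := by
  have key : ∀ p, f p (pad a p) ((Finset.range p).sup fun q => g q (pad a q)) = pad b p := by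
    intro p
    by_cases h : p < N
    · have := hf ⟨p, h⟩
      rw [← sup_range_pad, ← pad_val a, ← pad_val b] at this
      exact this
    · rw [pad_of_le a (by omega), pad_of_le b (by omega), hf0]
  refine (scanMax_computes hP (pad_lt hP.pos ha) ?_ ?_).congr_right fun p _ => key p
  · intro p
    by_cases h : p < N
    · have := hg ⟨p, h⟩
      rw [← pad_val a] at this
      exact this
    · rw [pad_of_le a (by omega), hg0]
      exact hP.pos
  · intro p _
    rw [key]
    exact pad_lt hP.pos hb p

theorem route_pad (hN : N ≤ M * d) {dst f : ℕ → ℕ → ℕ} (τ : Equiv.Perm (Fin N))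
    (hb : ∀ p, b p < K) (hf0 : ∀ p, f p 0 = 0) (hdst : ∀ p : Fin N, dst p (a p) = τ p)
    (hf : ∀ p : Fin N, f p (a p) = b (τ p)) :
    Computes mem K [routeRound M d dst fun p v _ => f p v] (pad a) (pad b) := by
  have hlt : ∀ p, f p (pad a p) ≠ 0 → p < N := by
    intro p h
    by_contra h'
    rw [pad_of_le a (by omega), hf0] at h
    exact h rfl
  have hf' : ∀ p (h : p < N), f p (pad a p) = b (τ ⟨p, h⟩) := by
    intro p h; rw [← hf, ← pad_val a]
  have hdst' : ∀ p (h : p < N), dst p (pad a p) = τ ⟨p, h⟩ := by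
    intro p h; rw [← hdst, ← pad_val a]
  have hinj : ∀ p < M * d, ∀ p' < M * d, f p (pad a p) ≠ 0 → f p' (pad a p') ≠ 0 →
      dst p (pad a p) = dst p' (pad a p') → p = p' := by
    intro p _ p' _ h h' hpp
    rw [hdst' p (hlt p h), hdst' p' (hlt p' h')] at hpp
    simpa using τ.injective (Fin.ext hpp)
  refine (route_computes hP ?_ hinj).congr_right fun q hq => ?_
  · intro p _
    by_cases h : p < N
    · rw [hf' p h]; exact hb _
    · rw [pad_of_le a (by omega), hf0]; exact hP.pos
  · by_cases h : q < N
    · obtain ⟨p, hp⟩ : ∃ p, τ p = ⟨q, h⟩ := ⟨τ.symm ⟨q, h⟩, by simp⟩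
      have hpq : dst p (pad a p) = q := by rw [hdst' p p.2]; simp [hp]
      have hbq : pad b q = f p (pad a p) := by
        rw [hf' p p.2]; simp [hp, pad, h]
      rw [hbq]
      -- A zero entry is not sent at all, and its destination stays empty, which is again the entry
      -- 0.
      by_cases h0 : f p (pad a p) = 0
      · rw [h0]
        refine routeArray_eq_zero fun p' hp' hf' hd => ?_
        rw [hdst' p' (hlt p' hf')] at hd
        have : τ ⟨p', hlt p' hf'⟩ = τ p := by rw [hp]; exact Fin.ext hd
        have := τ.injective this
        rw [← this] at h0
        exact hf' h0
      · have := routeArray_apply (c := fun _ => 0) (f := fun p v _ => f p v) hinj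
          (p.2.trans_le hN) h0
        rw [hpq] at this
        exact this
    · rw [pad_of_le b (by omega)]
      refine routeArray_eq_zero fun p hp hf' hd => h ?_
      rw [← hd, hdst' p (hlt p hf')]
      exact Fin.is_lt _

end

end CellMachine

/-! ### Sorting by one bit of the key at a time. -/

namespace CellMachine

/-- The number of indices before `p` that satisfy `b`. -/
def countBefore {N : ℕ} (b : Fin N → Prop) [DecidablePred b] (p : Fin N) : ℕ :=
  ∑ q ∈ Finset.Iio p, if b q then 1 else 0

section Split

variable {N : ℕ} (b : Fin N → Prop) [DecidablePred b]

theorem countBefore_eq_card (p : Fin N) :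
    countBefore b p = ((Finset.Iio p).filter b).card := by
  rw [countBefore, Finset.card_filter]

theorem countBefore_add_not (p : Fin N) :
    countBefore b p + countBefore (fun q => ¬ b q) p = p := by
  rw [countBefore_eq_card, countBefore_eq_card, Finset.card_filter_add_card_filter_not,
    Fin.card_Iio]

variable {b}

theorem countBefore_lt {p q : Fin N} (hp : b p) (hpq : p < q) :
    countBefore b p < countBefore b q := by
  rw [countBefore_eq_card, countBefore_eq_card]
  refine Finset.card_lt_card (Finset.ssubset_iff_of_subset ?_ |>.2 ⟨p, ?_, ?_⟩)
  · intro r hr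
    simp only [Finset.mem_filter, Finset.mem_Iio] at hr ⊢
    exact ⟨hr.1.trans hpq, hr.2⟩
  · simp [hp, hpq]
  · simp

theorem countBefore_lt_card {p : Fin N} (hp : b p) :
    countBefore b p < (Finset.univ.filter b).card := by
  rw [countBefore_eq_card]
  refine Finset.card_lt_card (Finset.ssubset_iff_of_subset ?_ |>.2 ⟨p, ?_, ?_⟩)
  · intro r hr
    simp only [Finset.mem_filter, Finset.mem_Iio, Finset.mem_univ, true_and] at hr ⊢
    exact hr.2
  · simp [hp]
  · simp

variable (b)

/-- The permutation that moves the indices satisfying `b` to the front, in order, and the others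
to the back, in reversed order. -/
theorem exists_splitPerm : ∃ τ : Equiv.Perm (Fin N),
    (∀ p, (τ p : ℕ) = if b p then countBefore b p else N - 1 - (p - countBefore b p)) ∧
    (∀ p q, b p → b q → p < q → τ p < τ q) ∧ (∀ p q, b p → ¬ b q → τ p < τ q) ∧
    (∀ p q, ¬ b p → ¬ b q → p < q → τ q < τ p) := by
  -- Filling the back part from the end makes the destination depend only on the number of earlier
  -- indices of each kind, which one prefix sum provides; the total number is not needed. The price
  -- is the reversed order.
  let D : Fin N → ℕ := fun p =>
    if b p then countBefore b p else N - 1 - (p - countBefore b p)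
  have htot : (Finset.univ.filter b).card + (Finset.univ.filter fun q => ¬ b q).card = N := by
    rw [Finset.card_filter_add_card_filter_not]; simp
  have h1 : ∀ p, b p → D p = countBefore b p := fun p hp => if_pos hp
  have h2 : ∀ p, ¬ b p → D p + countBefore (fun q => ¬ b q) p + 1 = N := by
    intro p hp
    have hD : D p = N - 1 - (p - countBefore b p) := if_neg hp
    have := countBefore_add_not b p
    have := countBefore_lt_card (b := fun q => ¬ b q) hp
    omega
  have hzz : ∀ p q, b p → b q → p < q → D p < D q := by
    intro p q hp hq hpq
    rw [h1 p hp, h1 q hq]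
    exact countBefore_lt hp hpq
  have hzo : ∀ p q, b p → ¬ b q → D p < D q := by
    intro p q hp hq
    have := h2 q hq
    have := countBefore_lt_card (b := fun q => ¬ b q) hq
    have := countBefore_lt_card hp
    rw [h1 p hp]
    omega
  have hoo : ∀ p q, ¬ b p → ¬ b q → p < q → D q < D p := by
    intro p q hp hq hpq
    have := h2 p hp
    have := h2 q hq
    have := countBefore_lt (b := fun q => ¬ b q) hp hpq
    omega
  have hlt : ∀ p, D p < N := by
    intro p
    by_cases hp : b p
    · rw [h1 p hp]
      have := countBefore_lt_card hp
      omega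
    · have := h2 p hp
      omega
  have hinj : Function.Injective fun p => (⟨D p, hlt p⟩ : Fin N) := by
    intro p q hpq
    have hpq : D p = D q := congrArg Fin.val hpq
    by_contra hne
    rcases lt_or_gt_of_ne hne with h | h <;> by_cases hp : b p <;> by_cases hq : b q
    · exact (hzz p q hp hq h).ne hpq
    · exact (hzo p q hp hq).ne hpq
    · exact (hzo q p hq hp).ne' hpq
    · exact (hoo p q hp hq h).ne' hpq
    · exact (hzz q p hq hp h).ne' hpq
    · exact (hzo p q hp hq).ne hpq
    · exact (hzo q p hq hp).ne' hpq
    · exact (hoo q p hq hp h).ne hpq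
  exact ⟨Equiv.ofBijective _ (Finite.injective_iff_bijective.1 hinj), fun _ => rfl,
    fun p q hp hq h => hzz p q hp hq h, fun p q hp hq => hzo p q hp hq,
    fun p q hp hq h => hoo p q hp hq h⟩

end Split

/-- Moves the records among the first `N` cells whose key is less than `t` to the front, and the
others, in reversed order, to the back. Records are nonzero and less than `K₁`. -/
def splitRounds (M d H N K₁ : ℕ) (key : ℕ → ℕ) (t : ℕ) : List (Round M (2 * d)) :=
  scanSum M d H (fun _ v => if v ≠ 0 ∧ key v < t then 1 else 0)
    (fun p v z => if v = 0 then 0 else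
      v + K₁ * if key v < t then z else N - 1 - (p - z)) ++
  [routeRound M d (fun _ v => v / K₁) fun _ v _ => v % K₁]

/-- Sorts the first `N` cells by a key that is less than `2 ^ B`. -/
def sortRounds (M d H N K₁ : ℕ) : ℕ → (ℕ → ℕ) → List (Round M (2 * d))
  | 0, _ => []
  | B + 1, key =>
    sortRounds M d H N K₁ B (fun v => if key v < 2 ^ B then key v else 2 ^ (B + 1) - 1 - key v) ++
      splitRounds M d H N K₁ key (2 ^ B)

theorem length_sortRounds (M d H N K₁ B : ℕ) (key : ℕ → ℕ) :
    (sortRounds M d H N K₁ B key).length = B * (H + 3) := by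
  induction B generalizing key with
  | zero => simp [sortRounds]
  | succ B ih =>
    rw [sortRounds, List.length_append, ih, splitRounds, List.length_append, length_scanSum]
    simp
    ring

section

variable {M d H mem K N K₁ : ℕ} (hP : Params M d H mem K)
include hP

/-- The destination rides along as the upper digit to base `K₁`, above the record itself, until the
routing round reads and removes it. -/
theorem splitRounds_computes (hN : N ≤ M * d) (hK : K₁ * N < K) {a : Fin N → ℕ}
    (ha0 : ∀ p, a p ≠ 0) (ha : ∀ p, a p < K₁) (key : ℕ → ℕ) (t : ℕ) (τ : Equiv.Perm (Fin N))
    (hτ : ∀ p, (τ p : ℕ) = if key (a p) < t then countBefore (fun q => key (a q) < t) p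
      else N - 1 - (p - countBefore (fun q => key (a q) < t) p)) :
    Computes mem K (splitRounds M d H N K₁ key t) (pad a) (pad fun p => a (τ.symm p)) := by
  have hK1 : ∀ p : Fin N, a p + K₁ * (τ p : ℕ) < K := by
    intro p
    refine lt_of_lt_of_le ?_ hK.le
    calc a p + K₁ * (τ p : ℕ) < K₁ + K₁ * (τ p : ℕ) := by have := ha p; omega
      _ = K₁ * (τ p + 1) := by ring
      _ ≤ K₁ * N := Nat.mul_le_mul_left _ (τ p).2
  have haK : ∀ p, a p < K := fun p => (Nat.le_add_right _ _).trans_lt (hK1 p)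
  refine Computes.append (y := pad fun p => a p + K₁ * (τ p : ℕ)) ?_ ?_
  · refine scanSum_pad hP haK hK1 ?_ (fun p z => if_pos rfl) ?_
    · intro p v; split_ifs <;> simp
    · intro p
      rw [if_neg (ha0 p), hτ]
      simp [ha0, countBefore]
  · refine route_pad hP hN τ (fun p => haK _) (fun _ => Nat.zero_mod _) ?_ ?_
    · intro p
      have hK₁ : 0 < K₁ := (Nat.zero_le _).trans_lt (ha p)
      rw [Nat.add_mul_div_left _ _ hK₁, Nat.div_eq_of_lt (ha p), zero_add]
    · intro p
      rw [Nat.add_mul_mod_self_left, Nat.mod_eq_of_lt (ha p), Equiv.symm_apply_apply]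

/-- A split reverses the records with a large key. The recursive call therefore sorts by a key
reflected on the upper half: small keys end up ascending and large ones descending, and the split
puts both in ascending order. -/
theorem sortRounds_computes (hN : N ≤ M * d) (hK : K₁ * N < K) {a : Fin N → ℕ}
    (ha0 : ∀ p, a p ≠ 0) (ha : ∀ p, a p < K₁) (B : ℕ) (key : ℕ → ℕ)
    (hkey : ∀ p, key (a p) < 2 ^ B) :
    ∃ σ : Equiv.Perm (Fin N),
      Computes mem K (sortRounds M d H N K₁ B key) (pad a) (pad fun p => a (σ p)) ∧
      ∀ p q, key (a (σ p)) < key (a (σ q)) → p < q := by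
  induction B generalizing key with
  | zero =>
    refine ⟨1, fun c => rfl, fun p q h => ?_⟩
    have := hkey ((1 : Equiv.Perm (Fin N)) q)
    rw [pow_zero] at this
    omega
  | succ B ih =>
    have hpow : 2 ^ (B + 1) = 2 * 2 ^ B := by rw [pow_succ, mul_comm]
    obtain ⟨σ, hσ, hord⟩ := ih
      (fun v => if key v < 2 ^ B then key v else 2 ^ (B + 1) - 1 - key v) (by
        intro p
        have := hkey p
        split_ifs <;> omega)
    obtain ⟨τ, hτ, hzz, hzo, hoo⟩ := exists_splitPerm fun p => key (a (σ p)) < 2 ^ B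
    refine ⟨τ.symm.trans σ, ?_, ?_⟩
    · exact hσ.append (splitRounds_computes hP hN hK (fun p => ha0 _) (fun p => ha _) key _ τ hτ)
    · intro p q h
      simp only [Equiv.trans_apply] at h
      obtain ⟨p, rfl⟩ := τ.surjective p
      obtain ⟨q, rfl⟩ := τ.surjective q
      rw [Equiv.symm_apply_apply, Equiv.symm_apply_apply] at h
      have hpk := hkey (σ p)
      have hqk := hkey (σ q)
      by_cases hp : key (a (σ p)) < 2 ^ B <;> by_cases hq : key (a (σ q)) < 2 ^ B
      · refine hzz p q hp hq (hord p q ?_)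
        simp only [hp, hq, if_true]
        exact h
      · exact hzo p q hp hq
      · omega
      · refine hoo q p hq hp (hord q p ?_)
        simp only [hp, hq, if_false]
        omega

end

end CellMachine

/-! ### Edge records, linking of reversed edges, and Bellman–Ford on records. -/

namespace CellMachine

/-- A record that describes one orientation of an edge (or a vertex, as an edge from the vertex to
itself) together with the current label of its source and the position of the reversed record. -/
@[ext]
structure Entry where
  src : ℕ
  tgt : ℕ
  cost : ℕ
  lab : ℕ
  ptr : ℕ

namespace Entry

/-- All fields are less than `β`. -/
structure Bounded (β : ℕ) (e : Entry) : Prop where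
  src : e.src < β
  tgt : e.tgt < β
  cost : e.cost < β
  lab : e.lab < β
  ptr : e.ptr < β

/-- The number that represents a record. -/
def code (β : ℕ) (e : Entry) : ℕ :=
  1 + (e.src + β * (e.tgt + β * (e.cost + β * (e.lab + β * e.ptr))))

/-- The record that a number represents. -/
def dec (β : ℕ) (v : ℕ) : Entry where
  src := (v - 1) % β
  tgt := (v - 1) / β % β
  cost := (v - 1) / β / β % β
  lab := (v - 1) / β / β / β % β
  ptr := (v - 1) / β / β / β / β

theorem code_ne_zero (β : ℕ) (e : Entry) : e.code β ≠ 0 := by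
  simp [code]

theorem add_mul_lt {β x y k : ℕ} (hx : x < β) (hy : y < k) : x + β * y < β * k :=
  calc x + β * y < β + β * y := by omega
    _ = β * (y + 1) := by ring
    _ ≤ β * k := Nat.mul_le_mul_left _ hy

theorem code_lt {β : ℕ} {e : Entry} (h : e.Bounded β) : e.code β < β ^ 5 + 1 := by
  have := add_mul_lt h.src (add_mul_lt h.tgt (add_mul_lt h.cost (add_mul_lt h.lab h.ptr)))
  rw [code, show β ^ 5 = β * (β * (β * (β * β))) by ring]
  omega

theorem dec_code {β : ℕ} {e : Entry} (h : e.Bounded β) : dec β (e.code β) = e := by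
  have hβ : 0 < β := (Nat.zero_le _).trans_lt h.src
  have hd : ∀ x y, x < β → (x + β * y) / β = y := by
    intro x y hx
    rw [Nat.add_mul_div_left _ _ hβ, Nat.div_eq_of_lt hx, zero_add]
  have hm : ∀ x y, x < β → (x + β * y) % β = x := by
    intro x y hx
    rw [Nat.add_mul_mod_self_left, Nat.mod_eq_of_lt hx]
  ext <;> simp only [dec, code, Nat.add_sub_cancel_left, hd _ _ h.src, hd _ _ h.tgt,
    hd _ _ h.cost, hd _ _ h.lab, hm _ _ h.src, hm _ _ h.tgt, hm _ _ h.cost, hm _ _ h.lab]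

end Entry

/-- The array of the codes of records. -/
def entryArray {N : ℕ} (β : ℕ) (E : Fin N → Entry) : ℕ → ℕ := pad fun p => (E p).code β

/-- The function on codes that corresponds to a function on records. -/
def liftEntry (β : ℕ) (φ : Entry → Entry) (v : ℕ) : ℕ :=
  if v = 0 then 0 else (φ (Entry.dec β v)).code β

/-- Every cell updates its record. -/
def mapRound (M d β : ℕ) (φ : ℕ → Entry → Entry) : Round M (2 * d) :=
  routeRound M d (fun p _ => p) fun p v _ => liftEntry β (φ p) v

/-- Reversal of the first `N` cells. -/
def reverseRound (M d N : ℕ) : Round M (2 * d) :=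
  routeRound M d (fun p _ => N - (p + 1)) fun _ v _ => v

/-- The number whose maximum among the preceding cells is computed by `minPass`. -/
def minKey (β : ℕ) (κ : Entry → ℕ) (v : ℕ) : ℕ :=
  if v = 0 then 0 else κ (Entry.dec β v) * β + (β - 1 - (Entry.dec β v).lab)

/-- Every label is replaced by the minimum of the labels of all records with the same key that are
not after it. -/
def minPass (M d H β : ℕ) (κ : Entry → ℕ) : List (Round M (2 * d)) :=
  scanMax M d H (fun _ v => minKey β κ v) fun _ v z =>
    liftEntry β (fun e => { e with lab := β - 1 - max z (minKey β κ v) % β }) v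

/-- Every label is replaced by the minimum of the labels of all records with the same source. -/
def minRounds (M d H N β : ℕ) : List (Round M (2 * d)) :=
  minPass M d H β Entry.src ++ [reverseRound M d N] ++ minPass M d H β (fun e => β - 1 - e.src) ++
    [reverseRound M d N]

/-- Every record is sent to the position of its reversed record and becomes the latter. -/
def relaxRound (M d β : ℕ) : Round M (2 * d) :=
  routeRound M d (fun _ v => (Entry.dec β v).ptr) fun p v _ =>
    liftEntry β (fun e => ⟨e.tgt, e.src, e.cost, e.lab + e.cost, p⟩) v

/-- The Bellman–Ford algorithm with `I` iterations. -/
def bellmanFordRounds (M d H N β : ℕ) : ℕ → List (Round M (2 * d))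
  | 0 => minRounds M d H N β
  | I + 1 => bellmanFordRounds M d H N β I ++ ([relaxRound M d β] ++ minRounds M d H N β)

/-- Sorts the records by their sources and finds the positions of the reversed records. -/
def linkRounds (M d H N β B ν : ℕ) : List (Round M (2 * d)) :=
  sortRounds M d H N (β ^ 5 + 1) B
    (fun v => (Entry.dec β v).src * ν + (Entry.dec β v).tgt) ++
  [mapRound M d β fun p e => { e with ptr := p }] ++
  sortRounds M d H N (β ^ 5 + 1) B
    (fun v => (Entry.dec β v).tgt * ν + (Entry.dec β v).src) ++
  [mapRound M d β fun _ e => { e with src := e.tgt, tgt := e.src }]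

theorem length_minRounds (M d H N β : ℕ) : (minRounds M d H N β).length = 2 * H + 6 := by
  simp only [minRounds, minPass, List.length_append, length_scanMax, List.length_singleton]
  ring

theorem length_bellmanFordRounds (M d H N β I : ℕ) :
    (bellmanFordRounds M d H N β I).length = (2 * H + 7) * I + (2 * H + 6) := by
  induction I with
  | zero => simp [bellmanFordRounds, length_minRounds]
  | succ I ih =>
    simp only [bellmanFordRounds, List.length_append, ih, length_minRounds, List.length_singleton]
    ring

theorem length_linkRounds (M d H N β B ν : ℕ) :
    (linkRounds M d H N β B ν).length = 2 * (B * (H + 3)) + 2 := by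
  simp only [linkRounds, List.length_append, length_sortRounds, List.length_singleton]
  ring

/-- The pair of key and complemented label, read as a two-digit number to base `β`, is ordered
lexicographically. As keys increase along the array, the prefix maximum has the current key as its
upper digit, and then the smallest label of that key. -/
theorem isLeast_of_max {N β : ℕ} {κ lab : Fin N → ℕ} (hκ : Monotone κ) (hlab : ∀ p, lab p < β)
    (p : Fin N) :
    IsLeast {x | ∃ q ≤ p, κ q = κ p ∧ x = lab q}
      (β - 1 - max ((Finset.Iio p).sup fun q => κ q * β + (β - 1 - lab q))
        (κ p * β + (β - 1 - lab p)) % β) := by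
  set X := max ((Finset.Iio p).sup fun q => κ q * β + (β - 1 - lab q))
        (κ p * β + (β - 1 - lab p)) with hX
  have hβ : 0 < β := (Nat.zero_le _).trans_lt (hlab p)
  have hle : ∀ q ≤ p, κ q * β + (β - 1 - lab q) ≤ X := by
    intro q hq
    rcases hq.lt_or_eq with h | h
    · exact (Finset.le_sup (f := fun q => κ q * β + (β - 1 - lab q))
        (Finset.mem_Iio.2 h)).trans (le_max_left _ _)
    · rw [h]; exact le_max_right _ _
  obtain ⟨q₀, hq₀, hXq⟩ : ∃ q ≤ p, X = κ q * β + (β - 1 - lab q) := by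
    rcases max_choice ((Finset.Iio p).sup fun q => κ q * β + (β - 1 - lab q))
        (κ p * β + (β - 1 - lab p)) with h | h
    · by_cases hne : (Finset.Iio p).Nonempty
      · obtain ⟨q, hq, hq'⟩ := Finset.exists_mem_eq_sup _ hne
          fun q => κ q * β + (β - 1 - lab q)
        exact ⟨q, (Finset.mem_Iio.1 hq).le, by rw [hX, h, hq']⟩
      · rw [Finset.not_nonempty_iff_eq_empty] at hne
        refine ⟨p, le_rfl, ?_⟩
        rw [hX, hne]
        simp
    · exact ⟨p, le_rfl, h⟩
  -- If the maximiser had a smaller key, record `p` itself would exceed it in the upper digit.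
  have hκq : κ q₀ = κ p := by
    refine le_antisymm (hκ hq₀) ?_
    by_contra hlt
    have h1 := hle p le_rfl
    rw [hXq] at h1
    have h2 : (κ q₀ + 1) * β ≤ κ p * β := Nat.mul_le_mul_right _ (by omega)
    rw [Nat.succ_mul] at h2
    omega
  have hmod : X % β = β - 1 - lab q₀ := by
    rw [hXq, mul_comm, Nat.mul_add_mod, Nat.mod_eq_of_lt (by omega)]
  rw [hmod]
  have hq₀' := hlab q₀
  refine ⟨⟨q₀, hq₀, hκq, by omega⟩, ?_⟩
  rintro x ⟨q, hq, hκ', rfl⟩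
  have h1 := hle q hq
  rw [hXq, hκq, hκ'] at h1
  have := hlab q
  omega

section

variable {M d H mem K N β : ℕ} (hP : Params M d H mem K) (hN : N ≤ M * d)
  (hK : (β ^ 5 + 1) * (N + 1) < K)
include hP

omit hP in
theorem liftEntry_zero (φ : Entry → Entry) : liftEntry β φ 0 = 0 := if_pos rfl

omit hP in
theorem liftEntry_code (φ : Entry → Entry) {e : Entry} (he : e.Bounded β) :
    liftEntry β φ (e.code β) = (φ e).code β := by
  rw [liftEntry, if_neg (e.code_ne_zero β), Entry.dec_code he]

include hK

omit hP in
theorem code_lt_of_bounded {e : Entry} (he : e.Bounded β) : e.code β < K := by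
  refine (Entry.code_lt he).trans_le (le_trans ?_ hK.le)
  exact Nat.le_mul_of_pos_right _ (Nat.succ_pos _)

theorem minPass_computes {E : Fin N → Entry} (hE : ∀ p, (E p).Bounded β) {κ : Entry → ℕ}
    (hκβ : ∀ p, κ (E p) < β) (hκ : Monotone fun p => κ (E p)) :
    ∃ l : Fin N → ℕ, Computes mem K (minPass M d H β κ) (entryArray β E)
        (entryArray β fun p => { E p with lab := l p }) ∧
      ∀ p, IsLeast {x | ∃ q ≤ p, κ (E q) = κ (E p) ∧ x = (E q).lab} (l p) := by
  refine ⟨fun p => β - 1 - max ((Finset.Iio p).sup fun q => κ (E q) * β + (β - 1 - (E q).lab))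
        (κ (E p) * β + (β - 1 - (E p).lab)) % β, ?_,
    fun p => isLeast_of_max hκ (fun p => (hE p).lab) p⟩
  have hmk : ∀ p, minKey β κ ((E p).code β) = κ (E p) * β + (β - 1 - (E p).lab) := by
    intro p
    rw [minKey, if_neg ((E p).code_ne_zero β), Entry.dec_code (hE p)]
  refine scanMax_pad hP ?_ ?_ (fun _ => if_pos rfl) ?_ (fun _ _ => liftEntry_zero _) ?_
  · exact fun p => code_lt_of_bounded hK (hE p)
  · intro p
    have hp := hE p
    have hβ : 0 < β := (Nat.zero_le _).trans_lt hp.src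
    exact code_lt_of_bounded hK ⟨hp.src, hp.tgt, hp.cost, by simp only; omega, hp.ptr⟩
  · intro p
    have hp := hE p
    have hβ : 0 < β := (Nat.zero_le _).trans_lt hp.src
    rw [hmk]
    refine lt_of_lt_of_le ?_ hK.le
    have h1 : κ (E p) * β + (β - 1 - (E p).lab) < β * β := by
      rw [mul_comm, add_comm]
      exact Entry.add_mul_lt (by omega) (hκβ p)
    have h2 : β * β ≤ β ^ 5 := by
      rw [← sq]; exact Nat.pow_le_pow_right hβ (by norm_num)
    have h3 : β ^ 5 + 1 ≤ (β ^ 5 + 1) * (N + 1) := Nat.le_mul_of_pos_right _ (Nat.succ_pos _)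
    omega
  · intro p
    simp only [hmk]
    rw [liftEntry_code _ (hE p)]

include hN

theorem reverseRound_computes {E : Fin N → Entry} (hE : ∀ p, (E p).Bounded β) :
    Computes mem K [reverseRound M d N] (entryArray β E) (entryArray β fun p => E (Fin.rev p)) := by
  refine route_pad hP hN Fin.revPerm (fun p => code_lt_of_bounded hK (hE _)) (fun _ => rfl) ?_ ?_
  · intro p; simp [Fin.val_rev]
  · intro p; simp

/-- The first pass accounts for records at or before the current one. After reversal the
complemented source is monotone, so the second pass accounts for the others; a second reversal
restores the order. -/
theorem minRounds_computes {E : Fin N → Entry} (hE : ∀ p, (E p).Bounded β)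
    (hs : Monotone fun p => (E p).src) :
    ∃ l : Fin N → ℕ, Computes mem K (minRounds M d H N β) (entryArray β E)
        (entryArray β fun p => { E p with lab := l p }) ∧
      ∀ p, IsLeast {x | ∃ q, (E q).src = (E p).src ∧ x = (E q).lab} (l p) := by
  obtain ⟨l₁, h₁, hl₁⟩ := minPass_computes hP hK hE (fun p => (hE p).src) hs
  have hE₁ : ∀ p, Entry.Bounded β { E p with lab := l₁ p } := by
    intro p
    obtain ⟨q, -, -, hq⟩ := (hl₁ p).1
    exact ⟨(hE p).src, (hE p).tgt, (hE p).cost, by rw [hq]; exact (hE q).lab, (hE p).ptr⟩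
  have h₂ := reverseRound_computes hP hN hK hE₁
  obtain ⟨l₂, h₃, hl₂⟩ := minPass_computes (κ := fun e => β - 1 - e.src) hP hK
    (fun p => hE₁ (Fin.rev p)) (fun p => by have := (hE p.rev).src; simp only; omega)
    (fun p q hpq => Nat.sub_le_sub_left (hs (Fin.rev_le_rev.2 hpq)) _)
  have hE₂ : ∀ p, Entry.Bounded β { E (Fin.rev p) with lab := l₂ p } := by
    intro p
    obtain ⟨q, -, -, hq⟩ := (hl₂ p).1
    have := hE (Fin.rev p)
    exact ⟨this.src, this.tgt, this.cost, by rw [hq]; exact (hE₁ _).lab, this.ptr⟩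
  have h₄ := reverseRound_computes hP hN hK hE₂
  simp only [Fin.rev_rev] at h₄
  refine ⟨fun p => l₂ (Fin.rev p), ((h₁.append h₂).append h₃).append h₄, fun p => ⟨?_, ?_⟩⟩
  · obtain ⟨q, -, hqs, hq⟩ := (hl₂ (Fin.rev p)).1
    obtain ⟨r, -, hrs, hr⟩ := (hl₁ (Fin.rev q)).1
    have h1 := (hE p).src
    have h2 := (hE q.rev).src
    simp only [Fin.rev_rev] at hqs
    refine ⟨r, by omega, hq.trans hr⟩
  · rintro x ⟨q, hqs, rfl⟩
    rcases le_total q p with h | h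
    · have h1 : l₂ (Fin.rev p) ≤ l₁ p := (hl₂ (Fin.rev p)).2 ⟨Fin.rev p, le_rfl, rfl, by simp⟩
      exact h1.trans ((hl₁ p).2 ⟨q, h, hqs, rfl⟩)
    · have h1 : l₂ (Fin.rev p) ≤ l₁ q :=
        (hl₂ (Fin.rev p)).2 ⟨Fin.rev q, Fin.rev_le_rev.2 h, by simp [hqs], by simp⟩
      exact h1.trans ((hl₁ q).2 ⟨q, le_rfl, rfl, rfl⟩)

theorem mapRound_computes {φ : ℕ → Entry → Entry} {E : Fin N → Entry} (hE : ∀ p, (E p).Bounded β)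
    (hφ : ∀ p : Fin N, (φ p (E p)).Bounded β) :
    Computes mem K [mapRound M d β φ] (entryArray β E) (entryArray β fun p => φ p (E p)) := by
  refine route_pad hP hN (Equiv.refl _) (fun p => code_lt_of_bounded hK (hφ p))
    (fun _ => liftEntry_zero _) (fun _ => rfl) ?_
  intro p
  rw [liftEntry_code _ (hE p)]
  rfl

end

/-- The records that are used by the Bellman–Ford algorithm: the reversed record of the record at
position `p` is at position `τ p`, and the records are sorted by their sources. -/
structure LinkedEntries (N : ℕ) where
  s : Fin N → ℕ
  t : Fin N → ℕ
  c : Fin N → ℕ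
  τ : Equiv.Perm (Fin N)
  mono : Monotone s
  invol : ∀ p, τ (τ p) = p
  s_link : ∀ p, s (τ p) = t p
  c_link : ∀ p, c (τ p) = c p

namespace LinkedEntries

/-- The records with labels `l`. -/
def entry {N : ℕ} (R : LinkedEntries N) (l : Fin N → ℕ) (p : Fin N) : Entry :=
  ⟨R.s p, R.t p, R.c p, l p, R.τ p⟩

theorem t_link {N : ℕ} (R : LinkedEntries N) (p : Fin N) : R.t (R.τ p) = R.s p := by
  rw [← R.s_link, R.invol]

variable {M d H mem K N β : ℕ} (hP : Params M d H mem K) (hN : N ≤ M * d)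
  (hK : (β ^ 5 + 1) * (N + 1) < K) (R : LinkedEntries N)
include hP hN hK

/-- The record at `R.τ p` carries the label of the target of record `p`. Adding the cost and moving
to `p` yields the label offered to the source of `p` through this edge, and the pointers survive
because `R.τ` is an involution. -/
theorem relaxRound_computes {l : Fin N → ℕ} (hb : ∀ p, (R.entry l p).Bounded β)
    (hl : ∀ p, l p + R.c p < β) :
    Computes mem K [relaxRound M d β] (entryArray β (R.entry l))
      (entryArray β (R.entry fun p => l (R.τ p) + R.c p)) := by
  have hb' : ∀ p, (R.entry (fun p => l (R.τ p) + R.c p) p).Bounded β := by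
    intro p
    refine ⟨(hb p).src, (hb p).tgt, (hb p).cost, ?_, (hb p).ptr⟩
    have := hl (R.τ p)
    rw [R.c_link] at this
    exact this
  refine route_pad hP hN R.τ (fun p => code_lt_of_bounded hK (hb' p))
    (fun _ => liftEntry_zero _) ?_ ?_
  · intro p
    rw [Entry.dec_code (hb p)]
    rfl
  · intro p
    rw [liftEntry_code _ (hb p)]
    congr 1
    simp only [entry, R.s_link, R.t_link, R.invol, R.c_link]

/-- If every source has a record with a label that is at most `A` and costs `0`, then the
Bellman–Ford algorithm computes the successive labels. -/
theorem bellmanFord_computes {l₀ : Fin N → ℕ} (hb : ∀ p, (R.entry l₀ p).Bounded β) {A : ℕ}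
    (hA : ∀ p, A + R.c p < β)
    (hself : ∀ p, ∃ q, R.s q = R.s p ∧ R.τ q = q ∧ R.c q = 0 ∧ l₀ q ≤ A) :
    ∃ l : ℕ → Fin N → ℕ,
      (∀ I, Computes mem K (bellmanFordRounds M d H N β I) (entryArray β (R.entry l₀))
        (entryArray β (R.entry (l I)))) ∧
      (∀ p, IsLeast {x | ∃ q, R.s q = R.s p ∧ x = l₀ q} (l 0 p)) ∧
      ∀ i p, IsLeast {x | ∃ q, R.s q = R.s p ∧ x = l i (R.τ q) + R.c q} (l (i + 1) p) := by
  have hmin : ∀ l : Fin N → ℕ, (∀ p, l p < β) → ∃ l' : Fin N → ℕ,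
      Computes mem K (minRounds M d H N β) (entryArray β (R.entry l))
        (entryArray β (R.entry l')) ∧ ∀ p, IsLeast {x | ∃ q, R.s q = R.s p ∧ x = l q} (l' p) := by
    intro l hl
    exact minRounds_computes hP hN hK (E := R.entry l)
      (fun p => ⟨(hb p).src, (hb p).tgt, (hb p).cost, hl p, (hb p).ptr⟩) R.mono
  obtain ⟨f₀, hf₀, hl₀⟩ := hmin l₀ fun p => (hb p).lab
  -- Existence is stated for every labelling, with an arbitrary value where the bound `A` fails, so
  -- that `choose` gives a total function to iterate.
  have hstep : ∀ l : Fin N → ℕ, ∃ l' : Fin N → ℕ, (∀ p, l p ≤ A) →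
      Computes mem K ([relaxRound M d β] ++ minRounds M d H N β) (entryArray β (R.entry l))
        (entryArray β (R.entry l')) ∧
      ∀ p, IsLeast {x | ∃ q, R.s q = R.s p ∧ x = l (R.τ q) + R.c q} (l' p) := by
    intro l
    by_cases hl : ∀ p, l p ≤ A
    · have hl1 : ∀ p, l p + R.c p < β := fun p => (Nat.add_le_add_right (hl p) _).trans_lt (hA p)
      have hb1 : ∀ p, (R.entry l p).Bounded β := fun p => ⟨(hb p).src, (hb p).tgt, (hb p).cost,
        (Nat.le_add_right _ _).trans_lt (hl1 p), (hb p).ptr⟩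
      obtain ⟨l', h, h'⟩ := hmin (fun p => l (R.τ p) + R.c p) (fun p => by
        have := hl1 (R.τ p)
        rw [R.c_link] at this
        exact this)
      exact ⟨l', fun _ => ⟨(relaxRound_computes hP hN hK R hb1 hl1).append h, h'⟩⟩
    · exact ⟨l, fun h => absurd h hl⟩
  choose F hF using hstep
  let l : ℕ → Fin N → ℕ := fun i => Nat.rec f₀ (fun _ l => F l) i
  have hinv : ∀ i, (∀ p, l i p ≤ A) ∧ ∀ p q, R.s p = R.s q → l i p = l i q := by
    intro i
    induction i with
    | zero =>
      refine ⟨fun p => ?_, fun p q hpq => ?_⟩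
      · obtain ⟨q, hq, -, -, hqA⟩ := hself p
        exact ((hl₀ p).2 ⟨q, hq, rfl⟩).trans hqA
      · have h := hl₀ q
        rw [← hpq] at h
        exact (hl₀ p).unique h
    | succ i ih =>
      have hs := (hF (l i) ih.1).2
      refine ⟨fun p => ?_, fun p q hpq => ?_⟩
      · obtain ⟨q, hq, hτ, hc, -⟩ := hself p
        refine ((hs p).2 ⟨q, hq, rfl⟩).trans ?_
        rw [hτ, hc, add_zero]
        exact ih.1 q
      · have h := hs q
        rw [← hpq] at h
        exact (hs p).unique h
  refine ⟨l, fun I => ?_, hl₀, fun i p => (hF (l i) (hinv i).1).2 p⟩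
  induction I with
  | zero => exact hf₀
  | succ I ih => exact ih.append (hF (l I) (hinv I).1).1

end LinkedEntries

section

variable {M d H mem K N β B ν : ℕ} (hP : Params M d H mem K) (hN : N ≤ M * d)
  (hK : (β ^ 5 + 1) * (N + 1) < K)
include hP hN hK

/-- The set of pairs (source, target) is symmetric, so the `p`-th record in the order by (target,
source) is the reverse of the `p`-th in the order by (source, target). After exchanging its ends it
plays the role of the latter, and its pointer is its own former position, where its reverse is
found. Labels get transported to the reversed records, which leaves those of self-records unchanged.
-/
theorem linkRounds_computes (hβ : N ≤ β) (hB : ν * ν ≤ 2 ^ B) {E : Fin N → Entry}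
    (hE : ∀ p, (E p).Bounded β) (hsν : ∀ p, (E p).src < ν) (htν : ∀ p, (E p).tgt < ν)
    (hinj : ∀ p q, (E p).src = (E q).src → (E p).tgt = (E q).tgt → p = q)
    (hsymm : ∀ p, ∃ q, (E q).src = (E p).tgt ∧ (E q).tgt = (E p).src ∧ (E q).cost = (E p).cost) :
    ∃ (R : LinkedEntries N) (σ : Equiv.Perm (Fin N)),
      (∀ p, R.s p = (E (σ p)).src ∧ R.t p = (E (σ p)).tgt ∧ R.c p = (E (σ p)).cost) ∧
      Computes mem K (linkRounds M d H N β B ν) (entryArray β E)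
        (entryArray β (R.entry fun p => (E (σ (R.τ p))).lab)) := by
  have hK' : (β ^ 5 + 1) * N < K := lt_of_le_of_lt (Nat.mul_le_mul_left _ (Nat.le_succ N)) hK
  have hpair : ∀ {x y : ℕ}, x < ν → y < ν → x * ν + y < 2 ^ B := by
    intro x y hx hy
    refine lt_of_lt_of_le ?_ hB
    rw [add_comm, mul_comm]
    exact Entry.add_mul_lt hy hx
  have hpair_inj : ∀ {x y x' y' : ℕ}, y < ν → y' < ν → x * ν + y = x' * ν + y' →
      x = x' ∧ y = y' := fun hy hy' h => address_inj hy hy' h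
  obtain ⟨σ, hσ, hσo⟩ := sortRounds_computes hP hN hK' (a := fun p => (E p).code β)
    (fun p => Entry.code_ne_zero _ _) (fun p => Entry.code_lt (hE p)) B
    (fun v => (Entry.dec β v).src * ν + (Entry.dec β v).tgt)
    (fun p => by simp only [Entry.dec_code (hE p)]; exact hpair (hsν p) (htν p))
  simp only [Entry.dec_code (hE _)] at hσo
  have hE₁ : ∀ p : Fin N, Entry.Bounded β { E (σ p) with ptr := p } := fun p =>
    ⟨(hE _).src, (hE _).tgt, (hE _).cost, (hE _).lab, p.2.trans_le hβ⟩
  have h₂ := mapRound_computes hP hN hK (φ := fun p e => { e with ptr := p })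
    (fun p => hE (σ p)) hE₁
  obtain ⟨τ, hτ, hτo⟩ := sortRounds_computes hP hN hK'
    (a := fun p => Entry.code β { E (σ p) with ptr := p })
    (fun p => Entry.code_ne_zero _ _) (fun p => Entry.code_lt (hE₁ p)) B
    (fun v => (Entry.dec β v).tgt * ν + (Entry.dec β v).src)
    (fun p => by simp only [Entry.dec_code (hE₁ _)]; exact hpair (htν _) (hsν _))
  simp only [Entry.dec_code (hE₁ _)] at hτo
  have hE₃ : ∀ p : Fin N, Entry.Bounded β
      ⟨(E (σ (τ p))).tgt, (E (σ (τ p))).src, (E (σ (τ p))).cost, (E (σ (τ p))).lab, τ p⟩ :=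
    fun p => ⟨(hE _).tgt, (hE _).src, (hE _).cost, (hE _).lab, (τ p).2.trans_le hβ⟩
  have h₄ := mapRound_computes hP hN hK
    (φ := fun _ e => { e with src := e.tgt, tgt := e.src }) (fun p => hE₁ (τ p)) hE₃
  have hstrict : ∀ k : Fin N → ℕ, Function.Injective k → (∀ p q, k p < k q → p < q) →
      StrictMono k := by
    intro k hk h p q hpq
    rcases lt_trichotomy (k p) (k q) with h1 | h1 | h1
    · exact h1
    · exact absurd (hk h1) hpq.ne
    · exact absurd (h q p h1) hpq.asymm
  -- Both sides are strictly increasing enumerations of the same set of numbers, hence equal.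
  have hkey : ∀ p, (E (σ (τ p))).tgt * ν + (E (σ (τ p))).src =
      (E (σ p)).src * ν + (E (σ p)).tgt := by
    have hs1 := hstrict (fun p => (E (σ p)).src * ν + (E (σ p)).tgt) (fun p q h => by
      obtain ⟨h1, h2⟩ := hpair_inj (htν _) (htν _) h
      exact σ.injective (hinj _ _ h1 h2)) hσo
    have hs2 := hstrict (fun p => (E (σ (τ p))).tgt * ν + (E (σ (τ p))).src) (fun p q h => by
      obtain ⟨h1, h2⟩ := hpair_inj (hsν _) (hsν _) h
      exact τ.injective (σ.injective (hinj _ _ h2 h1))) hτo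
    refine congrFun ((hs2.range_inj hs1).1 ?_)
    ext x
    constructor
    · rintro ⟨p, rfl⟩
      obtain ⟨q, hq1, hq2, -⟩ := hsymm (σ (τ p))
      exact ⟨σ.symm q, by simp [hq1, hq2]⟩
    · rintro ⟨p, rfl⟩
      obtain ⟨q, hq1, hq2, -⟩ := hsymm (σ p)
      exact ⟨τ.symm (σ.symm q), by simp [hq1, hq2]⟩
  have hlink : ∀ p, (E (σ (τ p))).tgt = (E (σ p)).src ∧ (E (σ (τ p))).src = (E (σ p)).tgt :=
    fun p => hpair_inj (hsν _) (htν _) (hkey p)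
  have hcost : ∀ p, (E (σ (τ p))).cost = (E (σ p)).cost := by
    intro p
    obtain ⟨q, hq1, hq2, hq3⟩ := hsymm (σ p)
    have : q = σ (τ p) := hinj _ _ (by rw [hq1, (hlink p).2]) (by rw [hq2, (hlink p).1])
    rw [← this, hq3]
  let R : LinkedEntries N :=
    { s := fun p => (E (σ p)).src
      t := fun p => (E (σ p)).tgt
      c := fun p => (E (σ p)).cost
      τ := τ
      mono := by
        intro p q hpq
        by_contra hlt
        have h1 : (E (σ q)).src * ν + (E (σ q)).tgt < (E (σ p)).src * ν + (E (σ p)).tgt := by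
          have h2 : ((E (σ q)).src + 1) * ν ≤ (E (σ p)).src * ν :=
            Nat.mul_le_mul_right _ (by simp only [not_le] at hlt; exact hlt)
          rw [Nat.succ_mul] at h2
          have := htν (σ q)
          omega
        exact absurd (hσo q p h1) hpq.not_gt
      invol := fun p => σ.injective (hinj _ _
        (by rw [(hlink (τ p)).2, (hlink p).1]) (by rw [(hlink (τ p)).1, (hlink p).2]))
      s_link := fun p => (hlink p).2
      c_link := hcost }
  refine ⟨R, σ, fun p => ⟨rfl, rfl, rfl⟩, ((hσ.append h₂).append hτ).append ?_⟩
  have hR : (R.entry fun p => (E (σ (R.τ p))).lab) = fun p =>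
      ⟨(E (σ (τ p))).tgt, (E (σ (τ p))).src, (E (σ (τ p))).cost, (E (σ (τ p))).lab, τ p⟩ := by
    funext p
    simp only [LinkedEntries.entry, R, (hlink p).1, (hlink p).2, hcost]
  rw [hR]
  exact h₄

end

end CellMachine

/-! ### Reading the input edges, compacting them, and making copies. -/

namespace CellMachine

/-- Moves the `r`-th nonempty cell to the positions from `r * w` to `r * w + w - 1`, for all `r`
that are less than `m`. -/
def spreadRounds (M d H m w K₁ : ℕ) : List (Round M (2 * d)) :=
  scanSum M d H (fun _ v => if v ≠ 0 then 1 else 0)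
    (fun _ v z => if v = 0 then 0 else v + K₁ * z) ++
  [routeRound M d (fun _ v => v / K₁ * w) fun _ v _ => v] ++
  scanMax M d H (fun _ v => v) fun p v z => if p < w * m then max z v % K₁ else 0

theorem length_spreadRounds (M d H m w K₁ : ℕ) :
    (spreadRounds M d H m w K₁).length = 2 * H + 5 := by
  simp only [spreadRounds, List.length_append, length_scanMax, length_scanSum,
    List.length_singleton]
  ring

/-- The rank among nonempty cells is put above the content as an upper digit. The cell of rank `r`
moves to `r * w`, and the prefix maximum copies it over the gap up to the next one. -/
theorem spreadRounds_computes {M d H mem K m w K₁ : ℕ} (hP : Params M d H mem K) (hw : 0 < w)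
    (hK : K₁ * (m + 1) < K) {x : ℕ → ℕ} (hx : ∀ p, x p < K₁)
    (hm : ((Finset.range (M * d)).filter fun p => x p ≠ 0).card = m) :
    ∃ φ : Fin m → ℕ, Function.Injective φ ∧ (∀ r, φ r < M * d ∧ x (φ r) ≠ 0) ∧
      (∀ p < M * d, x p ≠ 0 → ∃ r, φ r = p) ∧
      Computes mem K (spreadRounds M d H m w K₁) x
        fun p => if h : p < w * m then x (φ ⟨p / w, Nat.div_lt_of_lt_mul h⟩) else 0 := by
  have hK₁ : 0 < K₁ := (Nat.zero_le _).trans_lt (hx 0)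
  let rank : ℕ → ℕ := fun p => ∑ q ∈ Finset.range p, if x q ≠ 0 then 1 else 0
  have hrank : ∀ p, rank p = ((Finset.range p).filter fun q => x q ≠ 0).card := fun p => by
    rw [Finset.card_filter]
  have hrank_le : ∀ p ≤ M * d, rank p ≤ m := by
    intro p hp
    rw [hrank, ← hm]
    exact Finset.card_le_card (Finset.filter_subset_filter _ (Finset.range_mono hp))
  have hrank_lt : ∀ p q, p < q → x p ≠ 0 → rank p < rank q := by
    intro p q hpq hp
    have h1 : rank (p + 1) = rank p + 1 := by
      simp only [rank, Finset.sum_range_succ, hp, ne_eq, not_false_eq_true, if_true]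
    have h2 : rank (p + 1) ≤ rank q := by
      rw [hrank, hrank]
      exact Finset.card_le_card (Finset.filter_subset_filter _ (Finset.range_mono hpq))
    omega
  let Z := (Finset.range (M * d)).filter fun p => x p ≠ 0
  have hZ : ∀ p, p ∈ Z ↔ p < M * d ∧ x p ≠ 0 := fun p => by simp [Z]
  let f : Z → Fin m := fun p => ⟨rank p, lt_of_lt_of_le
    (hrank_lt _ _ ((hZ p).1 p.2).1 ((hZ p).1 p.2).2) (hrank_le _ le_rfl)⟩
  have hf : Function.Bijective f := by
    rw [Fintype.bijective_iff_injective_and_card]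
    refine ⟨fun p q hpq => ?_, by simpa using hm⟩
    have hpq : rank p = rank q := congrArg Fin.val hpq
    by_contra hne
    rcases lt_or_gt_of_ne (fun h => hne (Subtype.ext h) : (p : ℕ) ≠ q) with h | h
    · exact (hrank_lt _ _ h ((hZ p).1 p.2).2).ne hpq
    · exact (hrank_lt _ _ h ((hZ q).1 q.2).2).ne' hpq
  let e := Equiv.ofBijective f hf
  have hφr : ∀ r : Fin m, rank (e.symm r) = r := fun r =>
    congrArg Fin.val (e.apply_symm_apply r)
  have hφZ : ∀ r : Fin m, (e.symm r : ℕ) < M * d ∧ x (e.symm r) ≠ 0 := fun r =>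
    (hZ _).1 (e.symm r).2
  refine ⟨fun r => e.symm r, fun r r' h => e.symm.injective (Subtype.ext h), hφZ, ?_, ?_⟩
  · intro p hp hxp
    exact ⟨e ⟨p, (hZ p).2 ⟨hp, hxp⟩⟩, by simp⟩
  have hbd : ∀ v z, v < K₁ → z ≤ m → v + K₁ * z < K := by
    intro v z hv hz
    exact (Entry.add_mul_lt hv (Nat.lt_succ_of_le hz)).trans hK
  have hxK : ∀ p, x p < K := fun p => by have := hbd _ 0 (hx p) (Nat.zero_le _); omega
  have h₁ := scanSum_computes hP (x := x) (g := fun _ v => if v ≠ 0 then 1 else 0)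
    (f := fun _ v z => if v = 0 then 0 else v + K₁ * z) hxK
    (fun p v => by split_ifs <;> simp) (fun p hp => by
      split_ifs
      · exact hP.pos
      · exact hbd _ _ (hx p) (hrank_le p hp.le))
  let y₁ : ℕ → ℕ := fun p => if x p = 0 then 0 else x p + K₁ * rank p
  have h₁ : Computes mem K _ x y₁ := h₁
  have hy₁ : ∀ p, y₁ p ≠ 0 → x p ≠ 0 ∧ y₁ p = x p + K₁ * rank p := by
    intro p hp
    have : x p ≠ 0 := fun h => hp (if_pos h)
    exact ⟨this, if_neg this⟩
  have hy₁' : ∀ p, y₁ p ≠ 0 → y₁ p / K₁ = rank p := by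
    intro p hp
    rw [(hy₁ p hp).2, Nat.add_mul_div_left _ _ hK₁, Nat.div_eq_of_lt (hx p), zero_add]
  have hinj : ∀ p < M * d, ∀ p' < M * d, y₁ p ≠ 0 → y₁ p' ≠ 0 →
      y₁ p / K₁ * w = y₁ p' / K₁ * w → p = p' := by
    intro p _ p' _ hp hp' h
    rw [hy₁' p hp, hy₁' p' hp'] at h
    have h := Nat.eq_of_mul_eq_mul_right hw h
    by_contra hne
    rcases lt_or_gt_of_ne hne with h' | h'
    · exact (hrank_lt _ _ h' (hy₁ p hp).1).ne h
    · exact (hrank_lt _ _ h' (hy₁ p' hp').1).ne' h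
  have hy₁K : ∀ p < M * d, y₁ p < K := by
    intro p hp
    by_cases h : y₁ p = 0
    · rw [h]; exact hP.pos
    · rw [(hy₁ p h).2]; exact hbd _ _ (hx p) (hrank_le p hp.le)
  have h₂ := route_computes hP (x := y₁) (dst := fun _ v => v / K₁ * w) (f := fun _ v => v)
    hy₁K hinj
  let y₂ : ℕ → ℕ := routeArray (M * d) (fun _ v => v / K₁ * w) (fun _ v _ => v) (fun _ => 0) y₁
  have h₂ : Computes mem K _ y₁ y₂ := h₂
  have hy₁φ : ∀ r : Fin m, y₁ (e.symm r) = x (e.symm r) + K₁ * r := by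
    intro r
    have : y₁ (e.symm r) = x (e.symm r) + K₁ * rank (e.symm r) := if_neg (hφZ r).2
    rw [this, hφr]
  have hy₂ : ∀ r : Fin m, y₂ (r * w) = x (e.symm r) + K₁ * r := by
    intro r
    have hne : y₁ (e.symm r) ≠ 0 := by
      rw [hy₁φ]; have := (hφZ r).2; omega
    have := routeArray_apply (dst := fun _ v => v / K₁ * w) (f := fun _ v _ => v)
      (c := fun _ => 0) hinj (hφZ r).1 hne
    rw [hy₁' _ hne, hφr] at this
    rw [← hy₁φ]
    exact this
  have hy₂' : ∀ q, y₂ q ≠ 0 → ∃ r : Fin m, q = r * w := by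
    intro q hq
    by_contra hno
    refine hq (routeArray_eq_zero fun p hp hp0 hd => hno ?_)
    refine ⟨e ⟨p, (hZ p).2 ⟨hp, (hy₁ p hp0).1⟩⟩, ?_⟩
    rw [← hd, hy₁' p hp0]
    rfl
  have hy₂K : ∀ q, y₂ q < K := by
    intro q
    by_cases hq : y₂ q = 0
    · rw [hq]; exact hP.pos
    · obtain ⟨r, rfl⟩ := hy₂' q hq
      rw [hy₂]
      exact hbd _ _ (hx _) r.2.le
  have h₃ := scanMax_computes hP (x := y₂) (g := fun _ v => v)
    (f := fun p v z => if p < w * m then max z v % K₁ else 0) hy₂K hy₂K (fun p hp => by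
      split_ifs
      · refine (Nat.mod_lt _ hK₁).trans_le (le_trans ?_ hK.le)
        exact Nat.le_mul_of_pos_right _ (Nat.succ_pos _)
      · exact hP.pos)
  refine ((h₁.append h₂).append h₃).congr_right fun p hp => ?_
  by_cases hpw : p < w * m
  · simp only [hpw, if_true, dif_pos]
    set r : Fin m := ⟨p / w, Nat.div_lt_of_lt_mul hpw⟩ with hr
    have hrp : r * w ≤ p := Nat.div_mul_le_self p w
    -- The rank is the upper digit, so the last nonempty cell up to `p` holds the prefix maximum
    -- whatever the contents are.
    have hle : ∀ q ≤ p, y₂ q ≤ y₂ (r * w) := by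
      intro q hq
      by_cases h0 : y₂ q = 0
      · rw [h0]; exact Nat.zero_le _
      · obtain ⟨r', rfl⟩ := hy₂' q h0
        have h1 : (r' : ℕ) ≤ r := (Nat.le_div_iff_mul_le hw).2 hq
        rcases h1.lt_or_eq with h2 | h2
        · rw [hy₂, hy₂]
          have h3 : K₁ * (r' + 1) ≤ K₁ * r := Nat.mul_le_mul_left _ h2
          have := hx (e.symm r')
          rw [mul_add, mul_one] at h3
          omega
        · rw [h2]
    have hmax : max ((Finset.range p).sup fun q => y₂ q) (y₂ p) = y₂ (r * w) := by
      apply le_antisymm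
      · exact max_le (Finset.sup_le fun q hq => hle q (Finset.mem_range.1 hq).le) (hle p le_rfl)
      · rcases hrp.lt_or_eq with h | h
        · exact le_max_of_le_left (Finset.le_sup (f := fun q => y₂ q) (Finset.mem_range.2 h))
        · rw [h]; exact le_max_right _ _
    rw [hmax, hy₂, Nat.add_mul_mod_self_left, Nat.mod_eq_of_lt (hx _)]
  · simp only [hpw, if_false, dif_neg, not_false_eq_true]

/-- The code of the `o`-th edge in a list of words that holds three words for each edge. -/
def edgeCell (β : ℕ) (l : List ℕ) (o : ℕ) : ℕ :=
  if 3 * o + 2 < l.length then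
    1 + (l.getD (3 * o) 0 + β * (l.getD (3 * o + 1) 0 + β * l.getD (3 * o + 2) 0)) else 0

/-- The code of an edge. -/
def edgeCode {n : ℕ} (β : ℕ) (w : Sym2 (Fin n) → ℕ) (e : Fin n × Fin n) : ℕ :=
  1 + (e.1 + β * (e.2 + β * w s(e.1, e.2)))

theorem edgeCell_flatMap {n : ℕ} (β : ℕ) (w : Sym2 (Fin n) → ℕ) (L : List (Fin n × Fin n)) (o : ℕ) :
    edgeCell β (L.flatMap fun e => [(e.1 : ℕ), (e.2 : ℕ), w s(e.1, e.2)]) o =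
      if h : o < L.length then edgeCode β w L[o] else 0 := by
  induction L generalizing o with
  | nil => simp [edgeCell]
  | cons a L ih =>
    cases o with
    | zero => simp [edgeCell, edgeCode]
    | succ o =>
      have := ih o
      have h3 : 3 * (o + 1) = 3 * o + 1 + 1 + 1 := by ring
      simp only [edgeCell, List.flatMap_cons, List.cons_append, List.nil_append, h3,
        List.getD_cons_succ, List.length_cons, List.getElem_cons_succ] at this ⊢
      rw [← edgeCell] at this
      simp only [Nat.add_lt_add_iff_right,
        show 3 * o + 1 + 1 + 1 + 2 = 3 * o + 2 + 1 + 1 + 1 by ring]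
      rw [← this]
      rfl

/-- The cells in which a machine stores the edges of its input. -/
def readInput (M d β : ℕ) (_ : Fin M) (l : List ℕ) (s : Fin (2 * d)) : ℕ :=
  if (s : ℕ) < d then edgeCell β l s else 0

/-- The array of the codes of all edges of a distribution. -/
def inputArray {n M : ℕ} (d β : ℕ) (w : Sym2 (Fin n) → ℕ) (D : Fin M → List (Fin n × Fin n))
    (p : ℕ) : ℕ :=
  if h : p / d < M then
    if h' : p % d < (D ⟨p / d, h⟩).length then edgeCode β w (D ⟨p / d, h⟩)[p % d] else 0
  else 0

theorem readInput_eq {n M d β : ℕ} (w : Sym2 (Fin n) → ℕ) (D : Fin M → List (Fin n × Fin n)) :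
    (fun i => readInput M d β i (edgeInput w D i)) = ofArray M d (inputArray d β w D) := by
  funext i s
  unfold readInput ofArray
  split_ifs with hs
  · have hd : 0 < d := by omega
    have h1 : ((i : ℕ) * d + s) / d = i := by
      rw [mul_comm, Nat.mul_add_div hd, Nat.div_eq_of_lt hs, add_zero]
    have h2 : ((i : ℕ) * d + s) % d = s := by
      rw [mul_comm, Nat.mul_add_mod, Nat.mod_eq_of_lt hs]
    rw [edgeInput, edgeCell_flatMap]
    simp only [inputArray, h1, h2, i.2, dif_pos]
  · rfl

theorem edgeCode_lt {n β : ℕ} {w : Sym2 (Fin n) → ℕ} {e : Fin n × Fin n} (hn : n ≤ β)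
    (hw : w s(e.1, e.2) < β) : edgeCode β w e < β ^ 3 + 1 := by
  have := Entry.add_mul_lt (e.1.2.trans_le hn) (Entry.add_mul_lt (e.2.2.trans_le hn) hw)
  rw [edgeCode, show β ^ 3 = β * (β * β) by ring]
  omega

theorem inputArray_lt {n M d β : ℕ} {G : SimpleGraph (Fin n)} {w : Sym2 (Fin n) → ℕ}
    {D : Fin M → List (Fin n × Fin n)} (hD : IsEdgeDistribution G D) (hn : n ≤ β)
    (hw : ∀ e ∈ G.edgeSet, w e < β) (p : ℕ) : inputArray d β w D p < β ^ 3 + 1 := by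
  unfold inputArray
  split_ifs with h h'
  · refine edgeCode_lt hn (hw _ ?_)
    exact (hD.2 _).1 (List.mem_map.2 ⟨_, List.mem_flatMap.2
      ⟨_, List.mem_finRange _, List.getElem_mem h'⟩, rfl⟩)
  · omega
  · omega

/-- The nonempty cells of the input array correspond to the edges of the graph. -/
theorem inputArray_spec {n M d β m : ℕ} {G : SimpleGraph (Fin n)} {w : Sym2 (Fin n) → ℕ}
    {D : Fin M → List (Fin n × Fin n)} (hD : IsEdgeDistribution G D) (hlen : ∀ i, (D i).length ≤ d)
    (hm : G.edgeSet.ncard = m) :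
    ((Finset.range (M * d)).filter fun p => inputArray d β w D p ≠ 0).card = m ∧
    ∀ φ : Fin m → ℕ, Function.Injective φ →
      (∀ r, φ r < M * d ∧ inputArray d β w D (φ r) ≠ 0) →
      ∃ ed : Fin m → Fin n × Fin n, (∀ r, inputArray d β w D (φ r) = edgeCode β w (ed r)) ∧
        (∀ r, G.Adj (ed r).1 (ed r).2) ∧
        (∀ r r', s((ed r).1, (ed r).2) = s((ed r').1, (ed r').2) → r = r') ∧
        ∀ u v, G.Adj u v → ∃ r, ed r = (u, v) ∨ ed r = (v, u) := by
  classical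
  let toSym : Fin n × Fin n → Sym2 (Fin n) := fun e => s(e.1, e.2)
  have hval : ∀ p, inputArray d β w D p ≠ 0 →
      ∃ (h : p / d < M) (h' : p % d < (D ⟨p / d, h⟩).length),
      inputArray d β w D p = edgeCode β w (D ⟨p / d, h⟩)[p % d] := by
    intro p hp
    unfold inputArray at hp ⊢
    split_ifs at hp ⊢ with h h'
    · exact ⟨h, h', rfl⟩
    · exact absurd rfl hp
    · exact absurd rfl hp
  have hnodup := hD.1
  rw [List.map_flatMap, List.nodup_flatMap] at hnodup
  have hmem : ∀ i, ∀ e ∈ D i, s(e.1, e.2) ∈ G.edgeSet := by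
    intro i e he
    refine (hD.2 _).1 (List.mem_map.2 ⟨e, List.mem_flatMap.2 ⟨i, List.mem_finRange i, he⟩, rfl⟩)
  have hinj : ∀ i o i' o' (h : o < (D i).length) (h' : o' < (D i').length),
      toSym (D i)[o] = toSym (D i')[o'] → i = i' ∧ o = o' := by
    intro i o i' o' h h' heq
    have hi : i = i' := by
      by_contra hne
      have : Std.Symm (Function.onFun List.Disjoint
          fun a => List.map (fun e => s(e.1, e.2)) (D a)) := ⟨fun _ _ h => List.Disjoint.symm h⟩
      have hd := hnodup.2.forall (List.mem_finRange i) (List.mem_finRange i') hne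
      exact hd (List.mem_map_of_mem (List.getElem_mem h))
        (by rw [show s((D i)[o].1, (D i)[o].2) = s((D i')[o'].1, (D i')[o'].2) from heq]
            exact List.mem_map_of_mem (List.getElem_mem h'))
    subst hi
    refine ⟨rfl, ?_⟩
    have hn := hnodup.1 i (List.mem_finRange i)
    have := (hn.getElem_inj_iff (i := o) (j := o') (hi := by simpa using h)
      (hj := by simpa using h')).1 (by simpa only [List.getElem_map] using heq)
    exact this
  have hcard : ((Finset.range (M * d)).filter fun p => inputArray d β w D p ≠ 0).card = m := by
    have h1 : ((Finset.range (M * d)).filter fun p => inputArray d β w D p ≠ 0).card =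
        ∑ i : Fin M, ∑ o : Fin d, if (o : ℕ) < (D i).length then 1 else 0 := by
      rw [Finset.card_filter, ← sum_blocks M d fun p => if inputArray d β w D p ≠ 0 then 1 else 0]
      refine Finset.sum_congr rfl fun i _ => Finset.sum_congr rfl fun o _ => ?_
      have hd : 0 < d := o.pos
      have h1 : ((i : ℕ) * d + o) / d = i := by
        rw [mul_comm, Nat.mul_add_div hd, Nat.div_eq_of_lt o.2, add_zero]
      have h2 : ((i : ℕ) * d + o) % d = o := by
        rw [mul_comm, Nat.mul_add_mod, Nat.mod_eq_of_lt o.2]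
      simp only [inputArray, h1, h2, i.2, dif_pos]
      congr 1
      by_cases h : (o : ℕ) < (D i).length
      · simp [h, edgeCode]
      · simp [h]
    have h2 : ∀ i, (∑ o : Fin d, if (o : ℕ) < (D i).length then 1 else 0) = (D i).length := by
      intro i
      rw [← Finset.sum_range fun o => if o < (D i).length then 1 else 0, ← Finset.card_filter]
      rw [show (Finset.range d).filter (fun o => o < (D i).length) = Finset.range (D i).length by
        ext o; have := hlen i; simp only [Finset.mem_filter, Finset.mem_range]; omega]
      simp
    have h3 : G.edgeSet = ↑(((List.finRange M).flatMap D).map fun e => s(e.1, e.2)).toFinset := by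
      ext e; rw [List.coe_toFinset]; exact (hD.2 e).symm
    rw [h1, ← hm, h3, Set.ncard_coe_finset, List.toFinset_card_of_nodup hD.1, List.length_map,
      List.length_flatMap, Fin.sum_univ_def]
    simp only [h2]
  refine ⟨hcard, fun φ hφ hφ' => ?_⟩
  choose h h' hv using fun r => hval (φ r) (hφ' r).2
  let ed : Fin m → Fin n × Fin n := fun r => (D ⟨φ r / d, h r⟩)[φ r % d]'(h' r)
  have hadj : ∀ r, G.Adj (ed r).1 (ed r).2 := fun r =>
    (SimpleGraph.mem_edgeSet _).1 (hmem _ _ (List.getElem_mem (h' r)))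
  have hsinj : ∀ r r', toSym (ed r) = toSym (ed r') → r = r' := by
    intro r r' heq
    obtain ⟨h1, h2⟩ := hinj _ _ _ _ _ _ heq
    have h1 : φ r / d = φ r' / d := congrArg Fin.val h1
    apply hφ
    rw [← Nat.div_add_mod (φ r) d, ← Nat.div_add_mod (φ r') d, h1, h2]
  refine ⟨ed, hv, hadj, hsinj, ?_⟩
  intro u v huv
  let T : Fin m → G.edgeSet := fun r => ⟨toSym (ed r), hadj r⟩
  -- An injection between two sets with `m` elements; surjectivity says that every edge was found.
  have hT : Function.Bijective T := by
    have : Fintype G.edgeSet := Fintype.ofFinite _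
    rw [Fintype.bijective_iff_injective_and_card]
    refine ⟨fun r r' hrr => hsinj r r' (congrArg Subtype.val hrr), ?_⟩
    rw [Fintype.card_fin, ← hm, ← Nat.card_eq_fintype_card, Nat.card_coe_set_eq]
  obtain ⟨r, hr⟩ := hT.2 ⟨s(u, v), huv⟩
  have hr : s((ed r).1, (ed r).2) = s(u, v) := congrArg Subtype.val hr
  refine ⟨r, ?_⟩
  rw [Sym2.eq_iff] at hr
  rcases hr with hr | hr
  · exact Or.inl (Prod.ext hr.1 hr.2)
  · exact Or.inr (Prod.ext hr.1 hr.2)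

end CellMachine

/-! ### The records of all copies of the graph, and the complete program. -/

namespace CellMachine

/-- The initial label of node `s`: the shift, determined by a random number, and the name of the
node. There are `ν` nodes. -/
def initLabel (ν Λ c s : ℕ) : ℕ := ν * (Nat.size c * Λ) + s

/-- The record that is created in cell `p`, given the code `v` of an edge and the coin `c`. There
are `T` copies of the graph, and node `j * n + u` stands for vertex `u` in copy `j`. -/
def createEntry (n m T β Λ : ℕ) (cst : ℕ → ℕ) (p v c : ℕ) : ℕ :=
  if p < 2 * T * m then
    if p % (2 * T) % 2 = 0 then
      Entry.code β ⟨p % (2 * T) / 2 * n + (v - 1) % β, p % (2 * T) / 2 * n + (v - 1) / β % β,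
        T * n * cst ((v - 1) / β / β), β - 1, 0⟩
    else
      Entry.code β ⟨p % (2 * T) / 2 * n + (v - 1) / β % β, p % (2 * T) / 2 * n + (v - 1) % β,
        T * n * cst ((v - 1) / β / β), β - 1, 0⟩
  else if p < 2 * T * m + T * n then
    Entry.code β ⟨p - 2 * T * m, p - 2 * T * m, 0, initLabel (T * n) Λ c (p - 2 * T * m), 0⟩
  else 0

/-- The records of all edges and vertices in all copies of the graph. -/
def createdEntry {n m : ℕ} (T β Λ : ℕ) (cst : ℕ → ℕ) (w : Sym2 (Fin n) → ℕ)
    (ed : Fin m → Fin n × Fin n) (z : ℕ → ℕ) (p : Fin (2 * T * m + T * n)) : Entry :=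
  if h : (p : ℕ) < 2 * T * m then
    let e := ed ⟨p / (2 * T), Nat.div_lt_of_lt_mul h⟩
    if (p : ℕ) % (2 * T) % 2 = 0 then
      ⟨p % (2 * T) / 2 * n + e.1, p % (2 * T) / 2 * n + e.2, T * n * cst (w s(e.1, e.2)), β - 1, 0⟩
    else
      ⟨p % (2 * T) / 2 * n + e.2, p % (2 * T) / 2 * n + e.1, T * n * cst (w s(e.1, e.2)), β - 1, 0⟩
  else ⟨p - 2 * T * m, p - 2 * T * m, 0, initLabel (T * n) Λ (z p) (p - 2 * T * m), 0⟩

/-- `createEntry` acts on the numbers a machine sees, `createdEntry` on the edges they stand for.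
The label `β - 1` of an edge record serves as infinity. -/
theorem createEntry_eq {n m T β Λ : ℕ} {cst : ℕ → ℕ} {w : Sym2 (Fin n) → ℕ}
    {ed : Fin m → Fin n × Fin n} (hn : n ≤ β) (z : ℕ → ℕ) (p : ℕ) :
    createEntry n m T β Λ cst p
      (if h : p < 2 * T * m then edgeCode β w (ed ⟨p / (2 * T), Nat.div_lt_of_lt_mul h⟩) else 0)
      (z p) = entryArray β (createdEntry T β Λ cst w ed z) p := by
  by_cases hp : p < 2 * T * m
  · set e := ed ⟨p / (2 * T), Nat.div_lt_of_lt_mul hp⟩ with he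
    have hβ : 0 < β := (Nat.zero_le _).trans_lt (e.1.2.trans_le hn)
    have h1 : (e.1 : ℕ) < β := e.1.2.trans_le hn
    have h2 : (e.2 : ℕ) < β := e.2.2.trans_le hn
    have hu : (edgeCode β w e - 1) % β = e.1 := by
      rw [edgeCode, Nat.add_sub_cancel_left, Nat.add_mul_mod_self_left, Nat.mod_eq_of_lt h1]
    have hd : (edgeCode β w e - 1) / β = e.2 + β * w s(e.1, e.2) := by
      rw [edgeCode, Nat.add_sub_cancel_left, Nat.add_mul_div_left _ _ hβ, Nat.div_eq_of_lt h1,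
        zero_add]
    have hv : (edgeCode β w e - 1) / β % β = e.2 := by
      rw [hd, Nat.add_mul_mod_self_left, Nat.mod_eq_of_lt h2]
    have hw : (edgeCode β w e - 1) / β / β = w s(e.1, e.2) := by
      rw [hd, Nat.add_mul_div_left _ _ hβ, Nat.div_eq_of_lt h2, zero_add]
    have hpN : p < 2 * T * m + T * n := by omega
    simp only [createEntry, hp, if_true, dif_pos, ← he, hu, hv, hw, entryArray, pad, hpN,
      createdEntry]
    split_ifs <;> rfl
  · simp only [createEntry, hp, if_false, entryArray, pad, createdEntry, dif_neg,
      not_false_eq_true]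
    split_ifs <;> rfl

/-- The properties of the records that are used by the algorithm. -/
structure EntryFacts {n N : ℕ} (T β Λ : ℕ) (cst : ℕ → ℕ) (G : SimpleGraph (Fin n))
    (w : Sym2 (Fin n) → ℕ) (ζ : ℕ → ℕ) (E : Fin N → Entry) : Prop where
  edge_or_self : ∀ p, (∃ j < T, ∃ u v, G.Adj u v ∧
      E p = ⟨j * n + u, j * n + v, T * n * cst (w s(u, v)), β - 1, 0⟩) ∨
    ∃ s < T * n, E p = ⟨s, s, 0, initLabel (T * n) Λ (ζ s) s, 0⟩
  exists_edge : ∀ j < T, ∀ u v, G.Adj u v → ∃ p,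
    E p = ⟨j * n + u, j * n + v, T * n * cst (w s(u, v)), β - 1, 0⟩
  exists_self : ∀ s < T * n, ∃ p, E p = ⟨s, s, 0, initLabel (T * n) Λ (ζ s) s, 0⟩
  inj : ∀ p q, (E p).src = (E q).src → (E p).tgt = (E q).tgt → p = q

/-- A position below `2 * T * m` is `r * (2 * T) + (2 * j + b)` for edge `r`, copy `j` and
orientation `b`. Source and target determine the copy and the edge, and they determine `b` because a
simple graph has no loops; for the same reason edge records differ from self-records. -/
theorem createdEntry_facts {n m T β Λ : ℕ} {cst : ℕ → ℕ} {G : SimpleGraph (Fin n)}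
    {w : Sym2 (Fin n) → ℕ} {ed : Fin m → Fin n × Fin n} (hadj : ∀ r, G.Adj (ed r).1 (ed r).2)
    (hinj : ∀ r r', s((ed r).1, (ed r).2) = s((ed r').1, (ed r').2) → r = r')
    (hsurj : ∀ u v, G.Adj u v → ∃ r, ed r = (u, v) ∨ ed r = (v, u)) (z : ℕ → ℕ) :
    EntryFacts T β Λ cst G w (fun s => z (2 * T * m + s)) (createdEntry T β Λ cst w ed z) := by
  have hedge : ∀ p : Fin (2 * T * m + T * n), (p : ℕ) < 2 * T * m → ∃ (r : Fin m) (j b : ℕ),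
      j < T ∧ b < 2 ∧ (p : ℕ) = r * (2 * T) + (2 * j + b) ∧
      createdEntry T β Λ cst w ed z p = if b = 0 then
        ⟨j * n + (ed r).1, j * n + (ed r).2, T * n * cst (w s((ed r).1, (ed r).2)), β - 1, 0⟩ else
        ⟨j * n + (ed r).2, j * n + (ed r).1, T * n * cst (w s((ed r).1, (ed r).2)), β - 1, 0⟩ := by
    intro p hp
    have hT : 0 < 2 * T := Nat.pos_of_ne_zero fun h => by
      have : 2 * T * m = 0 := by rw [h, zero_mul]
      omega
    refine ⟨⟨p / (2 * T), Nat.div_lt_of_lt_mul hp⟩, p % (2 * T) / 2, p % (2 * T) % 2, ?_,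
      Nat.mod_lt _ two_pos, ?_, ?_⟩
    · have := Nat.mod_lt (p : ℕ) hT
      omega
    · have h1 := Nat.div_add_mod (p : ℕ) (2 * T)
      rw [mul_comm] at h1
      simp only
      omega
    · simp only [createdEntry, hp, dif_pos]
  have hself : ∀ p : Fin (2 * T * m + T * n), ¬ (p : ℕ) < 2 * T * m → ∃ s < T * n,
      (p : ℕ) = 2 * T * m + s ∧ createdEntry T β Λ cst w ed z p =
        ⟨s, s, 0, initLabel (T * n) Λ (z (2 * T * m + s)) s, 0⟩ := by
    intro p hp
    have hp2 := p.2
    have h1 : 2 * T * m + (p - 2 * T * m) = p := by omega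
    refine ⟨p - 2 * T * m, by omega, by omega, ?_⟩
    simp only [createdEntry, hp, dif_neg, not_false_eq_true, h1]
  have hmk : ∀ (r : Fin m) (j b : ℕ), j < T → b < 2 → ∃ p : Fin (2 * T * m + T * n),
      createdEntry T β Λ cst w ed z p = if b = 0 then
        ⟨j * n + (ed r).1, j * n + (ed r).2, T * n * cst (w s((ed r).1, (ed r).2)), β - 1, 0⟩ else
        ⟨j * n + (ed r).2, j * n + (ed r).1, T * n * cst (w s((ed r).1, (ed r).2)), β - 1, 0⟩ := by
    intro r j b hj hb
    have hlt : r * (2 * T) + (2 * j + b) < 2 * T * m := by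
      rw [add_comm, mul_comm (r : ℕ)]
      exact Entry.add_mul_lt (by omega) r.2
    refine ⟨⟨r * (2 * T) + (2 * j + b), by omega⟩, ?_⟩
    obtain ⟨r', j', b', hj', hb', hp, hE⟩ := hedge ⟨r * (2 * T) + (2 * j + b), by omega⟩ hlt
    obtain ⟨h1, h2⟩ := address_inj (by omega) (by omega) hp
    obtain rfl : r = r' := Fin.ext h1
    obtain rfl : j = j' := by omega
    obtain rfl : b = b' := by omega
    exact hE
  refine ⟨?_, ?_, ?_, ?_⟩
  · intro p
    by_cases hp : (p : ℕ) < 2 * T * m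
    · obtain ⟨r, j, b, hj, hb, -, hE⟩ := hedge p hp
      left
      by_cases h : b = 0
      · rw [if_pos h] at hE
        exact ⟨j, hj, _, _, hadj r, hE⟩
      · rw [if_neg h, Sym2.eq_swap] at hE
        exact ⟨j, hj, _, _, (hadj r).symm, hE⟩
    · obtain ⟨s, hs, -, hE⟩ := hself p hp
      exact Or.inr ⟨s, hs, hE⟩
  · intro j hj u v huv
    obtain ⟨r, hr | hr⟩ := hsurj u v huv
    · obtain ⟨p, hp⟩ := hmk r j 0 hj (by omega)
      rw [if_pos rfl, hr] at hp
      exact ⟨p, hp⟩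
    · obtain ⟨p, hp⟩ := hmk r j 1 hj (by omega)
      rw [if_neg one_ne_zero, hr, Sym2.eq_swap] at hp
      exact ⟨p, hp⟩
  · intro s hs
    obtain ⟨s', hs', hp, hE⟩ := hself ⟨2 * T * m + s, by omega⟩ (by simp)
    obtain rfl : s = s' := by simpa using hp
    exact ⟨_, hE⟩
  · intro p q hs ht
    by_cases hp : (p : ℕ) < 2 * T * m <;> by_cases hq : (q : ℕ) < 2 * T * m
    · obtain ⟨r, j, b, hj, hb, hpe, hE⟩ := hedge p hp
      obtain ⟨r', j', b', hj', hb', hqe, hE'⟩ := hedge q hq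
      rw [hE, hE'] at hs ht
      have h1 := (hadj r).ne
      have h2 := (hadj r').ne
      have key : r = r' ∧ j = j' ∧ b = b' := by
        by_cases h : b = 0 <;> by_cases h' : b' = 0
        · simp only [h, h', if_true] at hs ht
          have e1 := address_inj (Fin.is_lt _) (Fin.is_lt _) hs
          have e2 := address_inj (Fin.is_lt _) (Fin.is_lt _) ht
          refine ⟨hinj r r' ?_, e1.1, by omega⟩
          rw [Fin.ext e1.2, Fin.ext e2.2]
        · simp only [h, h', if_true, if_false] at hs ht
          have e1 := address_inj (Fin.is_lt _) (Fin.is_lt _) hs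
          have e2 := address_inj (Fin.is_lt _) (Fin.is_lt _) ht
          have hr : r = r' := hinj r r' (by rw [Fin.ext e1.2, Fin.ext e2.2, Sym2.eq_swap])
          subst hr
          exact absurd (Fin.ext e1.2) h1
        · simp only [h, h', if_true, if_false] at hs ht
          have e1 := address_inj (Fin.is_lt _) (Fin.is_lt _) hs
          have e2 := address_inj (Fin.is_lt _) (Fin.is_lt _) ht
          have hr : r = r' := hinj r r' (by rw [Fin.ext e1.2, Fin.ext e2.2, Sym2.eq_swap])
          subst hr
          exact absurd (Fin.ext e1.2).symm h1
        · simp only [h, h', if_false] at hs ht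
          have e1 := address_inj (Fin.is_lt _) (Fin.is_lt _) hs
          have e2 := address_inj (Fin.is_lt _) (Fin.is_lt _) ht
          refine ⟨hinj r r' ?_, e1.1, by omega⟩
          rw [Fin.ext e1.2, Fin.ext e2.2]
      obtain ⟨rfl, rfl, rfl⟩ := key
      exact Fin.ext (hpe.trans hqe.symm)
    · obtain ⟨r, j, b, hj, hb, hpe, hE⟩ := hedge p hp
      obtain ⟨s', -, hqe, hE'⟩ := hself q hq
      rw [hE, hE'] at hs ht
      have h1 : ((ed r).1 : ℕ) ≠ (ed r).2 := fun h => (hadj r).ne (Fin.ext h)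
      split_ifs at hs ht <;> (simp only at hs ht; omega)
    · obtain ⟨r, j, b, hj, hb, hpe, hE⟩ := hedge q hq
      obtain ⟨s', -, hqe, hE'⟩ := hself p hp
      rw [hE, hE'] at hs ht
      have h1 : ((ed r).1 : ℕ) ≠ (ed r).2 := fun h => (hadj r).ne (Fin.ext h)
      split_ifs at hs ht <;> (simp only at hs ht; omega)
    · obtain ⟨s, -, hpe, hE⟩ := hself p hp
      obtain ⟨s', -, hqe, hE'⟩ := hself q hq
      rw [hE, hE'] at hs
      simp only at hs
      subst hs
      exact Fin.ext (hpe.trans hqe.symm)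

/-- All rounds between input and output. -/
def coverRounds (M d H n m T β Λ B I : ℕ) (cst : ℕ → ℕ) : List (Round M (2 * d)) :=
  spreadRounds M d H m (2 * T) (β ^ 3 + 1) ++
    ([routeRound M d (fun p _ => p) (createEntry n m T β Λ cst)] ++
      (linkRounds M d H (2 * T * m + T * n) β B (T * n) ++
        bellmanFordRounds M d H (2 * T * m + T * n) β I))

theorem length_coverRounds (M d H n m T β Λ B I : ℕ) (cst : ℕ → ℕ) :
    (coverRounds M d H n m T β Λ B I cst).length =
      2 * H + 5 + (1 + (2 * (B * (H + 3)) + 2 + ((2 * H + 7) * I + (2 * H + 6)))) := by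
  simp only [coverRounds, List.length_append, length_spreadRounds, List.length_singleton,
    length_linkRounds, length_bellmanFordRounds]

/-- The labels of the Bellman–Ford algorithm: `L i s` is the label of node `s` after `i`
iterations. -/
structure IsLabeling {n : ℕ} (T Λ : ℕ) (cst : ℕ → ℕ) (G : SimpleGraph (Fin n))
    (w : Sym2 (Fin n) → ℕ) (ζ : ℕ → ℕ) (L : ℕ → ℕ → ℕ) : Prop where
  zero : ∀ s < T * n, L 0 s = initLabel (T * n) Λ (ζ s) s
  succ : ∀ i, ∀ j < T, ∀ u : Fin n, IsLeast {x | x = L i (j * n + u) ∨ ∃ v, G.Adj u v ∧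
    x = L i (j * n + v) + T * n * cst (w s(u, v))} (L (i + 1) (j * n + u))

section

variable {M d H mem K n m T β Λ B I : ℕ} {cst : ℕ → ℕ}

/-- The bounds that the numbers occurring in the algorithm have to satisfy. -/
structure Bounds (N K n T β Λ B A : ℕ) (cst : ℕ → ℕ) (G : SimpleGraph (Fin n))
    (w : Sym2 (Fin n) → ℕ) (ζ : ℕ → ℕ) : Prop where
  payload : (β ^ 5 + 1) * (N + 1) < K
  size_le : N ≤ β
  key_le : T * n * (T * n) ≤ 2 ^ B
  init_le : ∀ s < T * n, initLabel (T * n) Λ (ζ s) s ≤ A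
  lab_lt : A < β
  cost_lt : ∀ u v, G.Adj u v → A + T * n * cst (w s(u, v)) < β

theorem node_lt {n T j : ℕ} (hj : j < T) (u : Fin n) : j * n + u < T * n := by
  rw [add_comm, mul_comm j, mul_comm T]
  exact Entry.add_mul_lt u.2 hj

/-- All records with the same source carry the same label after each iteration, so labels of records
become labels `L` of nodes. The self-record offers a node its own old label, and each edge record
offers the relaxed label of a neighbour. -/
theorem link_bellmanFord {N A : ℕ} (hP : Params M d H mem K) (hN : N ≤ M * d)
    {G : SimpleGraph (Fin n)} {w : Sym2 (Fin n) → ℕ} {ζ : ℕ → ℕ}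
    (hb : Bounds N K n T β Λ B A cst G w ζ) {E : Fin N → Entry}
    (hE : EntryFacts T β Λ cst G w ζ E) (hTN : T * n ≤ N) (hν : 0 < T * n) :
    ∃ (R : LinkedEntries N) (L : ℕ → ℕ → ℕ) (l : ℕ → Fin N → ℕ),
      (∀ I, Computes mem K (linkRounds M d H N β B (T * n) ++ bellmanFordRounds M d H N β I)
        (entryArray β E) (entryArray β (R.entry (l I)))) ∧
      (∀ I p, (R.entry (l I) p).Bounded β) ∧
      IsLabeling T Λ cst G w ζ L ∧ (∀ I p, l I p = L I (R.s p)) ∧ (∀ p, R.s p < T * n) ∧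
      ∀ s < T * n, ∃ p, R.s p = s ∧ R.t p = s := by
  have hTβ : T * n ≤ β := hTN.trans hb.size_le
  have hsrc : ∀ p, (E p).src < T * n := by
    intro p
    obtain ⟨j, hj, u, v, huv, h⟩ | ⟨s, hs, h⟩ := hE.edge_or_self p
    · rw [h]; exact node_lt hj u
    · rw [h]; exact hs
  have htgt : ∀ p, (E p).tgt < T * n := by
    intro p
    obtain ⟨j, hj, u, v, huv, h⟩ | ⟨s, hs, h⟩ := hE.edge_or_self p
    · rw [h]; exact node_lt hj v
    · rw [h]; exact hs
  have hEb : ∀ p, (E p).Bounded β := by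
    intro p
    have hβ : 0 < β := (Nat.zero_le _).trans_lt hb.lab_lt
    obtain ⟨j, hj, u, v, huv, h⟩ | ⟨s, hs, h⟩ := hE.edge_or_self p
    · refine ⟨(hsrc p).trans_le hTβ, (htgt p).trans_le hTβ, ?_, ?_, ?_⟩ <;> rw [h]
      · have := hb.cost_lt u v huv
        simp only
        omega
      · simp only; omega
      · exact hβ
    · refine ⟨(hsrc p).trans_le hTβ, (htgt p).trans_le hTβ, ?_, ?_, ?_⟩ <;> rw [h]
      · exact hβ
      · exact (hb.init_le s hs).trans_lt hb.lab_lt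
      · exact hβ
  have hsymm : ∀ p, ∃ q, (E q).src = (E p).tgt ∧ (E q).tgt = (E p).src ∧
      (E q).cost = (E p).cost := by
    intro p
    obtain ⟨j, hj, u, v, huv, h⟩ | ⟨s, hs, h⟩ := hE.edge_or_self p
    · obtain ⟨q, hq⟩ := hE.exists_edge j hj v u huv.symm
      exact ⟨q, by rw [hq, h], by rw [hq, h], by rw [hq, h, Sym2.eq_swap]⟩
    · exact ⟨p, by rw [h], by rw [h], rfl⟩
  obtain ⟨R, σ, hR, hlink⟩ := linkRounds_computes hP hN hb.payload hb.size_le hb.key_le hEb hsrc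
    htgt hE.inj hsymm
  have hRself : ∀ s < T * n, ∃ q, R.s q = s ∧ R.t q = s ∧ R.τ q = q ∧ R.c q = 0 ∧
      (E (σ (R.τ q))).lab = initLabel (T * n) Λ (ζ s) s := by
    intro s hs
    obtain ⟨p, hp⟩ := hE.exists_self s hs
    have h1 : R.s (σ.symm p) = s := by rw [(hR _).1]; simp [hp]
    have h2 : R.t (σ.symm p) = s := by rw [(hR _).2.1]; simp [hp]
    have h3 : R.τ (σ.symm p) = σ.symm p := by
      apply σ.injective
      apply hE.inj
      · rw [← (hR _).1, R.s_link, ← (hR _).1, h1, h2]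
      · rw [← (hR _).2.1, R.t_link, ← (hR _).2.1, h1, h2]
    exact ⟨σ.symm p, h1, h2, h3, by rw [(hR _).2.2]; simp [hp], by rw [h3]; simp [hp]⟩
  have hRs : ∀ p, R.s p < T * n := fun p => by rw [(hR p).1]; exact hsrc _
  have hRb : ∀ p, (R.entry (fun p => (E (σ (R.τ p))).lab) p).Bounded β := by
    intro p
    refine ⟨?_, ?_, ?_, (hEb _).lab, (R.τ p).2.trans_le hb.size_le⟩
    · exact (hRs p).trans_le hTβ
    · change R.t p < β
      rw [(hR p).2.1]; exact (hEb _).tgt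
    · change R.c p < β
      rw [(hR p).2.2]; exact (hEb _).cost
  have hA : ∀ p, A + R.c p < β := by
    intro p
    rw [(hR p).2.2]
    obtain ⟨j, hj, u, v, huv, h⟩ | ⟨s, hs, h⟩ := hE.edge_or_self (σ p)
    · rw [h]; exact hb.cost_lt u v huv
    · rw [h]; exact hb.lab_lt
  obtain ⟨l, hl, hl0, hls⟩ := R.bellmanFord_computes hP hN hb.payload hRb hA (fun p => by
    obtain ⟨q, h1, -, h3, h4, h5⟩ := hRself _ (hRs p)
    exact ⟨q, h1, h3, h4, by rw [h5]; exact hb.init_le _ (hRs p)⟩)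
  have hleq : ∀ i p q, R.s p = R.s q → l i p = l i q := by
    intro i p q hpq
    cases i with
    | zero => have h := hl0 q; rw [← hpq] at h; exact (hl0 p).unique h
    | succ i => have h := hls i q; rw [← hpq] at h; exact (hls i p).unique h
  have : Nonempty (Fin N) := ⟨⟨0, by omega⟩⟩
  choose! pos hpos using hRself
  have hlL : ∀ i p, l i p = l i (pos (R.s p)) := fun i p =>
    hleq i _ _ (hpos _ (hRs p)).1.symm
  have hlA : ∀ i p, l i p ≤ A := by
    intro i
    induction i with
    | zero =>
      intro p
      have := hpos _ (hRs p)
      refine ((hl0 p).2 ⟨pos (R.s p), this.1, rfl⟩).trans ?_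
      rw [this.2.2.2.2]
      exact hb.init_le _ (hRs p)
    | succ i ih =>
      intro p
      have := hpos _ (hRs p)
      refine ((hls i p).2 ⟨pos (R.s p), this.1, rfl⟩).trans ?_
      rw [this.2.2.1, this.2.2.2.1]
      exact ih _
  refine ⟨R, fun i s => l i (pos s), l, fun I => hlink.append (hl I), ?_, ⟨?_, ?_⟩, hlL, hRs, ?_⟩
  · intro I p
    exact ⟨(hRb p).src, (hRb p).tgt, (hRb p).cost, (hlA I p).trans_lt hb.lab_lt, (hRb p).ptr⟩
  · intro s hs
    obtain ⟨h1, h2, h3, h4, h5⟩ := hpos s hs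
    apply le_antisymm
    · exact (hl0 (pos s)).2 ⟨pos s, rfl, h5.symm⟩
    · obtain ⟨q, hq, hq'⟩ := (hl0 (pos s)).1
      rw [hq']
      obtain ⟨j, hj, u, v, huv, h⟩ | ⟨s', hs', h⟩ := hE.edge_or_self (σ (R.τ q))
      -- An edge record carries `β - 1`, which is at least `A` and hence at least every initial
      -- label.
      · rw [h]
        have := hb.init_le s hs
        have := hb.lab_lt
        simp only
        omega
      · have : s' = s := by
          have h6 : R.t (R.τ q) = s' := by rw [(hR _).2.1, h]
          rw [R.t_link] at h6
          rw [← h6, hq, h1]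
        rw [h, this]
  · intro i j hj u
    have hu := node_lt hj u
    obtain ⟨h1, h2, h3, h4, h5⟩ := hpos _ hu
    refine ⟨?_, ?_⟩
    · obtain ⟨q, hq, hq'⟩ := (hls i (pos (j * n + u))).1
      rw [h1] at hq
      simp only [Set.mem_ofPred_eq]
      rw [hq', (hR q).2.2, hlL, R.s_link, (hR q).2.1]
      rw [(hR q).1] at hq
      obtain ⟨j', hj', u', v', huv, h⟩ | ⟨s', hs', h⟩ := hE.edge_or_self (σ q)
      · rw [h] at hq ⊢
        obtain ⟨e1, e2⟩ := address_inj u'.2 u.2 hq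
        obtain rfl : j' = j := e1
        obtain rfl : u' = u := Fin.ext e2
        exact Or.inr ⟨v', huv, rfl⟩
      · rw [h] at hq ⊢
        simp only at hq
        subst hq
        exact Or.inl rfl
    · rintro x (rfl | ⟨v, huv, rfl⟩)
      · refine (hls i (pos (j * n + u))).2 ⟨pos (j * n + u), rfl, ?_⟩
        rw [h3, h4, add_zero]
      · obtain ⟨p, hp⟩ := hE.exists_edge j hj u v huv
        refine (hls i (pos (j * n + u))).2 ⟨σ.symm p, ?_, ?_⟩
        · rw [h1, (hR _).1]; simp [hp]
        · rw [hlL i (R.τ _), R.s_link, (hR _).2.1, (hR _).2.2]; simp [hp]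
  · intro s hs
    exact ⟨pos s, (hpos s hs).1, (hpos s hs).2.1⟩

/-- The coin in cell `p`. -/
def cellCoin (d : ℕ) (c : Fin M → ℕ → ℕ) (p : ℕ) : ℕ :=
  if h : p / d < M then c ⟨p / d, h⟩ (p % d) else 0

/-- Execution of the whole algorithm between input and output. -/
theorem coverRounds_exec {A : ℕ} (hP : Params M d H mem K) (hN : 2 * T * m + T * n ≤ M * d)
    (hT : 0 < T) (hn : 0 < n)
    {G : SimpleGraph (Fin n)} {w : Sym2 (Fin n) → ℕ} {D : Fin M → List (Fin n × Fin n)}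
    (hD : IsEdgeDistribution G D) (hlen : ∀ i, (D i).length ≤ d) (hm : G.edgeSet.ncard = m)
    (hw : ∀ e ∈ G.edgeSet, w e < β) {c : ℕ → Fin M → ℕ → ℕ}
    (hb : Bounds (2 * T * m + T * n) K n T β Λ B A cst G w
      fun s => cellCoin d (c (2 * H + 5)) (2 * T * m + s)) :
    ∃ (R : LinkedEntries (2 * T * m + T * n)) (L : ℕ → ℕ → ℕ) (l : Fin (2 * T * m + T * n) → ℕ),
      Exec mem K (coverRounds M d H n m T β Λ B I cst) c
        (fun i => readInput M d β i (edgeInput w D i)) (ofArray M d (entryArray β (R.entry l))) ∧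
      (∀ p, (R.entry l p).Bounded β) ∧
      IsLabeling T Λ cst G w (fun s => cellCoin d (c (2 * H + 5)) (2 * T * m + s)) L ∧
      (∀ p, l p = L I (R.s p)) ∧ (∀ p, R.s p < T * n) ∧
      ∀ s < T * n, ∃ p, R.s p = s ∧ R.t p = s := by
  obtain ⟨hcard, hφ⟩ := inputArray_spec (β := β) (w := w) hD hlen hm
  have hnT : n ≤ T * n := Nat.le_mul_of_pos_left n hT
  have hnβ : n ≤ β := by have := hb.size_le; omega
  have hK₁ : (β ^ 3 + 1) * (m + 1) < K := by
    refine lt_of_le_of_lt (Nat.mul_le_mul ?_ ?_) hb.payload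
    · rcases Nat.eq_zero_or_pos β with h | h
      · simp [h]
      · exact Nat.add_le_add_right (Nat.pow_le_pow_right h (by norm_num)) _
    · have : m ≤ 2 * T * m := Nat.le_mul_of_pos_left m (by omega)
      omega
  have hin : ∀ p, inputArray d β w D p < β ^ 3 + 1 := inputArray_lt hD hnβ hw
  obtain ⟨φ, hφi, hφn, -, hspread⟩ := spreadRounds_computes hP (w := 2 * T) (by omega) hK₁ hin hcard
  obtain ⟨ed, hed, hadj, hinj, hsurj⟩ := hφ φ hφi hφn
  simp only [hed] at hspread
  set z := cellCoin d (c (2 * H + 5)) with hz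
  have hfacts := createdEntry_facts (T := T) (β := β) (Λ := Λ) (cst := cst) (w := w) hadj hinj
    hsurj z
  obtain ⟨R, L, l, hl, hlb, hL, hlL, hRs, hself⟩ := link_bellmanFord hP hN hb hfacts (by omega)
    (Nat.mul_pos hT hn)
  refine ⟨R, L, l I, ?_, hlb I, hL, hlL I, hRs, hself⟩
  rw [readInput_eq]
  refine (hspread c).append (Exec.append ?_ (hl I _))
  -- The round that creates the records follows `2 * H + 5` rounds of spreading, which fixes the
  -- index of the coins used for the shifts.
  rw [length_spreadRounds]
  have hEb : ∀ p, ((createdEntry T β Λ cst w ed z) p).code β < K := by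
    intro p
    apply code_lt_of_bounded hb.payload
    have hβ : 0 < β := (Nat.zero_le _).trans_lt hb.lab_lt
    have hTβ : T * n ≤ β := by have := hb.size_le; omega
    obtain ⟨j, hj, u, v, huv, h⟩ | ⟨s, hs, h⟩ := hfacts.edge_or_self p
    · rw [h]
      have := hb.cost_lt u v huv
      exact ⟨(node_lt hj u).trans_le hTβ, (node_lt hj v).trans_le hTβ, by simp only; omega,
        by simp only; omega, hβ⟩
    · rw [h]
      exact ⟨hs.trans_le hTβ, hs.trans_le hTβ, hβ, (hb.init_le s hs).trans_lt hb.lab_lt, hβ⟩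
  have h := routeRound_spec (M := M) (d := d) (mem := mem) (K := K) (dst := fun p _ => p)
    (f := createEntry n m T β Λ cst) (c := c (0 + (2 * H + 5))) (c' := z)
    (x := fun p => if h : p < 2 * T * m then
      edgeCode β w (ed ⟨p / (2 * T), Nat.div_lt_of_lt_mul h⟩) else 0)
    (by have := hP.mem_le; omega) hP.pos (fun p _ => by
      rw [createEntry_eq hnβ z p]; exact pad_lt hP.pos hEb p) (fun i o => by
      have hd : 0 < d := o.pos
      have h1 : ((i : ℕ) * d + o) / d = i := by
        rw [mul_comm, Nat.mul_add_div hd, Nat.div_eq_of_lt o.2, add_zero]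
      have h2 : ((i : ℕ) * d + o) % d = o := by
        rw [mul_comm, Nat.mul_add_mod, Nat.mod_eq_of_lt o.2]
      simp only [hz, cellCoin, h1, h2, i.2, dif_pos, zero_add]) (fun p _ p' _ _ _ h => h)
  refine ⟨h.1, h.2.trans (ofArray_congr fun q hq => ?_)⟩
  rw [routeArray, Finset.sum_eq_single q]
  · rw [if_pos rfl, createEntry_eq hnβ z q]
  · intro p _ hp; exact if_neg hp
  · intro hq'; exact absurd (Finset.mem_range.2 hq) hq'

end

end CellMachine

/-! ### Labels and clusters -/

namespace CoverLabel

variable {n : ℕ} {G : SimpleGraph (Fin n)}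

theorem walkWeight_append {w : Sym2 (Fin n) → ℕ} {u v x : Fin n} (p : G.Walk u v)
    (q : G.Walk v x) : walkWeight w (p.append q) = walkWeight w p + walkWeight w q := by
  simp [walkWeight]

theorem walkWeight_reverse {w : Sym2 (Fin n) → ℕ} {u v : Fin n} (p : G.Walk u v) :
    walkWeight w p.reverse = walkWeight w p := by
  simp [walkWeight, List.sum_reverse]

theorem walkWeight_cons {w : Sym2 (Fin n) → ℕ} {u v x : Fin n} (h : G.Adj u v) (p : G.Walk v x) :
    walkWeight w (SimpleGraph.Walk.cons h p) = w s(u, v) + walkWeight w p := by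
  simp [walkWeight]

/-- The edges of a path are distinct, so those of the bypass form a submultiset of the edges of the
walk. -/
theorem walkWeight_bypass_le {w : Sym2 (Fin n) → ℕ} {u v : Fin n} (p : G.Walk u v) :
    walkWeight w p.bypass ≤ walkWeight w p := by
  have h : p.bypass.edges.Subperm p.edges :=
    p.bypass_isPath.isTrail.edges_nodup.subperm p.edges_bypass_subset_edges
  obtain ⟨l, hl, hs⟩ := h
  rw [walkWeight, walkWeight, ← (hl.map w).sum_eq]
  exact (hs.map w).sum_le_sum fun _ _ => Nat.zero_le _

/-- The successive labels of the Bellman–Ford algorithm, where `κ` is the cost of an edge and `init`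
are the initial labels. -/
structure IsBellmanFord (G : SimpleGraph (Fin n)) (κ : Sym2 (Fin n) → ℕ) (init : Fin n → ℕ)
    (L : ℕ → Fin n → ℕ) : Prop where
  zero : ∀ u, L 0 u = init u
  succ : ∀ i u, IsLeast {x | x = L i u ∨ ∃ v, G.Adj u v ∧ x = L i v + κ s(u, v)} (L (i + 1) u)

namespace IsBellmanFord

variable {κ : Sym2 (Fin n) → ℕ} {init : Fin n → ℕ} {L : ℕ → Fin n → ℕ}
  (h : IsBellmanFord G κ init L)
include h

theorem succ_le (i : ℕ) (u : Fin n) : L (i + 1) u ≤ L i u := (h.succ i u).2 (Or.inl rfl)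

theorem le_init (i : ℕ) (u : Fin n) : L i u ≤ init u := by
  induction i with
  | zero => exact (h.zero u).le
  | succ i ih => exact (h.succ_le i u).trans ih

/-- A label that drops in iteration `i + 1` does so because a neighbour's label dropped in iteration
`i`; unrolling this chain gives `i + 1` edges of cost at least `k`. -/
theorem le_of_lt {k : ℕ} (hk : ∀ e ∈ G.edgeSet, k ≤ κ e) (i : ℕ) (u : Fin n)
    (hlt : L (i + 1) u < L i u) : (i + 1) * k ≤ L (i + 1) u := by
  induction i generalizing u with
  | zero =>
    obtain h1 | ⟨v, huv, h1⟩ := (h.succ 0 u).1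
    · omega
    · have := hk s(u, v) huv
      omega
  | succ i ih =>
    obtain h1 | ⟨v, huv, h1⟩ := (h.succ (i + 1) u).1
    · omega
    · have hv : L (i + 1) v < L i v := by
        by_contra hge
        have h2 : L (i + 1) u ≤ L i v + κ s(u, v) := (h.succ i u).2 (Or.inr ⟨v, huv, rfl⟩)
        omega
      have h3 := ih v hv
      have h4 := hk s(u, v) huv
      rw [h1, Nat.succ_mul]
      omega

/-- A later drop would leave a label of at least `(I + 1) * k`, yet strictly below the initial
label. -/
theorem fixed {k I : ℕ} (hk : ∀ e ∈ G.edgeSet, k ≤ κ e) (hI : ∀ u, init u ≤ (I + 1) * k)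
    (u : Fin n) : L (I + 1) u = L I u := by
  by_contra hne
  have hlt := lt_of_le_of_ne (h.succ_le I u) hne
  have h1 := h.le_of_lt hk I u hlt
  have h2 := h.le_init I u
  have h3 := hI u
  omega

end IsBellmanFord

/-- The labels are stable. -/
structure IsStable (G : SimpleGraph (Fin n)) (κ : Sym2 (Fin n) → ℕ) (init lab : Fin n → ℕ) :
    Prop where
  le_init : ∀ u, lab u ≤ init u
  le_adj : ∀ u v, G.Adj u v → lab u ≤ lab v + κ s(u, v)
  attained : ∀ u, lab u = init u ∨ ∃ v, G.Adj u v ∧ lab u = lab v + κ s(u, v)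

/-- During the iteration a label that is not initial exceeds or equals some neighbour's label plus
the edge cost, since labels only decrease; at the fixed point the reverse inequality holds as well.
-/
theorem IsBellmanFord.isStable {κ : Sym2 (Fin n) → ℕ} {init : Fin n → ℕ} {L : ℕ → Fin n → ℕ}
    (h : IsBellmanFord G κ init L) {k I : ℕ}
    (hk : ∀ e ∈ G.edgeSet, k ≤ κ e) (hI : ∀ u, init u ≤ (I + 1) * k) :
    IsStable G κ init (L I) := by
  have hfix := h.fixed hk hI
  refine ⟨h.le_init I, fun u v huv => ?_, ?_⟩
  · rw [← hfix u]
    exact (h.succ I u).2 (Or.inr ⟨v, huv, rfl⟩)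
  · have key : ∀ i u, L i u = init u ∨ ∃ v, G.Adj u v ∧ L i v + κ s(u, v) ≤ L i u := by
      intro i
      induction i with
      | zero => exact fun u => Or.inl (h.zero u)
      | succ i ih =>
        intro u
        obtain h1 | ⟨v, huv, h1⟩ := (h.succ i u).1
        · rcases ih u with h2 | ⟨v, huv, h2⟩
          · exact Or.inl (h1.trans h2)
          · refine Or.inr ⟨v, huv, ?_⟩
            have := h.succ_le i v
            omega
        · refine Or.inr ⟨v, huv, ?_⟩
          have := h.succ_le i v
          omega
    intro u
    rcases key I u with h1 | ⟨v, huv, h1⟩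
    · exact Or.inl h1
    · refine Or.inr ⟨v, huv, le_antisymm ?_ h1⟩
      rw [← hfix u]
      exact (h.succ I u).2 (Or.inr ⟨v, huv, rfl⟩)

namespace IsStable

variable {κ : Sym2 (Fin n) → ℕ} {init lab : Fin n → ℕ}

theorem le_walk (h : IsStable G κ init lab) {u v : Fin n} (p : G.Walk u v) :
    lab u ≤ lab v + walkWeight κ p := by
  induction p with
  | nil => simp
  | cons huv p ih =>
    rw [walkWeight_cons]
    have := h.le_adj _ _ huv
    omega

/-- Following edges that attain the labels decreases them strictly, so the process ends at a centre.
Every vertex on the way has the same centre, which is why clusters have small strong diameter. -/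
theorem exists_walk (h : IsStable G κ init lab) (hpos : ∀ e ∈ G.edgeSet, 0 < κ e) (u : Fin n) :
    ∃ (v : Fin n) (p : G.Walk u v), lab u = init v + walkWeight κ p ∧
      ∀ z ∈ p.support, ∃ q : G.Walk z v, lab z = init v + walkWeight κ q := by
  induction hl : lab u using Nat.strong_induction_on generalizing u with
  | _ N ih =>
    subst hl
    rcases h.attained u with h1 | ⟨x, hux, h1⟩
    · refine ⟨u, SimpleGraph.Walk.nil, by simpa [walkWeight] using h1, ?_⟩
      intro z hz
      simp only [SimpleGraph.Walk.support_nil, List.mem_singleton] at hz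
      subst hz
      exact ⟨SimpleGraph.Walk.nil, by simpa [walkWeight] using h1⟩
    · obtain ⟨v, p, hp, hz⟩ := ih (lab x) (by have := hpos s(u, x) hux; omega) x rfl
      have hw : lab u = init v + walkWeight κ (SimpleGraph.Walk.cons hux p) := by
        rw [walkWeight_cons, h1, hp]; ring
      refine ⟨v, SimpleGraph.Walk.cons hux p, hw, ?_⟩
      intro z hz'
      rw [SimpleGraph.Walk.support_cons, List.mem_cons] at hz'
      rcases hz' with rfl | hz'
      · exact ⟨_, hw⟩
      · exact hz z hz'

end IsStable

theorem walkWeight_mul (ν : ℕ) (κ : Sym2 (Fin n) → ℕ) {u v : Fin n} (p : G.Walk u v) :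
    walkWeight (fun e => ν * κ e) p = ν * walkWeight κ p := by
  induction p with
  | nil => simp [walkWeight]
  | cons huv p ih => rw [walkWeight_cons, walkWeight_cons, ih]; ring

/-- Two vertices in the same cluster are joined by a walk inside the cluster; its cost is at most
twice the largest shift. -/
theorem exists_walk_in_cluster {κ : Sym2 (Fin n) → ℕ} {sh id lab : Fin n → ℕ} {ν S : ℕ}
    (hpos : ∀ e ∈ G.edgeSet, 0 < κ e) (hid : ∀ u, id u < ν) (hinj : Function.Injective id)
    (hS : ∀ u, sh u ≤ S)
    (h : IsStable G (fun e => ν * κ e) (fun u => ν * sh u + id u) lab) {c : ℕ} {x y : Fin n}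
    (hx : lab x % ν = c) (hy : lab y % ν = c) :
    ∃ p : G.Walk x y, p.IsPath ∧ (∀ z ∈ p.support, lab z % ν = c) ∧
      ∃ q : G.Walk x y, walkWeight κ q ≤ 2 * S ∧ ∀ w : Sym2 (Fin n) → ℕ,
        walkWeight w p ≤ walkWeight w q := by
  have hν : 0 < ν := (Nat.zero_le _).trans_lt (hid x)
  have hpos' : ∀ e ∈ G.edgeSet, 0 < ν * κ e := fun e he => Nat.mul_pos hν (hpos e he)
  -- All terms except the name of the centre are multiples of `ν`.
  have hmod : ∀ z v (q : G.Walk z v), lab z = ν * sh v + id v + walkWeight (fun e => ν * κ e) q →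
      lab z % ν = id v := by
    intro z v q hq
    rw [hq, walkWeight_mul, show ν * sh v + id v + ν * walkWeight κ q =
      id v + ν * (sh v + walkWeight κ q) by ring, Nat.add_mul_mod_self_left,
      Nat.mod_eq_of_lt (hid v)]
  have hone : ∀ x : Fin n, ∃ (v : Fin n) (p : G.Walk x v), id v = lab x % ν ∧
      (∀ z ∈ p.support, lab z % ν = lab x % ν) ∧ walkWeight κ p ≤ S := by
    intro x
    obtain ⟨v, p, hp, hz⟩ := h.exists_walk hpos' x
    refine ⟨v, p, (hmod x v p hp).symm, ?_, ?_⟩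
    · intro z hzp
      obtain ⟨q, hq⟩ := hz z hzp
      rw [hmod z v q hq, hmod x v p hp]
    · have h1 := h.le_init x
      rw [hp, walkWeight_mul] at h1
      -- The label of `x` is at most its own initial label, which is less than `ν * (S + 1)`.
      have h2 : ν * (sh v + walkWeight κ p) < ν * (S + 1) := by
        have h3 : ν * sh x ≤ ν * S := Nat.mul_le_mul_left _ (hS x)
        have h4 := hid x
        rw [mul_add, mul_add, mul_one]
        omega
      have := Nat.lt_of_mul_lt_mul_left h2
      omega
  obtain ⟨v, p, hv, hp, hpS⟩ := hone x
  obtain ⟨v', q, hv', hq, hqS⟩ := hone y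
  obtain rfl : v = v' := hinj (by rw [hv, hv', hx, hy])
  -- Both the path and the walk it shortens are returned: the cost bound holds for the walk, and the
  -- path is no heavier under any weighting, in particular the original one.
  refine ⟨(p.append q.reverse).bypass, SimpleGraph.Walk.bypass_isPath _, ?_,
    p.append q.reverse, ?_, fun w => walkWeight_bypass_le _⟩
  · intro z hz
    have := SimpleGraph.Walk.support_bypass_subset_support _ hz
    rw [SimpleGraph.Walk.mem_support_append_iff, SimpleGraph.Walk.support_reverse,
      List.mem_reverse] at this
    rcases this with h1 | h1
    · rw [hp z h1, hx]
    · rw [hq z h1, hy]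
  · rw [walkWeight_append, walkWeight_reverse]
    omega

/-- The least cost of a walk from `u` to `v`, and `Z` if there is none. -/
noncomputable def walkDist (G : SimpleGraph (Fin n)) (κ : Sym2 (Fin n) → ℕ) (Z : ℕ) (u v : Fin n) :
    ℕ :=
  open Classical in
  if G.Reachable u v then sInf {x | ∃ p : G.Walk u v, x = walkWeight κ p} else Z

theorem walkDist_le (κ : Sym2 (Fin n) → ℕ) (Z : ℕ) {u v : Fin n} (p : G.Walk u v) :
    walkDist G κ Z u v ≤ walkWeight κ p := by
  rw [walkDist, if_pos ⟨p⟩]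
  exact Nat.sInf_le ⟨p, rfl⟩

theorem exists_walkDist (κ : Sym2 (Fin n) → ℕ) (Z : ℕ) {u v : Fin n}
    (h : walkDist G κ Z u v ≠ Z) : ∃ p : G.Walk u v, walkDist G κ Z u v = walkWeight κ p := by
  unfold walkDist at h ⊢
  split_ifs at h ⊢ with hr
  · obtain ⟨p⟩ := hr
    exact Nat.sInf_mem (s := {x | ∃ p : G.Walk u v, x = walkWeight κ p}) ⟨_, p, rfl⟩
  · exact absurd rfl h

/-- If one vertex `v` reaches `u` earlier than all others, by a margin of more than `2 * U`, then
all vertices at distance at most `U` from `u` belong to the cluster of `v`. -/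
theorem ball_subset_cluster {κ : Sym2 (Fin n) → ℕ} {sh id lab : Fin n → ℕ} {ν S U Z : ℕ}
    (hpos : ∀ e ∈ G.edgeSet, 0 < κ e) (hid : ∀ u, id u < ν)
    (hS : ∀ u, sh u ≤ S) (hZ : S < Z)
    (h : IsStable G (fun e => ν * κ e) (fun u => ν * sh u + id u) lab) {u v : Fin n}
    (hgap : ∀ x, x ≠ v → sh v + walkDist G κ Z u v + (2 * U + 1) ≤ sh x + walkDist G κ Z u x)
    {y : Fin n} (p : G.Walk u y) (hp : walkWeight κ p ≤ U) : lab y % ν = id v := by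
  have hν : 0 < ν := (Nat.zero_le _).trans_lt (hid y)
  have hpos' : ∀ e ∈ G.edgeSet, 0 < ν * κ e := fun e he => Nat.mul_pos hν (hpos e he)
  -- An unreachable vertex cannot win: `Z` exceeds all shifts, while `u` reaches itself at distance
  -- 0.
  have hdist : walkDist G κ Z u v ≠ Z := by
    intro hZ'
    by_cases huv : u = v
    · subst huv
      have := walkDist_le (G := G) κ Z (SimpleGraph.Walk.nil : G.Walk u u)
      simp [walkWeight] at this
      omega
    · have h1 := hgap u huv
      have h2 := walkDist_le (G := G) κ Z (SimpleGraph.Walk.nil : G.Walk u u)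
      have h3 : walkWeight κ (SimpleGraph.Walk.nil : G.Walk u u) = 0 := by simp [walkWeight]
      have := hS u
      omega
  obtain ⟨q, hq⟩ := exists_walkDist κ Z hdist
  obtain ⟨x, r, hr, -⟩ := h.exists_walk hpos' y
  have hmod : lab y % ν = id x := by
    rw [hr, walkWeight_mul, show ν * sh x + id x + ν * walkWeight κ r =
      id x + ν * (sh x + walkWeight κ r) by ring, Nat.add_mul_mod_self_left,
      Nat.mod_eq_of_lt (hid x)]
  rw [hmod]
  by_contra hne
  have hxv : x ≠ v := fun h => hne (by rw [h])
  have h1 := hgap x hxv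
  have h2 := walkDist_le κ Z (p.append r)
  rw [walkWeight_append] at h2
  have h3 := h.le_walk (p.reverse.append q)
  have h4 := h.le_init v
  rw [hr, walkWeight_mul, walkWeight_mul, walkWeight_append, walkWeight_reverse, ← hq] at h3
  -- Moving from `u` to `y` changes each distance by at most the cost of `p`, so of the margin `2 *
  -- U + 1` at least 1 remains, which outweighs any difference of names.
  have h5 : ν * (sh v + walkDist G κ Z u v + walkWeight κ p + 1) ≤ ν * (sh x + walkWeight κ r) :=
    Nat.mul_le_mul_left _ (by omega)
  have h6 := hid v
  simp only [mul_add, mul_one] at h3 h5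
  omega

end CoverLabel

/-! ### Probabilities -/

namespace CoverLabel

/-- Vertex `v` has the least shifted distance, by a margin of `Λ`. -/
def IsGapWinner {n : ℕ} (Λ : ℕ) (D : Fin n → ℕ) (f : Fin n → ℕ) (v : Fin n) : Prop :=
  ∀ x, x ≠ v → Nat.size (f v) * Λ + D v + Λ ≤ Nat.size (f x) * Λ + D x

theorem size_div_two {a : ℕ} (ha : a ≠ 0) : Nat.size a = Nat.size (a / 2) + 1 := by
  conv_lhs => rw [← Nat.bit_bodd_div2 a]
  rw [Nat.size_bit (by rw [Nat.bit_bodd_div2]; exact ha), Nat.div2_val]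

section

variable {n Q : ℕ}

/-- Overwriting the coordinate `v`, known to be zero, by an arbitrary value is injective. -/
theorem card_zero_mul_le (v : Fin n) :
    (Finset.univ.filter fun f : Fin n → Fin Q => (f v : ℕ) = 0).card * Q ≤ Q ^ n := by
  have h := Finset.card_le_card_of_injOn
    (s := (Finset.univ.filter fun f : Fin n → Fin Q => (f v : ℕ) = 0) ×ˢ
      (Finset.univ : Finset (Fin Q))) (t := (Finset.univ : Finset (Fin n → Fin Q)))
    (fun fa => Function.update fa.1 v fa.2) (fun _ _ => Finset.mem_coe.2 (Finset.mem_univ _)) (by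
      rintro ⟨f, a⟩ hf ⟨g, b⟩ hg hfg
      simp only [Finset.coe_product, Set.mem_prod, Finset.coe_filter, Finset.mem_univ, true_and,
        Set.mem_ofPred_eq, Finset.coe_univ, Set.mem_univ, and_true] at hf hg hfg
      have h1 : a = b := by simpa using congrFun hfg v
      subst h1
      congr 1
      funext x
      by_cases hx : x = v
      · subst hx; exact Fin.ext (hf.trans hg.symm)
      · simpa [hx] using congrFun hfg x)
  simpa [Finset.card_product] using h

-- Memorylessness of the shifts: halving the coin of a weak winner `v` lowers its shift by one unit
-- `Λ` and makes it win by that margin. The zero coin, which cannot be halved, has probability `1 /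
-- Q`.
open Classical in
theorem card_weak_le (Λ : ℕ) (D : Fin n → ℕ) (v : Fin n) :
    (Finset.univ.filter fun f : Fin n → Fin Q =>
      ∀ x, Nat.size (f v) * Λ + D v ≤ Nat.size (f x) * Λ + D x).card * Q ≤
    2 * (Finset.univ.filter fun f : Fin n → Fin Q =>
      IsGapWinner Λ D (fun x => f x) v).card * Q + Q ^ n := by
  let half : Fin Q → Fin Q := fun a => ⟨a / 2, (Nat.div_le_self _ _).trans_lt a.2⟩
  let W := Finset.univ.filter fun f : Fin n → Fin Q =>
      ∀ x, Nat.size (f v) * Λ + D v ≤ Nat.size (f x) * Λ + D x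
  let Gd := Finset.univ.filter fun f : Fin n → Fin Q => IsGapWinner Λ D (fun x => f x) v
  have h1 : (W.filter fun f => ¬ (f v : ℕ) = 0).card ≤ 2 * Gd.card := by
    refine Finset.card_le_mul_card_image_of_maps_to (f := fun f => Function.update f v (half (f v)))
      ?_ 2 ?_
    · intro f hf
      simp only [W, Gd, Finset.mem_filter, Finset.mem_univ, true_and] at hf ⊢
      intro x hx
      have h2 := hf.1 x
      have h3 : Nat.size (f v) = Nat.size ((half (f v) : Fin Q) : ℕ) + 1 := size_div_two hf.2
      simp only [Function.update_self, Function.update_of_ne hx]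
      rw [h3, Nat.succ_mul] at h2
      omega
    · intro g _
      -- Halving forgets only the parity of the coin of `v`, so a fibre has at most two elements.
      refine (Finset.card_le_card_of_injOn (t := Finset.range 2) (fun f => (f v : ℕ) % 2)
        (fun f _ => by simp only [Finset.coe_range, Set.mem_Iio]; omega) ?_).trans (by simp)
      intro f hf f' hf' hff
      simp only [Finset.coe_filter, Set.mem_ofPred_eq] at hf hf' hff
      have h2 := hf.2.trans hf'.2.symm
      funext x
      by_cases hx : x = v
      · subst hx
        have h3 := congrFun h2 x
        simp only [Function.update_self, half, Fin.mk.injEq] at h3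
        exact Fin.ext (by omega)
      · simpa [hx] using congrFun h2 x
  have h2 : W.card ≤ 2 * Gd.card +
      (Finset.univ.filter fun f : Fin n → Fin Q => (f v : ℕ) = 0).card := by
    rw [← Finset.card_filter_add_card_filter_not (s := W) fun f => (f v : ℕ) = 0, add_comm]
    exact Nat.add_le_add h1 (Finset.card_le_card (Finset.filter_subset_filter _
      (Finset.filter_subset _ _)))
  calc W.card * Q ≤ (2 * Gd.card +
        (Finset.univ.filter fun f : Fin n → Fin Q => (f v : ℕ) = 0).card) * Q :=
        Nat.mul_le_mul_right _ h2
    _ ≤ 2 * Gd.card * Q + Q ^ n := by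
        rw [add_mul]
        exact Nat.add_le_add_left (card_zero_mul_le v) _

open Classical in
/-- There is a vertex that wins by a large margin with probability at least `1 / 4`. -/
theorem card_gapWinner (hn : 0 < n) (hQ : 2 * n ≤ Q) {Λ : ℕ} (hΛ : 0 < Λ) (D : Fin n → ℕ) :
    Q ^ n ≤ 4 * (Finset.univ.filter fun f : Fin n → Fin Q =>
      ∃ v, IsGapWinner Λ D (fun x => f x) v).card := by
  have hQ0 : 0 < Q := by omega
  let W : Fin n → Finset (Fin n → Fin Q) := fun v => Finset.univ.filter fun f : Fin n → Fin Q =>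
      ∀ x, Nat.size (f v) * Λ + D v ≤ Nat.size (f x) * Λ + D x
  let Gd : Fin n → Finset (Fin n → Fin Q) := fun v =>
    Finset.univ.filter fun f : Fin n → Fin Q => IsGapWinner Λ D (fun x => f x) v
  have hW : Q ^ n ≤ ∑ v, (W v).card := by
    refine le_trans ?_ Finset.card_biUnion_le
    rw [show Q ^ n = (Finset.univ : Finset (Fin n → Fin Q)).card by simp]
    refine Finset.card_le_card fun f _ => ?_
    have : Nonempty (Fin n) := ⟨⟨0, hn⟩⟩
    obtain ⟨v, -, hv⟩ := Finset.exists_min_image Finset.univ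
      (fun x => Nat.size (f x) * Λ + D x) Finset.univ_nonempty
    exact Finset.mem_biUnion.2 ⟨v, Finset.mem_univ _, Finset.mem_filter.2
      ⟨Finset.mem_univ _, fun x => hv x (Finset.mem_univ _)⟩⟩
  have hG : ∑ v, (Gd v).card = (Finset.univ.filter fun f : Fin n → Fin Q =>
      ∃ v, IsGapWinner Λ D (fun x => f x) v).card := by
    rw [← Finset.card_biUnion]
    · congr 1
      ext f
      simp [Gd]
    · intro v _ v' _ hne
      rw [Function.onFun, Finset.disjoint_left]
      intro f hf hf'
      simp only [Gd, Finset.mem_filter, Finset.mem_univ, true_and] at hf hf'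
      -- Two vertices cannot both win by a positive margin, so the probabilities of the winners add
      -- up.
      have h1 := hf v' hne.symm
      have h2 := hf' v hne
      simp only at h1 h2
      omega
  have h1 : (∑ v, (W v).card) * Q ≤ 2 * (∑ v, (Gd v).card) * Q + n * Q ^ n := by
    have := Finset.sum_le_sum fun v (_ : v ∈ Finset.univ) => card_weak_le (Q := Q) Λ D v
    rw [Finset.sum_add_distrib, ← Finset.sum_mul, ← Finset.sum_mul, ← Finset.mul_sum] at this
    simpa using this
  rw [hG] at h1
  set g := (Finset.univ.filter fun f : Fin n → Fin Q =>
      ∃ v, IsGapWinner Λ D (fun x => f x) v).card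
  have h2 : Q ^ n * Q ≤ 2 * g * Q + n * Q ^ n := (Nat.mul_le_mul_right _ hW).trans h1
  -- The zero coins cost at most `n / Q ≤ 1 / 2` in total; the remaining half is at most twice the
  -- probability of a winner by margin.
  have h3 : 2 * n * Q ^ n ≤ Q * Q ^ n := Nat.mul_le_mul_right _ hQ
  refine Nat.le_of_mul_le_mul_right (?_ : _ * Q ≤ _ * Q) hQ0
  nlinarith

theorem card_bad_le (hn : 0 < n) (hQ : 2 * n ≤ Q) {Λ : ℕ} (hΛ : 0 < Λ) (D : Fin n → ℕ) :
    (Nat.card {f : Fin n → Fin Q // ¬ ∃ v, IsGapWinner Λ D (fun x => f x) v} : ℝ) ≤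
      3 / 4 * (Q : ℝ) ^ n := by
  classical
  have h1 := card_gapWinner hn hQ hΛ D
  have h2 := Finset.card_filter_add_card_filter_not (s := (Finset.univ : Finset (Fin n → Fin Q)))
    fun f : Fin n → Fin Q => ∃ v, IsGapWinner Λ D (fun x => f x) v
  rw [Nat.card_eq_fintype_card, Fintype.card_subtype]
  simp only [Finset.card_univ, Fintype.card_pi, Fintype.card_fin, Finset.prod_const] at h2
  have h1' : ((Q ^ n : ℕ) : ℝ) ≤ ((4 * (Finset.univ.filter fun f : Fin n → Fin Q =>
      ∃ v, IsGapWinner Λ D (fun x => f x) v).card : ℕ) : ℝ) := by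
    refine Nat.cast_le.2 ?_
    convert h1
  have h2' := congrArg (Nat.cast (R := ℝ)) h2
  push_cast at h1' h2'
  linarith

end

theorem card_forall_eq {T n Q : ℕ} (b : (Fin n → Fin Q) → Prop) :
    Nat.card {g : Fin T × Fin n → Fin Q // ∀ j, b fun v => g (j, v)} =
      Nat.card {f : Fin n → Fin Q // b f} ^ T := by
  let e : {g : Fin T × Fin n → Fin Q // ∀ j, b fun v => g (j, v)} ≃
      (Fin T → {f : Fin n → Fin Q // b f}) :=
    ((Equiv.curry (Fin T) (Fin n) (Fin Q)).subtypeEquiv fun g => Iff.rfl).trans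
      (Equiv.subtypePiEquivPi (p := fun _ f => b f))
  rw [Nat.card_congr e, Nat.card_fun, Nat.card_fin]

/-- Forgetting coordinates preserves the uniform distribution. -/
theorem card_comp_mul_le {Ω ι κ α : Type} [Finite Ω] [Finite κ] [Finite α]
    (flat : Ω ≃ (ι → α)) {e : κ → ι} (he : Function.Injective e) (P : (κ → α) → Prop) :
    Nat.card {ω : Ω // P fun k => flat ω (e k)} * Nat.card (κ → α) ≤
      Nat.card {g : κ → α // P g} * Nat.card Ω := by
  rw [← Nat.card_prod, ← Nat.card_prod]
  -- Exchange the selected coordinates of `ω` with `g`: the pair of the old coordinates and the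
  -- modified outcome determines `ω` and `g`.
  refine Nat.card_le_card_of_injective
    (fun x => (⟨fun k => flat x.1.1 (e k), x.1.2⟩,
      flat.symm (Function.extend e x.2 (flat x.1.1)))) ?_
  rintro ⟨⟨ω, hω⟩, g⟩ ⟨⟨ω', hω'⟩, g'⟩ h
  simp only [Prod.mk.injEq, Subtype.mk.injEq, EmbeddingLike.apply_eq_iff_eq] at h
  obtain ⟨h1, h2⟩ := h
  have hg : g = g' := by
    funext k
    have := congrFun h2 (e k)
    rwa [he.extend_apply, he.extend_apply] at this
  have hω : ω = ω' := by
    apply flat.injective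
    funext i
    by_cases hi : ∃ k, e k = i
    · obtain ⟨k, rfl⟩ := hi
      exact congrFun h1 k
    · have := congrFun h2 i
      rwa [Function.extend_apply' _ _ _ hi, Function.extend_apply' _ _ _ hi] at this
  subst hg hω
  rfl

/-- The probability that in each of `T` independent experiments, for some `u`, no vertex wins by a
large margin. -/
theorem prob_bad_le {Ω ι : Type} [Finite Ω] [Nonempty Ω] {T n Q : ℕ} (hn : 0 < n) (hQ : 2 * n ≤ Q)
    {Λ : ℕ} (hΛ : 0 < Λ) (D : Fin n → Fin n → ℕ) (flat : Ω ≃ (ι → Fin Q))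
    {e : Fin T × Fin n → ι} (he : Function.Injective e) :
    (Nat.card {ω : Ω // ∃ u, ∀ j, ¬ ∃ v, IsGapWinner Λ (D u) (fun x => flat ω (e (j, x))) v} : ℝ) ≤
      n * (3 / 4 : ℝ) ^ T * Nat.card Ω := by
  have hQ0 : 0 < Q := by omega
  have : Nonempty (Fin Q) := ⟨⟨0, hQ0⟩⟩
  -- For a fixed `u` the copies use disjoint sets of coins, so the failure probabilities multiply; a
  -- union bound over `u` follows.
  have hone : ∀ u, (Nat.card {ω : Ω // ∀ j, ¬ ∃ v, IsGapWinner Λ (D u)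
      (fun x => flat ω (e (j, x))) v} : ℝ) ≤ (3 / 4 : ℝ) ^ T * Nat.card Ω := by
    intro u
    have h1 := card_comp_mul_le flat he fun g : Fin T × Fin n → Fin Q =>
      ∀ j, ¬ ∃ v, IsGapWinner Λ (D u) (fun x => g (j, x)) v
    rw [card_forall_eq fun f => ¬ ∃ v, IsGapWinner Λ (D u) (fun x => f x) v] at h1
    have h2 : (Nat.card (Fin T × Fin n → Fin Q) : ℝ) = ((Q : ℝ) ^ n) ^ T := by
      rw [Nat.card_fun, Nat.card_prod, Nat.card_fin, Nat.card_fin, Nat.card_fin, ← pow_mul,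
        mul_comm n T]
      push_cast
      rfl
    have h3 := card_bad_le hn hQ hΛ (D u)
    have h4 := pow_le_pow_left₀ (Nat.cast_nonneg _) h3 T
    have h5 : (0 : ℝ) < ((Q : ℝ) ^ n) ^ T := by positivity
    have h1' := (Nat.cast_le (α := ℝ)).2 h1
    push_cast at h1'
    rw [h2] at h1'
    refine le_of_mul_le_mul_right (h1'.trans ?_) h5
    calc _ ≤ (3 / 4 * (Q : ℝ) ^ n) ^ T * Nat.card Ω :=
          mul_le_mul_of_nonneg_right h4 (Nat.cast_nonneg _)
      _ = _ := by rw [mul_pow]; ring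
  have hU : Nat.card {ω : Ω // ∃ u, ∀ j, ¬ ∃ v, IsGapWinner Λ (D u)
      (fun x => flat ω (e (j, x))) v} ≤ ∑ u, Nat.card {ω : Ω // ∀ j, ¬ ∃ v, IsGapWinner Λ (D u)
      (fun x => flat ω (e (j, x))) v} := by
    rw [← Nat.card_sigma]
    refine Nat.card_le_card_of_surjective (fun x => ⟨x.2.1, x.1, x.2.2⟩) ?_
    rintro ⟨ω, u, hu⟩
    exact ⟨⟨u, ω, hu⟩, rfl⟩
  calc _ ≤ ((∑ u, Nat.card {ω : Ω // ∀ j, ¬ ∃ v, IsGapWinner Λ (D u)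
      (fun x => flat ω (e (j, x))) v} : ℕ) : ℝ) := Nat.cast_le.2 hU
    _ ≤ ∑ _u : Fin n, (3 / 4 : ℝ) ^ T * Nat.card Ω := by
        push_cast
        exact Finset.sum_le_sum fun u _ => hone u
    _ = _ := by simp; ring

end CoverLabel

/-! ### Reading the clusters off the final memories. -/

namespace CellMachine

theorem mem_wordPairs_flatMap {ι : Type*} (P : ι → Prop) [DecidablePred P] (a b : ι → ℕ)
    (l : List ι) (x y : ℕ) :
    (x, y) ∈ wordPairs (l.flatMap fun o => if P o then [a o, b o] else []) ↔
      ∃ o ∈ l, P o ∧ a o = x ∧ b o = y := by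
  induction l with
  | nil => simp [wordPairs]
  | cons o l ih =>
    by_cases h : P o
    · simp [h, wordPairs, ih, eq_comm]
    · simp [h, ih]

/-- The output of a machine: for every record that stands for a node, the vertex and the name of its
cluster. -/
def writeOutput {d : ℕ} (n β ν : ℕ) (x : Fin (2 * d) → ℕ) : List ℕ :=
  (List.finRange d).flatMap fun o =>
    if x (mainSlot o) ≠ 0 ∧
        (Entry.dec β (x (mainSlot o))).src = (Entry.dec β (x (mainSlot o))).tgt then
      [(Entry.dec β (x (mainSlot o))).src % n, (Entry.dec β (x (mainSlot o))).lab % ν]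
    else []

theorem length_writeOutput_le {d : ℕ} (n β ν : ℕ) (x : Fin (2 * d) → ℕ) :
    (writeOutput n β ν x).length ≤ 2 * d := by
  rw [writeOutput, List.length_flatMap]
  refine (List.sum_le_card_nsmul _ 2 ?_).trans ?_
  · intro y hy
    obtain ⟨o, -, rfl⟩ := List.mem_map.1 hy
    split_ifs <;> simp
  · simp [mul_comm]

theorem lt_of_mem_writeOutput {d n β ν Q : ℕ} (hn : 0 < n) (hν : 0 < ν) (hnQ : n ≤ Q) (hνQ : ν ≤ Q)
    {x : Fin (2 * d) → ℕ} {y : ℕ} (hy : y ∈ writeOutput n β ν x) : y < Q := by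
  obtain ⟨o, -, ho⟩ := List.mem_flatMap.1 hy
  split_ifs at ho
  · simp only [List.mem_cons, List.not_mem_nil, or_false] at ho
    rcases ho with rfl | rfl
    · exact (Nat.mod_lt _ hn).trans_le hnQ
    · exact (Nat.mod_lt _ hν).trans_le hνQ
  · simp at ho

/-- The clusters that the machines output. -/
theorem outputClusters_writeOutput {M d n T β N : ℕ} (hN : N ≤ M * d)
    {R : LinkedEntries N} {l : Fin N → ℕ} {L : ℕ → ℕ}
    (hE : ∀ p, (R.entry l p).Bounded β) (hl : ∀ p, l p = L (R.s p)) (hs : ∀ p, R.s p < T * n)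
    (hex : ∀ s < T * n, ∃ p, R.s p = s ∧ R.t p = s) (c : ℕ) :
    outputClusters n (fun i => writeOutput n β (T * n) (ofArray M d (entryArray β (R.entry l)) i)) c
      = {v : Fin n | ∃ j < T, L (j * n + v) % (T * n) = c} := by
  ext v
  simp only [outputClusters, Set.mem_ofPred_eq, writeOutput, mem_wordPairs_flatMap,
    ofArray_mainSlot]
  constructor
  · rintro ⟨i, o, -, ⟨hne, -⟩, h1, h2⟩
    have hp : (i * d + o : ℕ) < N := by
      by_contra hp
      exact hne (pad_of_le _ (not_lt.1 hp))
    have h3 : entryArray β (R.entry l) (i * d + o) = (R.entry l ⟨_, hp⟩).code β :=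
      pad_val (fun p => (R.entry l p).code β) ⟨_, hp⟩
    rw [h3, Entry.dec_code (hE _)] at h1 h2
    set p : Fin N := ⟨_, hp⟩
    have h4 : R.s p % n = v := h1
    have h5 : l p % (T * n) = c := h2
    -- Node `j * n + v` stands for vertex `v` in copy `j`: quotient and remainder modulo `n` recover
    -- both.
    refine ⟨R.s p / n, Nat.div_lt_of_lt_mul (by rw [mul_comm]; exact hs p), ?_⟩
    rw [← h4, mul_comm, Nat.div_add_mod, ← hl, h5]
  · rintro ⟨j, hj, h⟩
    obtain ⟨p, hps, hpt⟩ := hex _ (node_lt hj v)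
    have hpM : (p : ℕ) < M * d := p.2.trans_le hN
    have hd : 0 < d := Nat.pos_of_mul_pos_left ((Nat.zero_le _).trans_lt hpM)
    have h3 : entryArray β (R.entry l) (p / d * d + p % d) = (R.entry l p).code β := by
      rw [Nat.div_add_mod']
      exact pad_val (fun p => (R.entry l p).code β) p
    refine ⟨⟨p / d, Nat.div_lt_of_lt_mul (by rwa [mul_comm])⟩, ⟨p % d, Nat.mod_lt _ hd⟩,
      List.mem_finRange _, ?_⟩
    simp only [h3, Entry.dec_code (hE p)]
    refine ⟨⟨Entry.code_ne_zero _ _, hps.trans hpt.symm⟩, ?_, ?_⟩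
    · change R.s p % n = v
      rw [hps, mul_comm, Nat.mul_add_mod, Nat.mod_eq_of_lt v.2]
    · change l p % (T * n) = c
      rw [hl, hps, h]

end CellMachine

/-! ### Edge costs for hop-limited balls, and the cover property of the labels. -/

namespace CoverLabel

open CellMachine

/-- The cost of an edge of weight `x`, for the hop bound `h` and the radius `r`; the coins have `b`
bits. -/
def edgeCost (b h r x : ℕ) : ℕ := if r = 0 then 2 * b + 1 else h * x + r

/-- The unit of the random shifts: larger than twice the cost of a walk with `h` hops and weight
`r`. -/
def shiftUnit (h r : ℕ) : ℕ := 2 * (2 * (h * r)) + 1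

theorem IsStable.exists_center {n : ℕ} {G : SimpleGraph (Fin n)} {κ : Sym2 (Fin n) → ℕ}
    {sh id lab : Fin n → ℕ} {ν : ℕ}
    (h : IsStable G (fun e => ν * κ e) (fun u => ν * sh u + id u) lab)
    (hpos : ∀ e ∈ G.edgeSet, 0 < κ e) (hid : ∀ u, id u < ν) (x : Fin n) :
    ∃ v, lab x % ν = id v := by
  have hν : 0 < ν := (Nat.zero_le _).trans_lt (hid x)
  obtain ⟨v, p, hp, -⟩ := h.exists_walk (fun e he => Nat.mul_pos hν (hpos e he)) x
  refine ⟨v, ?_⟩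
  rw [hp, walkWeight_mul, show ν * sh v + id v + ν * walkWeight κ p =
    id v + ν * (sh v + walkWeight κ p) by ring, Nat.add_mul_mod_self_left,
    Nat.mod_eq_of_lt (hid v)]

section

variable {n T b h r : ℕ} {G : SimpleGraph (Fin n)} {w : Sym2 (Fin n) → ℕ} {ζ : ℕ → ℕ}
  {L : ℕ → ℕ → ℕ}

theorem edgeCost_pos (x : ℕ) : 0 < edgeCost b h r x := by
  unfold edgeCost
  split_ifs <;> omega

/-- Where the number of iterations comes from: each edge costs at least `r` while shifts are at most
`b * (4 * h * r + 1)`, so after `5 * b * h` iterations every potential improvement is too long. -/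
theorem isStable_labeling (hh : 0 < h) (hb : ∀ s, Nat.size (ζ s) ≤ b)
    (hL : IsLabeling T (shiftUnit h r) (edgeCost b h r) G w ζ L) {j : ℕ} (hj : j < T) :
    IsStable G (fun e => T * n * edgeCost b h r (w e))
      (fun u => T * n * (Nat.size (ζ (j * n + u)) * shiftUnit h r) + (j * n + u))
      fun u => L (5 * b * h) (j * n + u) := by
  have hBF : IsBellmanFord G (fun e => T * n * edgeCost b h r (w e))
      (fun u => T * n * (Nat.size (ζ (j * n + u)) * shiftUnit h r) + (j * n + u))
      fun i u => L i (j * n + u) :=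
    ⟨fun u => hL.zero _ (node_lt hj u), fun i u => hL.succ i j hj u⟩
  refine hBF.isStable (k := T * n * if r = 0 then 2 * b + 1 else r) ?_ ?_
  · intro e _
    refine Nat.mul_le_mul_left _ ?_
    unfold edgeCost
    split_ifs <;> omega
  · intro u
    have h1 : Nat.size (ζ (j * n + u)) * shiftUnit h r ≤ b * shiftUnit h r :=
      Nat.mul_le_mul_right _ (hb _)
    have h2 := node_lt hj u
    -- The factor 5 is 4 from the shift unit and 1 from `b ≤ b * (h * r)`; the added 1 makes room
    -- for the name.
    have h3 : b * shiftUnit h r + 1 ≤ (5 * b * h + 1) * if r = 0 then 2 * b + 1 else r := by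
      unfold shiftUnit
      split_ifs with hr
      · subst hr
        nlinarith [Nat.zero_le (5 * b * h * (2 * b + 1))]
      · have h4 : b * 1 ≤ b * (h * r) :=
          Nat.mul_le_mul_left _ (Nat.mul_pos hh (Nat.pos_of_ne_zero hr))
        have h5 : 1 ≤ r := Nat.pos_of_ne_zero hr
        nlinarith
    calc _ ≤ T * n * (b * shiftUnit h r) + T * n :=
          Nat.add_le_add (Nat.mul_le_mul_left _ h1) h2.le
      _ = T * n * (b * shiftUnit h r + 1) := by ring
      _ ≤ _ := by
        rw [mul_left_comm]
        exact Nat.mul_le_mul_left _ h3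

theorem mul_walkWeight_add (w : Sym2 (Fin n) → ℕ) (h r : ℕ) {u v : Fin n} (p : G.Walk u v) :
    walkWeight (fun e => h * w e + r) p = h * walkWeight w p + p.length * r := by
  induction p with
  | nil => simp [walkWeight]
  | cons huv p ih => rw [walkWeight_cons, walkWeight_cons, ih, SimpleGraph.Walk.length_cons]; ring

theorem mul_length_le_walkWeight {k : ℕ} (hw : ∀ e ∈ G.edgeSet, k ≤ w e) {u v : Fin n}
    (p : G.Walk u v) : p.length * k ≤ walkWeight w p := by
  induction p with
  | nil => simp
  | cons huv p ih =>
    rw [walkWeight_cons, SimpleGraph.Walk.length_cons]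
    have := hw _ (G.mem_edgeSet.2 huv)
    nlinarith

theorem walkWeight_le_mul_length {k : ℕ} (hw : ∀ e ∈ G.edgeSet, w e ≤ k) {u v : Fin n}
    (p : G.Walk u v) : walkWeight w p ≤ p.length * k := by
  induction p with
  | nil => simp [walkWeight]
  | cons huv p ih =>
    rw [walkWeight_cons, SimpleGraph.Walk.length_cons]
    have := hw _ (G.mem_edgeSet.2 huv)
    nlinarith

/-- A walk that is cheap is short. -/
theorem walkWeight_le_of_edgeCost (hh : 0 < h) {u v : Fin n} (q : G.Walk u v)
    (hq : walkWeight (fun e => edgeCost b h r (w e)) q ≤ 2 * (b * shiftUnit h r)) :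
    walkWeight w q ≤ 10 * b * r := by
  rcases Nat.eq_zero_or_pos r with hr | hr
  · subst hr
    have h1 := mul_length_le_walkWeight (G := G) (w := fun e => edgeCost b h 0 (w e))
      (k := 2 * b + 1) (fun e _ => by simp [edgeCost]) q
    -- For `r = 0` the shift unit is 1, so one edge already costs more than `2 * b`, the whole
    -- budget.
    have h2 : q.length * (2 * b + 1) < 1 * (2 * b + 1) := by
      refine (h1.trans hq).trans_lt ?_
      simp [shiftUnit]
    have h3 : q.length = 0 := by
      have := Nat.lt_of_mul_lt_mul_right h2
      omega
    have h4 : q.edges = [] := List.length_eq_zero_iff.1 (by rw [SimpleGraph.Walk.length_edges, h3])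
    simp [walkWeight, h4]
  · have h1 : (fun e => edgeCost b h r (w e)) = fun e => h * w e + r := by
      funext e
      simp [edgeCost, hr.ne']
    rw [h1, mul_walkWeight_add] at hq
    refine Nat.le_of_mul_le_mul_left (?_ : h * _ ≤ h * _) hh
    -- Hence `2 * b * (4 * h * r + 1)` is at most `10 * b * h * r`, and `h` cancels.
    have h2 : b * 1 ≤ b * (h * r) := Nat.mul_le_mul_left _ (Nat.mul_pos hh hr)
    have h3 : h * walkWeight w q ≤ 2 * (b * shiftUnit h r) := (Nat.le_add_right _ _).trans hq
    unfold shiftUnit at h3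
    nlinarith

/-- If around every vertex, in one of the copies, one shifted distance is much smaller than the
others, then the clusters form a limited neighborhood cover. -/
theorem isLimitedNeighborhoodCover {a ℓ : ℕ} {W C : ℝ} (hW : 0 < W) (hn : 0 < n)
    (hℓ : 0 < ℓ) (hw : ∀ e ∈ G.edgeSet, 1 ≤ w e ∧ w e ≤ n ^ a)
    (hh : h = min ℓ n) (hr : r = min ⌊W⌋₊ (n ^ (a + 1))) (hb : ∀ s, Nat.size (ζ s) ≤ b)
    (hL : IsLabeling T (shiftUnit h r) (edgeCost b h r) G w ζ L)
    (hgap : ∀ u, ∃ j : Fin T, ∃ v, IsGapWinner (shiftUnit h r)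
      (walkDist G (fun e => edgeCost b h r (w e)) (b * shiftUnit h r + 1) u)
      (fun x => ζ (j * n + x)) v)
    (hCb : (10 * b : ℕ) ≤ C * Real.log n) (hCT : T ≤ C * Real.log n) :
    IsLimitedNeighborhoodCover G w ℓ W C
      fun c => {v | ∃ j < T, L (5 * b * h) (j * n + v) % (T * n) = c} := by
  have hh0 : 0 < h := by omega
  have hst := fun j hj => isStable_labeling (j := j) hh0 hb hL hj
  have hpos : ∀ e ∈ G.edgeSet, 0 < edgeCost b h r (w e) := fun e _ => edgeCost_pos _
  have hS : ∀ s, Nat.size (ζ s) * shiftUnit h r ≤ b * shiftUnit h r :=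
    fun s => Nat.mul_le_mul_right _ (hb s)
  have hrW : (r : ℝ) ≤ W := by
    rw [hr]
    exact (Nat.cast_le.2 (min_le_left _ _)).trans (Nat.floor_le hW.le)
  refine ⟨?_, ?_, ?_⟩
  · rintro c x ⟨j, hj, hx⟩ y ⟨j', hj', hy⟩
    obtain ⟨v, hv⟩ := (hst j hj).exists_center (κ := fun e => edgeCost b h r (w e)) hpos
      (fun u => node_lt hj u) x
    obtain ⟨v', hv'⟩ := (hst j' hj').exists_center (κ := fun e => edgeCost b h r (w e)) hpos
      (fun u => node_lt hj' u) y
    -- The name of a cluster is the node of its centre and thus contains the number of the copy, so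
    -- clusters of different copies have different names.
    have hjj : j = j' := by
      have h1 : j * n + v = j' * n + v' := by
        rw [← hv, ← hv']
        exact hx.trans hy.symm
      have h2 : ∀ i (u : Fin n), (i * n + u) / n = i := fun i u => by
        rw [mul_comm, Nat.mul_add_div hn, Nat.div_eq_of_lt u.2, add_zero]
      rw [← h2 j v, h1, h2]
    subst hjj
    obtain ⟨p, hp, hpc, q, hq, hpq⟩ := exists_walk_in_cluster
      (κ := fun e => edgeCost b h r (w e)) hpos (fun u => node_lt hj u)
      (fun u u' huu => Fin.ext (Nat.add_left_cancel huu)) (fun u => hS (j * n + u)) (hst j hj) hx hy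
    refine ⟨p, hp, fun z hz => ⟨j, hj, hpc z hz⟩, ?_⟩
    have h1 : walkWeight w p ≤ 10 * b * r := (hpq w).trans (walkWeight_le_of_edgeCost hh0 q hq)
    calc (walkWeight w p : ℝ) ≤ ((10 * b * r : ℕ) : ℝ) := Nat.cast_le.2 h1
      _ = ((10 * b : ℕ) : ℝ) * r := by push_cast; ring
      _ ≤ (C * Real.log n) * W :=
          mul_le_mul hCb hrW (Nat.cast_nonneg _) ((Nat.cast_nonneg _).trans hCb)
      _ = _ := by ring
  · intro v
    have h1 : {c | v ∈ {v : Fin n | ∃ j < T, L (5 * b * h) (j * n + v) % (T * n) = c}} =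
        ((Finset.range T).image fun j => L (5 * b * h) (j * n + v) % (T * n) : Finset ℕ) := by
      ext c
      simp
    rw [h1]
    refine ⟨Finset.finite_toSet _, le_trans (Nat.cast_le.2 ?_) hCT⟩
    rw [Set.ncard_coe_finset]
    exact Finset.card_image_le.trans (by simp)
  · intro u
    obtain ⟨j, v, hv⟩ := hgap u
    refine ⟨j * n + v, ?_⟩
    rintro y ⟨p, hp, hpℓ, hpW⟩
    refine ⟨j, j.2, ?_⟩
    refine ball_subset_cluster (κ := fun e => edgeCost b h r (w e)) (U := 2 * (h * r))
      (id := fun u => j * n + u) hpos (fun u => node_lt j.2 u) (fun u => hS (j * n + u))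
      (Nat.lt_succ_self _) (hst j j.2) hv p ?_
    -- A path has fewer than `n` edges, so replacing `ℓ` by `min ℓ n` loses nothing.
    have hlen : p.length ≤ h := by
      rw [hh]
      refine le_min hpℓ ?_
      have := hp.length_lt
      rw [Fintype.card_fin] at this
      exact this.le
    -- Weights are integers, so `W` may be rounded down, and no path weighs more than `n ^ (a + 1)`,
    -- so the cap is harmless.
    have hwr : walkWeight w p ≤ r := by
      rw [hr]
      refine le_min (Nat.le_floor hpW) ?_
      refine (walkWeight_le_mul_length (fun e he => (hw e he).2) p).trans ?_
      rw [pow_succ']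
      exact Nat.mul_le_mul_right _ (hlen.trans (by omega))
    rcases Nat.eq_zero_or_pos r with hr0 | hr0
    · have h1 := mul_length_le_walkWeight (fun e he => (hw e he).1) p
      have h4 : p.edges = [] := List.length_eq_zero_iff.1 (by
        rw [SimpleGraph.Walk.length_edges]; omega)
      simp [walkWeight, h4]
    · have h1 : (fun e => edgeCost b h r (w e)) = fun e => h * w e + r := by
        funext e
        simp [edgeCost, hr0.ne']
      rw [h1, mul_walkWeight_add]
      have h2 := Nat.mul_le_mul_left h hwr
      have h3 := Nat.mul_le_mul_right r hlen
      omega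

end

end CoverLabel

/-! ### The algorithm, its limits and its success probability. -/

namespace CoverLabel

open CellMachine

/-- The numerical conditions under which the algorithm works: there are `T` copies of the graph,
words have `b` bits, `h` and `r` are the effective hop bound and radius. -/
structure Admissible (a n m M d H mem K T β b B h r : ℕ) : Prop where
  params : Params M d H mem K
  cells : 2 * T * m + T * n ≤ M * d
  copies_pos : 0 < T
  two_le : 2 ≤ n
  input_le : 3 * d ≤ mem
  word : 2 * d * K ≤ 2 ^ b
  payload : (β ^ 5 + 1) * (2 * T * m + T * n + 1) < K
  size_le : 2 * T * m + T * n ≤ β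
  key_le : T * n * (T * n) ≤ 2 ^ B
  weight_lt : n ^ a < β
  cost_lt : ∀ x ≤ n ^ a,
    T * n * (b * shiftUnit h r) + T * n + T * n * edgeCost b h r x < β

/-- The algorithm for limited neighborhood covers. -/
def coverAlgorithm (n m M d H mem T β b B h r : ℕ) : MPCAlgorithm :=
  toAlgorithm mem (2 ^ b) (readInput M d β)
    (coverRounds M d H n m T β (shiftUnit h r) B (5 * b * h) (edgeCost b h r))
    (writeOutput n β (T * n))

section

variable {a n m M d H mem K T β b B h r : ℕ}

theorem Admissible.size_lt (hA : Admissible a n m M d H mem K T β b B h r) : T * n < 2 ^ b := by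
  have h1 := hA.size_le
  have h2 := hA.word
  have h3 : K ≤ 2 * d * K := Nat.le_mul_of_pos_left _ (by have := hA.params.block_pos; omega)
  have h4 : 1 * (2 * T * m + T * n + 1) ≤ (β ^ 5 + 1) * (2 * T * m + T * n + 1) :=
    Nat.mul_le_mul_right _ (by omega)
  have h5 := hA.payload
  omega

theorem Admissible.base_lt (hA : Admissible a n m M d H mem K T β b B h r) : β < 2 ^ b := by
  have h2 := hA.word
  have h3 : K ≤ 2 * d * K := Nat.le_mul_of_pos_left _ (by have := hA.params.block_pos; omega)
  have h4 : (β ^ 5 + 1) * 1 ≤ (β ^ 5 + 1) * (2 * T * m + T * n + 1) :=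
    Nat.mul_le_mul_left _ (by omega)
  have h5 := hA.payload
  have h6 : β ≤ β ^ 5 := Nat.le_self_pow (by norm_num) β
  omega

theorem coinFun_of_lt {mem Q : ℕ} (ρ : Fin mem → Fin Q) {o : ℕ} (ho : o < mem) :
    coinFun ρ o = ρ ⟨o, ho⟩ := dif_pos ho

theorem roundCoins_lt {M D mem b : ℕ} {inp : Fin M → List ℕ → Fin D → ℕ} {rs : List (Round M D)}
    {out : (Fin D → ℕ) → List ℕ} (ω : (toAlgorithm mem (2 ^ b) inp rs out).Coins) (t : ℕ)
    (i : Fin M) (o : ℕ) : roundCoins ω t i o < 2 ^ b := by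
  unfold roundCoins coinFun
  split_ifs
  · exact Fin.is_lt _
  · positivity
  · positivity

theorem cellCoin_lt {M d k : ℕ} (hk : 0 < k) {c : Fin M → ℕ → ℕ} (hc : ∀ i o, c i o < k) (p : ℕ) :
    cellCoin d c p < k := by
  unfold cellCoin
  split_ifs
  exacts [hc _ _, hk]

/-- The coins of an algorithm as a function of one variable. -/
def flatCoins (A : MPCAlgorithm) :
    A.Coins ≃ (Fin A.rounds × Fin A.machines × Fin A.memory → Fin A.wordSize) :=
  ((Equiv.refl (Fin A.rounds)).arrowCongr (Equiv.curry _ _ _).symm).trans (Equiv.curry _ _ _).symm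

/-- The coin that shifts a given vertex in a given copy. -/
theorem exists_coinIndex (hA : Admissible a n m M d H mem K T β b B h r) :
    ∃ e : Fin T × Fin n → Fin (coverAlgorithm n m M d H mem T β b B h r).rounds ×
        Fin (coverAlgorithm n m M d H mem T β b B h r).machines ×
        Fin (coverAlgorithm n m M d H mem T β b B h r).memory, Function.Injective e ∧
      ∀ ω : (coverAlgorithm n m M d H mem T β b B h r).Coins, ∀ (j : Fin T) (x : Fin n),
        (flatCoins _ ω (e (j, x)) : ℕ) =
          cellCoin d (roundCoins ω (2 * H + 5)) (2 * T * m + (j * n + x)) := by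
  have hd := hA.params.block_pos
  have hmem : d ≤ mem := by have := hA.input_le; omega
  have haddr : ∀ (j : Fin T) (x : Fin n), 2 * T * m + (j * n + x) < M * d := fun j x => by
    have := node_lt j.2 x
    have := hA.cells
    omega
  have hdiv : ∀ (j : Fin T) (x : Fin n), (2 * T * m + (j * n + x)) / d < M := fun j x =>
    Nat.div_lt_of_lt_mul ((haddr j x).trans_eq (mul_comm _ _))
  have hmod : ∀ p, p % d < mem := fun p => (Nat.mod_lt _ hd).trans_le hmem
  -- One more than the index within `coverRounds`, because the first round of the algorithm reads
  -- the input.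
  have hround : 2 * H + 5 + 1 < (coverRounds M d H n m T β (shiftUnit h r) B (5 * b * h)
      (edgeCost b h r)).length + 2 := by
    rw [length_coverRounds]
    omega
  refine ⟨fun y => (⟨2 * H + 5 + 1, hround⟩, ⟨(2 * T * m + (y.1 * n + y.2)) / d, hdiv y.1 y.2⟩,
    ⟨(2 * T * m + (y.1 * n + y.2)) % d, hmod _⟩), ?_, ?_⟩
  · rintro ⟨j, x⟩ ⟨j', x'⟩ hjx
    simp only [Prod.mk.injEq, true_and] at hjx
    have hq := congrArg Fin.val hjx.1
    have hm' := congrArg Fin.val hjx.2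
    dsimp only at hq hm'
    have h1 : 2 * T * m + (j * n + x) = 2 * T * m + (j' * n + x') := by
      rw [← Nat.div_add_mod (2 * T * m + (j * n + x)) d, hq, hm', Nat.div_add_mod]
    have h2 : (j : ℕ) * n + x = j' * n + x' := Nat.add_left_cancel h1
    have h3 : ∀ i (u : Fin n), (i * n + u) / n = i := fun i u => by
      rw [mul_comm, Nat.mul_add_div u.pos, Nat.div_eq_of_lt u.2, add_zero]
    have h4 : (j : ℕ) = j' := by rw [← h3 j x, h2, h3]
    have h5 : j = j' := Fin.ext h4
    subst h5
    exact Prod.ext rfl (Fin.ext (Nat.add_left_cancel h2))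
  · intro ω j x
    rw [cellCoin, dif_pos (hdiv j x), roundCoins_eq ω hround]
    exact (coinFun_of_lt _ (hmod _)).symm

/-- The algorithm obeys the limits of the model, and it outputs a limited neighborhood cover with
high probability. -/
theorem coverAlgorithm_spec (hA : Admissible a n m M d H mem K T β b B h r) {ℓ : ℕ} {W C : ℝ}
    (hW : 0 < W) (hℓ : 0 < ℓ) (hh : h = min ℓ n) (hr : r = min ⌊W⌋₊ (n ^ (a + 1)))
    (hCb : (10 * b : ℕ) ≤ C * Real.log n) (hCT : T ≤ C * Real.log n)
    {G : SimpleGraph (Fin n)} {w : Sym2 (Fin n) → ℕ} (hm : G.edgeSet.ncard = m)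
    (hw : ∀ e ∈ G.edgeSet, 1 ≤ w e ∧ w e ≤ n ^ a)
    {D : Fin M → List (Fin n × Fin n)}
    (hD : IsEdgeDistribution G D) (hlen : ∀ i, (D i).length ≤ d) :
    (coverAlgorithm n m M d H mem T β b B h r).ObeysLimits (edgeInput w D) ∧
      1 - n * (3 / 4 : ℝ) ^ T ≤
        (coverAlgorithm n m M d H mem T β b B h r).successProb (edgeInput w D) fun out =>
          IsLimitedNeighborhoodCover G w ℓ W C (outputClusters n out) := by
  have hn : 0 < n := by have := hA.two_le; omega
  have hT := hA.copies_pos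
  have hwβ : ∀ e ∈ G.edgeSet, w e < β := fun e he => (hw e he).2.trans_lt hA.weight_lt
  have hnT : n ≤ T * n := Nat.le_mul_of_pos_left n hT
  have hnβ : n ≤ β := by have := hA.size_le; omega
  have hνQ := hA.size_lt
  have hβQ := hA.base_lt
  have hmemE : ∀ i, ∀ e ∈ D i, s(e.1, e.2) ∈ G.edgeSet := fun i e he =>
    (hD.2 _).1 (List.mem_map.2 ⟨e, List.mem_flatMap.2 ⟨i, List.mem_finRange _, he⟩, rfl⟩)
  have hsize : ∀ (ω : (coverAlgorithm n m M d H mem T β b B h r).Coins) (s : ℕ),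
      Nat.size (cellCoin d (roundCoins ω (2 * H + 5)) (2 * T * m + s)) ≤ b := fun ω s =>
    Nat.size_le.2 (cellCoin_lt (by positivity) (roundCoins_lt ω _) _)
  have hexec := fun ω : (coverAlgorithm n m M d H mem T β b B h r).Coins =>
    -- The bound `A` holds for all coins, as a `b`-bit number has size at most `b`; this is why the
    -- limits are obeyed with certainty.
    coverRounds_exec (A := T * n * (b * shiftUnit h r) + T * n) (I := 5 * b * h) hA.params hA.cells
      hT hn hD hlen hm hwβ (c := roundCoins ω)
      (Λ := shiftUnit h r) (B := B) (cst := edgeCost b h r)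
      ⟨hA.payload, hA.size_le, hA.key_le, fun s hs => Nat.add_le_add (Nat.mul_le_mul_left _
        (Nat.mul_le_mul_right _ (hsize ω s))) hs.le,
        (Nat.le_add_right _ _).trans_lt (hA.cost_lt 0 (Nat.zero_le _)),
        fun u v huv => hA.cost_lt _ (hw _ (G.mem_edgeSet.2 huv)).2⟩
  choose R L l hE hbd hL hl hs hex using hexec
  have hpayload : β ^ 3 + 1 < K := by
    refine lt_of_le_of_lt ?_ hA.payload
    have h1 : β ^ 3 ≤ β ^ 5 := Nat.pow_le_pow_right (by omega) (by norm_num)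
    exact (Nat.add_le_add_right h1 1).trans (Nat.le_mul_of_pos_right _ (Nat.succ_pos _))
  obtain ⟨hobey, hout⟩ := toAlgorithm_spec (mem := mem) (K := K) (Q := 2 ^ b)
    (inp := readInput M d β) (out := writeOutput n β (T * n)) hA.params.mem_le hA.word
    (init := edgeInput w D)
    (by
      intro i
      have h1 : (edgeInput w D i).length = 3 * (D i).length := by
        simp [edgeInput, List.length_flatMap, mul_comm]
      rw [h1]
      exact (Nat.mul_le_mul_left 3 (hlen i)).trans hA.input_le)
    (by
      intro i x hx
      obtain ⟨e, he, hx⟩ := List.mem_flatMap.1 hx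
      simp only [List.mem_cons, List.not_mem_nil, or_false] at hx
      rcases hx with rfl | rfl | rfl
      · exact e.1.2.trans (by omega)
      · exact e.2.2.trans (by omega)
      · exact (hwβ _ (hmemE i e he)).trans hβQ)
    (by
      intro i s
      have h1 := congrFun (congrFun (readInput_eq (d := d) (β := β) w D) i) s
      rw [h1]
      unfold ofArray
      split_ifs
      · exact (inputArray_lt hD hnβ hwβ _).trans hpayload
      · omega)
    (fun ω => ofArray M d (entryArray β ((R ω).entry (l ω)))) hE
    (fun ω i => ⟨(length_writeOutput_le _ _ _ _).trans (by have := hA.input_le; omega),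
      fun x hx => lt_of_mem_writeOutput hn (Nat.mul_pos hT hn) (by omega) hνQ.le hx⟩)
  refine ⟨hobey, ?_⟩
  obtain ⟨e, he, hecoin⟩ := exists_coinIndex hA
  let A := coverAlgorithm n m M d H mem T β b B h r
  let Dst : Fin n → Fin n → ℕ := fun u =>
    walkDist G (fun e => edgeCost b h r (w e)) (b * shiftUnit h r + 1) u
  have : Nonempty A.Coins := ⟨fun _ _ _ => ⟨0, by change 0 < 2 ^ b; positivity⟩⟩
  have hbad := prob_bad_le (Ω := A.Coins) hn (Q := 2 ^ b) (Λ := shiftUnit h r) (T := T) (by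
      have h1 := hA.word
      have h2 : 2 * d * n ≤ 2 * d * K := Nat.mul_le_mul_left _ (by
        have h4 : 1 * (2 * T * m + T * n + 1) ≤ (β ^ 5 + 1) * (2 * T * m + T * n + 1) :=
          Nat.mul_le_mul_right _ (by omega)
        have h5 := hA.payload
        omega)
      have h3 : 2 * 1 * n ≤ 2 * d * n :=
        Nat.mul_le_mul_right _ (Nat.mul_le_mul_left _ hA.params.block_pos)
      omega) (Nat.succ_pos _) Dst (flatCoins A) he
  have hgood : ∀ ω : A.Coins, (¬ ∃ u, ∀ j, ¬ ∃ v, IsGapWinner (shiftUnit h r) (Dst u)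
      (fun x => flatCoins A ω (e (j, x))) v) →
      IsLimitedNeighborhoodCover G w ℓ W C (outputClusters n (A.output (edgeInput w D) ω)) := by
    intro ω hω
    push Not at hω
    have h1 : outputClusters n (A.output (edgeInput w D) ω) =
        fun c => {v : Fin n | ∃ j < T, L ω (5 * b * h) (j * n + v) % (T * n) = c} := by
      funext c
      rw [show A.output (edgeInput w D) ω = _ from hout ω]
      exact outputClusters_writeOutput hA.cells (hbd ω) (hl ω) (hs ω) (hex ω) c
    rw [h1]
    refine isLimitedNeighborhoodCover hW hn hℓ hw hh hr (hsize ω) (hL ω) ?_ hCb hCT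
    intro u
    obtain ⟨j, v, hv⟩ := hω u
    refine ⟨j, v, ?_⟩
    have h2 : (fun x => (flatCoins A ω (e (j, x)) : ℕ)) =
        fun x : Fin n => cellCoin d (roundCoins ω (2 * H + 5)) (2 * T * m + (j * n + x)) :=
      funext fun x => hecoin ω j x
    rw [← h2]
    exact hv
  have hcard : (0 : ℝ) < Nat.card A.Coins := Nat.cast_pos.2 Nat.card_pos
  have hsum : Nat.card A.Coins ≤ Nat.card {ω : A.Coins // IsLimitedNeighborhoodCover G w ℓ W C
      (outputClusters n (A.output (edgeInput w D) ω))} +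
      Nat.card {ω : A.Coins // ∃ u, ∀ j, ¬ ∃ v, IsGapWinner (shiftUnit h r) (Dst u)
        (fun x => flatCoins A ω (e (j, x))) v} := by
    rw [← Nat.card_sum]
    refine Nat.card_le_card_of_surjective (Sum.elim (fun x => x.1) fun x => x.1) fun ω => ?_
    by_cases hω : ∃ u, ∀ j, ¬ ∃ v, IsGapWinner (shiftUnit h r) (Dst u)
        (fun x => flatCoins A ω (e (j, x))) v
    · exact ⟨Sum.inr ⟨ω, hω⟩, rfl⟩
    · exact ⟨Sum.inl ⟨ω, hgood ω hω⟩, rfl⟩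
  have hsum' := (Nat.cast_le (α := ℝ)).2 hsum
  push_cast at hsum'
  rw [MPCAlgorithm.successProb, le_div_iff₀ hcard]
  calc (1 - n * (3 / 4 : ℝ) ^ T) * Nat.card A.Coins
      = Nat.card A.Coins - n * (3 / 4 : ℝ) ^ T * Nat.card A.Coins := by ring
    _ ≤ _ := sub_le_iff_le_add.2 (hsum'.trans (add_le_add le_rfl hbad))

end

end CoverLabel

/-! ### Choice of the parameters and the asymptotic bounds. -/

namespace CoverLabel

open CellMachine

/-- Constant factors are absorbed into exponents, so that all size estimates become comparisons of
powers of `y`, the least power of two that is at least `n`. -/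
theorem mul_pow_le_pow {y c i : ℕ} (hy : 2 ≤ y) (hc : c ≤ 2 ^ i) (j : ℕ) :
    c * y ^ j ≤ y ^ (j + i) := by
  rw [pow_add, mul_comm]
  exact Nat.mul_le_mul_left _ (hc.trans (Nat.pow_le_pow_left hy i))

section

variable {a k e n m s d q y T M : ℕ}

theorem copies_le (hy : y = 2 ^ q) (hq : 0 < q) (hT : T = 3 * (k + 1) * q) : T ≤ y ^ (k + 3) := by
  have hy2 : 2 ≤ y := hy ▸ Nat.le_self_pow hq.ne' 2
  have h1 : q ≤ y ^ 1 := by rw [pow_one, hy]; exact Nat.lt_two_pow_self.le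
  have h2 : 3 * (k + 1) ≤ 2 ^ (k + 2) := by
    have : k + 1 ≤ 2 ^ k := Nat.lt_two_pow_self
    rw [pow_add]
    omega
  calc T ≤ 3 * (k + 1) * y ^ 1 := hT ▸ Nat.mul_le_mul_left _ h1
    _ ≤ y ^ (1 + (k + 2)) := mul_pow_le_pow hy2 h2 1
    _ = y ^ (k + 3) := by congr 1; omega

theorem copies_mul_le (hy : y = 2 ^ q) (hq : 0 < q) (hT : T = 3 * (k + 1) * q) (hny : n ≤ y)
    (hmn : m ≤ n ^ 2) : T * m ≤ y ^ (k + 5) :=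
  calc T * m ≤ y ^ (k + 3) * y ^ 2 :=
        Nat.mul_le_mul (copies_le hy hq hT) (hmn.trans (Nat.pow_le_pow_left hny 2))
    _ = y ^ (k + 5) := by rw [← pow_add]

theorem machines_le (hy : y = 2 ^ q) (hq : 0 < q) (hT : T = 3 * (k + 1) * q) (hny : n ≤ y)
    (hmn : m ≤ n ^ 2) (hM : M = 4 * T * m / s + 1) : M ≤ y ^ (k + 8) := by
  have hy2 : 2 ≤ y := hy ▸ Nat.le_self_pow hq.ne' 2
  have h1 := copies_mul_le hy hq hT hny hmn
  have h2 : 4 * T * m / s ≤ 4 * T * m := Nat.div_le_self _ _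
  have h3 : 1 ≤ y ^ (k + 5) := Nat.one_le_pow _ _ (by omega)
  have h4 := mul_pow_le_pow hy2 (by norm_num : 8 ≤ 2 ^ 3) (k + 5)
  rw [mul_assoc] at h2
  rw [mul_assoc] at hM
  have h5 : y ^ (k + 5 + 3) = y ^ (k + 8) := rfl
  omega

/-- The choice of the parameters. -/
theorem admissible {h r H b β : ℕ} (hy : y = 2 ^ q) (hq : 0 < q) (hT : T = 3 * (k + 1) * q)
    (he : e = a + k + 20) (hβ : β = y ^ (4 * e)) (hb : b = 32 * e * q) (hn : 2 ≤ n) (hny : n ≤ y)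
    (hnm : n ≤ 2 * m) (hmn : m ≤ n ^ 2) (hs : 0 < s) (hsn : s ≤ n) (hd : d = max 2 s)
    (hM : M = 4 * T * m / s + 1) (hH : M ≤ d ^ H) (hh : h ≤ n) (hr : r ≤ n ^ (a + 1)) :
    Admissible a n m M d H (3 * d) (β ^ 7) T β b b h r := by
  have hy2 : 2 ≤ y := hy ▸ Nat.le_self_pow hq.ne' 2
  have hT0 : 0 < T := by rw [hT]; positivity
  have hTm := copies_mul_le hy hq hT hny hmn
  have hMy := machines_le hy hq hT hny hmn hM
  have hpow : ∀ i j, i ≤ j → y ^ i ≤ y ^ j := fun i j hij => Nat.pow_le_pow_right (by omega) hij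
  have hplt : ∀ i j, i < j → y ^ i < y ^ j := fun i j hij => Nat.pow_lt_pow_right (by omega) hij
  have hTn : T * n ≤ 2 * (T * m) := by
    rw [mul_left_comm]
    exact Nat.mul_le_mul_left _ hnm
  have hTny : T * n ≤ y ^ (k + 4) := by
    rw [show k + 4 = k + 3 + 1 from rfl, pow_succ]
    exact Nat.mul_le_mul (copies_le hy hq hT) hny
  have hN : 2 * T * m + T * n ≤ y ^ (k + 7) := by
    have := mul_pow_le_pow hy2 (by norm_num : 4 ≤ 2 ^ 2) (k + 5)
    have h5 : y ^ (k + 5 + 2) = y ^ (k + 7) := rfl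
    rw [mul_assoc]
    omega
  have hNβ : 2 * T * m + T * n ≤ β := hN.trans (hβ ▸ hpow _ _ (by omega))
  have hβ8 : 8 ≤ β := by
    rw [hβ]
    exact (Nat.pow_le_pow_left hy2 3).trans (hpow 3 _ (by omega))
  have hdy : 2 * d ≤ y ^ 3 := by
    have h1 : d ≤ 2 * y := by rw [hd]; omega
    have h2 := mul_pow_le_pow hy2 (by norm_num : 4 ≤ 2 ^ 2) 1
    rw [pow_one] at h2
    have h5 : y ^ (1 + 2) = y ^ 3 := rfl
    omega
  -- A payload is below `β ^ 7` and the slot number takes one more factor `β`.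
  have hwordeq : 2 ^ b = β ^ 8 := by
    rw [hβ, hy, ← pow_mul, ← pow_mul, hb]
    congr 1
    ring
  have hby : b ≤ y ^ (e + 6) := by
    have h1 : q ≤ y := hy ▸ Nat.lt_two_pow_self.le
    -- Costs involve `b`, which in turn depends on `e`. Bounding `e` by `y ^ e` uses up only part of
    -- the exponent `4 * e` of `β`.
    have h2 : e ≤ y ^ e := Nat.lt_two_pow_self.le.trans (Nat.pow_le_pow_left hy2 e)
    calc b ≤ 32 * y ^ e * y := hb ▸ Nat.mul_le_mul (Nat.mul_le_mul_left _ h2) h1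
      _ = 32 * y ^ (e + 1) := by ring
      _ ≤ y ^ (e + 1 + 5) := mul_pow_le_pow hy2 (by norm_num) _
  have hr' : r ≤ y ^ (a + 1) := hr.trans (Nat.pow_le_pow_left hny _)
  have hΛ : shiftUnit h r ≤ y ^ (a + 5) := by
    have h1 : h * r ≤ y ^ (a + 2) := by
      rw [pow_succ' y (a + 1)]
      exact Nat.mul_le_mul (hh.trans hny) hr'
    have h2 := mul_pow_le_pow hy2 (by norm_num : 5 ≤ 2 ^ 3) (a + 2)
    have h3 : 1 ≤ y ^ (a + 2) := Nat.one_le_pow _ _ (by omega)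
    have h5 : y ^ (a + 2 + 3) = y ^ (a + 5) := rfl
    unfold shiftUnit
    omega
  refine ⟨⟨?_, ?_, hH, ?_⟩, ?_, hT0, hn, le_rfl, ?_, ?_, hNβ, ?_, ?_, ?_⟩
  · omega
  · omega
  · calc M * d ≤ y ^ (k + 8) * y ^ 3 := Nat.mul_le_mul hMy (by omega)
      _ = y ^ (k + 11) := by rw [← pow_add]
      _ < y ^ (4 * e) := hplt _ _ (by omega)
      _ = β ^ 1 := by rw [pow_one, hβ]
      _ ≤ β ^ 7 := Nat.pow_le_pow_right (by omega) (by norm_num)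
  · have h1 : 4 * T * m < M * s := by
      rw [hM, add_mul, one_mul]
      exact Nat.lt_div_mul_add hs
    have h2 : M * s ≤ M * d := Nat.mul_le_mul_left _ (hd ▸ le_max_right _ _)
    rw [mul_assoc] at h1 ⊢
    omega
  · rw [hwordeq, pow_succ' β 7]
    exact Nat.mul_le_mul_right _ (hdy.trans (hβ ▸ hpow _ _ (by omega)))
  · have h1 : 1 ≤ β ^ 5 := Nat.one_le_pow _ _ (by omega)
    calc (β ^ 5 + 1) * (2 * T * m + T * n + 1) ≤ (2 * β ^ 5) * (2 * β) :=
          Nat.mul_le_mul (by omega) (by omega)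
      _ = 4 * β ^ 6 := by ring
      _ < β * β ^ 6 := Nat.mul_lt_mul_of_pos_right (by omega) (by positivity)
      _ = β ^ 7 := by ring
  · have h1 : T * n ≤ β := (Nat.le_add_left _ _).trans hNβ
    calc T * n * (T * n) ≤ β * β := Nat.mul_le_mul h1 h1
      _ = β ^ 2 := by ring
      _ ≤ 2 ^ b := hwordeq ▸ Nat.pow_le_pow_right (by omega) (by norm_num)
  · exact (Nat.pow_le_pow_left hny a).trans_lt (hβ ▸ hplt _ _ (by omega))
  · intro x hx
    have hcost : edgeCost b h r x ≤ y ^ (e + a + 11) := by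
      have h1 : edgeCost b h r x ≤ 2 * b + 1 + (h * x + r) := by
        unfold edgeCost
        split_ifs <;> omega
      have h2 : h * x ≤ y ^ (a + 1) := by
        rw [pow_succ']
        exact Nat.mul_le_mul (hh.trans hny) (hx.trans (Nat.pow_le_pow_left hny a))
      have h3 : y ^ (a + 1) ≤ y ^ (e + a + 7) := hpow _ _ (by omega)
      have h4 : y ^ (e + 6) ≤ y ^ (e + a + 7) := hpow _ _ (by omega)
      have h5 := mul_pow_le_pow hy2 (by norm_num : 5 ≤ 2 ^ 4) (e + a + 7)
      have h6 : 1 ≤ y ^ (e + a + 7) := Nat.one_le_pow _ _ (by omega)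
      have h7 : y ^ (e + a + 7 + 4) = y ^ (e + a + 11) := rfl
      omega
    have hbΛ : b * shiftUnit h r ≤ y ^ (e + a + 11) := by
      rw [show e + a + 11 = e + 6 + (a + 5) by omega, pow_add]
      exact Nat.mul_le_mul hby hΛ
    have h1 : 1 ≤ y ^ (e + a + 11) := Nat.one_le_pow _ _ (by omega)
    calc T * n * (b * shiftUnit h r) + T * n + T * n * edgeCost b h r x
        = T * n * (b * shiftUnit h r + 1 + edgeCost b h r x) := by ring
      _ ≤ y ^ (k + 4) * (3 * y ^ (e + a + 11)) := Nat.mul_le_mul hTny (by omega)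
      _ = 3 * y ^ (e + a + k + 15) := by ring
      _ ≤ y ^ (e + a + k + 15 + 2) := mul_pow_le_pow hy2 (by norm_num) _
      _ < y ^ (4 * e) := hplt _ _ (by omega)
      _ = β := hβ.symm

/-- Three copies more than halve the failure probability, so `3 * (k + 1) * q` copies push it below
`y ^ -(k + 1)`; one factor `n` pays for the union bound. -/
theorem mul_three_quarters_pow_le (hy : y = 2 ^ q) (hT : T = 3 * (k + 1) * q) (hn : 2 ≤ n)
    (hny : n ≤ y) : (n : ℝ) * (3 / 4 : ℝ) ^ T ≤ 1 / (n : ℝ) ^ k := by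
  have hn0 : (0 : ℝ) < n := by positivity
  have h1 : (3 / 4 : ℝ) ^ T ≤ 1 / (n : ℝ) ^ (k + 1) :=
    calc (3 / 4 : ℝ) ^ T = ((3 / 4 : ℝ) ^ 3) ^ ((k + 1) * q) := by rw [hT, ← pow_mul, mul_assoc]
      _ ≤ (1 / 2 : ℝ) ^ ((k + 1) * q) := pow_le_pow_left₀ (by norm_num) (by norm_num) _
      _ = 1 / (y : ℝ) ^ (k + 1) := by
        rw [hy, one_div_pow, Nat.cast_pow, ← pow_mul, mul_comm q]
        norm_num
      _ ≤ 1 / (n : ℝ) ^ (k + 1) := by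
        have : (n : ℝ) ≤ y := Nat.cast_le.2 hny
        gcongr
  calc (n : ℝ) * (3 / 4 : ℝ) ^ T ≤ n * (1 / (n : ℝ) ^ (k + 1)) := by gcongr
    _ = 1 / (n : ℝ) ^ k := by rw [pow_succ]; field_simp

theorem clog_le_log (hn : 2 ≤ n) : (Nat.clog 2 n : ℝ) ≤ 3 * Real.log n := by
  have h2 : Real.log 2 ≤ Real.log n := Real.log_le_log (by norm_num) (by exact_mod_cast hn)
  have h1 : ((Nat.clog 2 n - 1 : ℕ) : ℝ) * Real.log 2 ≤ Real.log n := by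
    rw [← Real.log_pow]
    refine Real.log_le_log (by positivity) ?_
    exact_mod_cast (Nat.pow_pred_clog_lt_self (by norm_num) (by omega)).le
  have h3 : 0 < Nat.clog 2 n := Nat.clog_pos (by norm_num) hn
  rw [Nat.cast_sub h3] at h1
  have h4 := Real.log_two_gt_d9
  have h5 : (0 : ℝ) ≤ Nat.clog 2 n := Nat.cast_nonneg _
  push_cast at h1
  nlinarith

theorem two_pow_clog_le (hn : 2 ≤ n) : 2 ^ Nat.clog 2 n ≤ n ^ 2 := by
  have h1 := Nat.pow_pred_clog_lt_self (b := 2) (by norm_num) (show 1 < n by omega)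
  have h3 : 0 < Nat.clog 2 n := Nat.clog_pos (by norm_num) hn
  calc 2 ^ Nat.clog 2 n = 2 ^ (Nat.clog 2 n).pred * 2 := by
        rw [← pow_succ, ← Nat.succ_eq_add_one, Nat.succ_pred_eq_of_pos h3]
    _ ≤ n * n := Nat.mul_le_mul h1.le hn
    _ = n ^ 2 := by ring

/-- Trees of degree `max 2 ⌊n ^ γ⌋` and of depth `O(1 / γ)` have polynomially many leaves. -/
theorem pow_le_pow_height {γ : ℝ} (hγ : 0 < γ) (hn : 1 ≤ n) (E : ℕ)
    (hd : d = max 2 ⌊(n : ℝ) ^ γ⌋₊) : n ^ E ≤ d ^ (2 * ⌈(E : ℝ) / γ⌉₊) := by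
  have hn1 : (1 : ℝ) ≤ n := by exact_mod_cast hn
  have h1 : (n : ℝ) ^ γ ≤ (d : ℝ) ^ 2 := by
    have h2 := Nat.lt_floor_add_one ((n : ℝ) ^ γ)
    -- Squaring `d ≥ 2` makes up for the rounding, which is why the height carries a factor 2.
    have h3 : ⌊(n : ℝ) ^ γ⌋₊ + 1 ≤ d ^ 2 := by
      have h4 : 2 ≤ d := hd ▸ le_max_left _ _
      have h5 : ⌊(n : ℝ) ^ γ⌋₊ ≤ d := hd ▸ le_max_right _ _
      nlinarith
    exact h2.le.trans (by exact_mod_cast h3)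
  have h2 : (n : ℝ) ^ (E : ℝ) ≤ ((n : ℝ) ^ γ) ^ (⌈(E : ℝ) / γ⌉₊) := by
    rw [← Real.rpow_natCast, ← Real.rpow_mul (by positivity)]
    refine Real.rpow_le_rpow_of_exponent_le hn1 ?_
    rw [← div_le_iff₀' hγ]
    exact Nat.le_ceil _
  have h3 : (n : ℝ) ^ E ≤ (d : ℝ) ^ (2 * ⌈(E : ℝ) / γ⌉₊) := by
    rw [← Real.rpow_natCast, pow_mul]
    exact h2.trans (pow_le_pow_left₀ (by positivity) h1 _)
  exact_mod_cast h3

theorem rounds_le {H b h β Λ : ℕ} {cst : ℕ → ℕ} (hb : 0 < b) (hh : 0 < h) :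
    (coverRounds M d H n m T β Λ b (5 * b * h) cst).length + 2 ≤ 30 * (b * h * (H + 3)) := by
  rw [length_coverRounds]
  have h1 : 1 * (H + 3) ≤ b * h * (H + 3) := Nat.mul_le_mul_right _ (Nat.mul_pos hb hh)
  have h2 : b * (H + 3) ≤ b * h * (H + 3) :=
    Nat.mul_le_mul_right _ (Nat.le_mul_of_pos_right _ hh)
  have h3 : (2 * H + 7) * (5 * b * h) ≤ 15 * (b * h * (H + 3)) := by
    calc (2 * H + 7) * (5 * b * h) ≤ (3 * (H + 3)) * (5 * b * h) :=
          Nat.mul_le_mul_right _ (by omega)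
      _ = _ := by ring
  omega

end

end CoverLabel

theorem SimpleGraph.ncard_edgeSet_le_sq {n : ℕ} (G : SimpleGraph (Fin n)) :
    G.edgeSet.ncard ≤ n ^ 2 := by
  classical
  rw [← SimpleGraph.coe_edgeFinset, Set.ncard_coe_finset]
  refine G.card_edgeFinset_le_card_choose_two.trans ?_
  rw [Fintype.card_fin]
  exact Nat.choose_le_pow n 2

open CoverLabel in
theorem mainTheorem6 (a k : ℕ) :
    ∃ C : ℕ, ∀ (γ : ℝ), 0 < γ → γ ≤ 1 → ∀ (n m ℓ : ℕ) (W : ℝ),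
      2 ≤ n → n ≤ 2 * m → 1 ≤ ℓ → 0 < W →
      ∃ A : MPCAlgorithm,
        -- rounds, memory per machine, overall memory (in words), words of `O(log n)` bits
        (A.rounds : ℝ) ≤ C * ((ℓ : ℝ) / γ * Real.log n) ∧
        (A.memory : ℝ) ≤ C * (n : ℝ) ^ γ ∧
        (A.machines : ℝ) * (A.memory : ℝ) ≤ C * (m * Real.log n ^ 2) ∧
        A.wordSize ≤ n ^ C ∧
        -- there are enough machines to hold the input with at most `n ^ γ` edges on each
        m ≤ A.machines * ⌊(n : ℝ) ^ γ⌋₊ ∧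
        ∀ (G : SimpleGraph (Fin n)) (w : Sym2 (Fin n) → ℕ),
          G.edgeSet.ncard = m →
          (∀ e ∈ G.edgeSet, 1 ≤ w e ∧ w e ≤ n ^ a) →
          ∀ D : Fin A.machines → List (Fin n × Fin n),
            IsEdgeDistribution G D →
            (∀ i, (D i).length ≤ ⌊(n : ℝ) ^ γ⌋₊) →
            A.ObeysLimits (edgeInput w D) ∧
            1 - 1 / (n : ℝ) ^ k ≤ A.successProb (edgeInput w D) fun out =>
              IsLimitedNeighborhoodCover G w ℓ W C (outputClusters n out) := by
  obtain ⟨e, he⟩ : ∃ e, e = a + k + 20 := ⟨_, rfl⟩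
  -- The round bound is the tightest: 30 from `rounds_le` times 96 from `b ≤ 96 * e * log n` is
  -- 2880, and `H + 3 ≤ (4 * k + 37) / γ`.
  obtain ⟨C, hC⟩ : ∃ C, C = 3000 * e * (4 * k + 37) := ⟨_, rfl⟩
  have hCe : 3000 * e ≤ C := by rw [hC]; exact Nat.le_mul_of_pos_right _ (by omega)
  have hek : k + 20 ≤ e := by omega
  refine ⟨C, fun γ hγ hγ1 n m ℓ W hn hnm hℓ hW => ?_⟩
  have hn1 : (1 : ℝ) ≤ n := by exact_mod_cast (by omega : 1 ≤ n)
  have hx1 : (1 : ℝ) ≤ (n : ℝ) ^ γ := Real.one_le_rpow hn1 hγ.le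
  obtain ⟨s, hs⟩ : ∃ s, s = ⌊(n : ℝ) ^ γ⌋₊ := ⟨_, rfl⟩
  have hs0 : 0 < s := hs ▸ Nat.floor_pos.2 hx1
  have hlog : 1 ≤ 2 * Real.log n := by
    have h1 : Real.log 2 ≤ Real.log n := Real.log_le_log (by norm_num) (by exact_mod_cast hn)
    have := Real.log_two_gt_d9
    linarith
  rcases Nat.lt_or_ge (n ^ 2) m with hmn | hmn
  · -- There are no graphs with so many edges.
    refine ⟨⟨m, 0, 0, 0, fun _ _ _ _ _ => []⟩, ?_, ?_, ?_, Nat.zero_le _, ?_, ?_⟩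
    · rw [Nat.cast_zero]
      have : 0 ≤ Real.log n := by linarith
      positivity
    · rw [Nat.cast_zero]
      positivity
    · rw [Nat.cast_zero, mul_zero]
      positivity
    · rw [← hs]
      exact Nat.le_mul_of_pos_right _ hs0
    · intro G w hG
      exact absurd G.ncard_edgeSet_le_sq (by omega)
  have hsx : (s : ℝ) ≤ (n : ℝ) ^ γ := hs ▸ Nat.floor_le (by positivity)
  have hsn : s ≤ n := by
    have h1 : (n : ℝ) ^ γ ≤ n := by
      simpa using Real.rpow_le_rpow_of_exponent_le hn1 hγ1
    exact_mod_cast hsx.trans h1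
  obtain ⟨q, hq⟩ : ∃ q, q = Nat.clog 2 n := ⟨_, rfl⟩
  have hq0 : 0 < q := hq ▸ Nat.clog_pos (by norm_num) hn
  have hqlog : (q : ℝ) ≤ 3 * Real.log n := hq ▸ clog_le_log hn
  obtain ⟨y, hy⟩ : ∃ y, y = 2 ^ q := ⟨_, rfl⟩
  have hny : n ≤ y := by rw [hy, hq]; exact Nat.le_pow_clog (by norm_num) n
  have hyn : y ≤ n ^ 2 := by rw [hy, hq]; exact two_pow_clog_le hn
  obtain ⟨T, hT⟩ : ∃ T, T = 3 * (k + 1) * q := ⟨_, rfl⟩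
  obtain ⟨b, hb⟩ : ∃ b, b = 32 * e * q := ⟨_, rfl⟩
  obtain ⟨d, hd⟩ : ∃ d, d = max 2 s := ⟨_, rfl⟩
  obtain ⟨M, hM⟩ : ∃ M, M = 4 * T * m / s + 1 := ⟨_, rfl⟩
  -- There are at most `y ^ (k + 8)` machines, and `y` is at most `n ^ 2`.
  obtain ⟨H, hH⟩ : ∃ H, H = 2 * ⌈((2 * (k + 8) : ℕ) : ℝ) / γ⌉₊ := ⟨_, rfl⟩
  obtain ⟨h, hh⟩ : ∃ h, h = min ℓ n := ⟨_, rfl⟩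
  obtain ⟨r, hr⟩ : ∃ r, r = min ⌊W⌋₊ (n ^ (a + 1)) := ⟨_, rfl⟩
  have hT0 : 0 < T := by rw [hT]; positivity
  have hb0 : 0 < b := hb ▸ Nat.mul_pos (by omega) hq0
  have hMd : M ≤ d ^ H := by
    refine (machines_le hy hq0 hT hny hmn hM).trans ((Nat.pow_le_pow_left hyn _).trans ?_)
    rw [← pow_mul, hH]
    exact pow_le_pow_height hγ (by omega) _ (hs ▸ hd)
  have hA := admissible (h := h) (r := r) hy hq0 hT he rfl hb hn hny hnm hmn hs0 hsn hd hM hMd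
    (by omega) (by omega)
  have hbC : (10 * b : ℕ) ≤ C * Real.log n := by
    rw [hb]
    have h1 : (3000 * e : ℝ) ≤ C := by exact_mod_cast hCe
    have h2 : (0 : ℝ) ≤ e := Nat.cast_nonneg _
    push_cast
    nlinarith
  have hTlog : (T : ℝ) ≤ 9 * e * Real.log n := by
    have h1 : (k : ℝ) + 1 ≤ e := by exact_mod_cast (by omega : k + 1 ≤ e)
    have h2 : (0 : ℝ) ≤ (k : ℝ) + 1 := by positivity
    rw [hT]
    push_cast
    nlinarith
  have hCe' : (3000 * e : ℝ) ≤ C := by exact_mod_cast hCe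
  have he1 : (1 : ℝ) ≤ e := by exact_mod_cast (by omega : 1 ≤ e)
  have hTC : (T : ℝ) ≤ C * Real.log n := by nlinarith
  refine ⟨coverAlgorithm n m M d H (3 * d) T (y ^ (4 * e)) b b h r, ?_, ?_, ?_, ?_, ?_, ?_⟩
  · have h1 : (coverAlgorithm n m M d H (3 * d) T (y ^ (4 * e)) b b h r).rounds ≤
        30 * (b * h * (H + 3)) := rounds_le hb0 (by omega)
    have h2 : ((H + 3 : ℕ) : ℝ) ≤ (4 * k + 37) / γ := by
      have h3 := Nat.ceil_lt_add_one (a := ((2 * (k + 8) : ℕ) : ℝ) / γ) (by positivity)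
      have h4 : 1 ≤ 1 / γ := by rwa [le_div_iff₀ hγ, one_mul]
      rw [hH]
      push_cast at h3 ⊢
      calc _ ≤ 2 * (2 * ((k : ℝ) + 8) / γ + 1) + 3 := by linarith
        _ ≤ 2 * (2 * ((k : ℝ) + 8) / γ) + 5 * (1 / γ) := by linarith
        _ = _ := by ring
    have h3 : (b : ℝ) ≤ 96 * e * Real.log n := by
      rw [hb]
      push_cast
      nlinarith
    have h4 : (h : ℝ) ≤ ℓ := by exact_mod_cast (by omega : h ≤ ℓ)
    have h5 : (0 : ℝ) ≤ Real.log n := by linarith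
    calc ((coverAlgorithm n m M d H (3 * d) T (y ^ (4 * e)) b b h r).rounds : ℝ)
        ≤ ((30 * (b * h * (H + 3)) : ℕ) : ℝ) := Nat.cast_le.2 h1
      _ = 30 * (b * h * ((H + 3 : ℕ) : ℝ)) := by push_cast; ring
      _ ≤ 30 * (96 * e * Real.log n * ℓ * ((4 * k + 37) / γ)) := by gcongr
      _ = 2880 * e * (4 * k + 37) * (ℓ / γ * Real.log n) := by ring
      _ ≤ 3000 * e * (4 * k + 37) * (ℓ / γ * Real.log n) := by gcongr; norm_num
      _ = C * (ℓ / γ * Real.log n) := by rw [hC]; push_cast; ring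
  · change ((3 * d : ℕ) : ℝ) ≤ _
    have h1 : (d : ℝ) ≤ 2 * (n : ℝ) ^ γ := by
      rw [hd, Nat.cast_max]
      refine max_le ?_ ?_
      · push_cast; linarith
      · linarith
    push_cast
    nlinarith
  · change (M : ℝ) * ((3 * d : ℕ) : ℝ) ≤ _
    have h1 : M * s ≤ 6 * (T * m) := by
      have h2 : 4 * T * m / s * s ≤ 4 * T * m := Nat.div_mul_le_self _ _
      -- The machine added by rounding up is paid for by `s ≤ n ≤ 2 * m`.
      have h3 : s ≤ 2 * (T * m) := (hsn.trans hnm).trans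
        (Nat.mul_le_mul_left _ (Nat.le_mul_of_pos_left _ hT0))
      rw [hM, add_mul, one_mul]
      rw [mul_assoc 4] at h2 ⊢
      omega
    have h2 : M * (3 * d) ≤ 36 * (T * m) := by
      have h3 : M * d ≤ M * (2 * s) := Nat.mul_le_mul_left _ (by omega)
      rw [mul_left_comm] at h3 ⊢
      omega
    have h5 : (0 : ℝ) ≤ Real.log n := by linarith
    calc (M : ℝ) * ((3 * d : ℕ) : ℝ) = ((M * (3 * d) : ℕ) : ℝ) := by push_cast; ring
      _ ≤ ((36 * (T * m) : ℕ) : ℝ) := Nat.cast_le.2 h2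
      _ = 36 * (T * m) * 1 := by push_cast; ring
      -- One logarithm suffices here; the second enters only through `1 ≤ 2 * log n`.
      _ ≤ 36 * (9 * e * Real.log n * m) * (2 * Real.log n) := by gcongr
      _ = 648 * e * (m * Real.log n ^ 2) := by ring
      _ ≤ 3000 * e * (m * Real.log n ^ 2) := by gcongr; norm_num
      _ ≤ C * (m * Real.log n ^ 2) := by gcongr
  · change 2 ^ b ≤ n ^ C
    calc 2 ^ b = y ^ (32 * e) := by rw [hy, ← pow_mul, hb, mul_comm]
      _ ≤ (n ^ 2) ^ (32 * e) := Nat.pow_le_pow_left hyn _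
      _ = n ^ (2 * (32 * e)) := by rw [← pow_mul]
      _ ≤ n ^ C := Nat.pow_le_pow_right (by omega) (by omega)
  · change m ≤ M * ⌊(n : ℝ) ^ γ⌋₊
    rw [← hs]
    have h1 : 4 * T * m < M * s := by
      rw [hM, add_mul, one_mul]
      exact Nat.lt_div_mul_add hs0
    have h2 : m ≤ 4 * T * m := Nat.le_mul_of_pos_left _ (by omega)
    omega
  · intro G w hG hw D hD hlen
    have hspec := coverAlgorithm_spec hA hW hℓ hh hr hbC hTC hG hw hD
      fun i => (hlen i).trans (by rw [← hs, hd]; exact le_max_right _ _)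
    refine ⟨hspec.1, le_trans ?_ hspec.2⟩
    have := mul_three_quarters_pow_le hy hT hn hny
    linarith
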